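/- Let $\mathbb T=\mathbb R/2\pi\mathbb Z$, $\langle a\rangle=(1+a^2)^{1/2}$, and for $f$ on $\mathbb T\times\mathbb R$ put $\widehat f(k,\xi)=\frac1{2\pi}\iint e^{-i(kx+\xi y)}f\,dx\,dy$ (in the sense of distributions) and $\|f\|_{H^r_xH^s_y}^2=\sum_{k\in\mathbb Z}\int_{\mathbb R}\langle k\rangle^{2r}\langle\xi\rangle^{2s}|\widehat f(k,\xi)|^2d\xi$. Let $m_->0$, $e>0$, and consider the linearized electron Euler–Poisson system $$\partial_t\eta+y\partial_x\eta+\nabla\cdot u=0,\qquad \partial_tu+y\partial_xu+\binom{u^y}{0}+\tfrac1{m_-}\nabla\eta=\tfrac e{m_-}\nabla\phi,\qquad \Delta\phi=4\pi e\,\eta$$ on $[0,\infty)\times\mathbb T\times\mathbb R$. A smooth solution is a triple $(\eta,u,\phi)$ of real functions, $C^\infty$ on $[0,\infty)\times\mathbb T\times\mathbb R$, whose $L^2(\mathbb T\times\mathbb R)$ norms are bounded on bounded time intervals, and which satisfies the system. Write $\psi=\nabla\cdot u$, $\omega=-\partial_yu^x+\partial_xu^y$, $\mathbb Q[u]=\nabla\Delta^{-1}\psi$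 and let $\eta^{in},\psi^{in},\omega^{in}$ be the values at $t=0$. For $k\in\mathbb Z$, $\xi\in\mathbb R$ let $\alpha(t)=k^2+(\xi-kt)^2$, $$L(t)=\begin{pmatrix}-\frac{\partial_t\alpha}{4\alpha}&-\frac{\alpha^{1/2}}{\sqrt{m_-}}\\ \frac{4\pi e^2}{\sqrt{m_-}\alpha^{1/2}}+\frac{2k^2\sqrt{m_-}}{\alpha^{3/2}}+\frac{\alpha^{1/2}}{\sqrt{m_-}}&\frac{\partial_t\alpha}{4\alpha}\end{pmatrix},\quad M(t)=\begin{pmatrix}0\\-\frac{2k^2}{\alpha^{7/4}}\end{pmatrix},\quad B^{in}=\begin{pmatrix}\frac{\widehat{\eta^{in}}}{\sqrt{m_-}(k^2+\xi^2)^{1/4}}\\ \frac{\widehat{\psi^{in}}}{(k^2+\xi^2)^{3/4}}\end{pmatrix},$$ let $S_L(t,s)$ be the solution operator of $X'=L(t)X$, put $F^{in}=\eta^{in}+\omega^{in}$, and define $$\mathcal C^{in}_\sigma(t)=\Big(\sum_k\int\langle\xi\rangle^{-1}\Big|B^{in}+\int_0^tS_L(0,s)M(s)\,ds\,\widehat{F^{in}}\Big|^2d\xi\Big)^{1/2}.$$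 **Theorem 1.4.** There are constants $c,K>0$ depending only on $m_-$ and $e$ such that for every smooth solution with $\eta^{in},\omega^{in}\in L^2_xH^{-1/2}_y$, $\psi^{in}\in H^{-3/2}_xH^{-2}_y$ and with $\eta^{in},\psi^{in},\omega^{in}$ of zero average in $x$ for every $y$, and for all $t\ge0$, $$\|\mathbb Q[u](t)\|_{L^2}+m_-^{-1/2}\|\eta(t)\|_{L^2}\ \ge\ c\,\mathcal C^{in}_\sigma(t)\,\langle t\rangle^{1/2},$$ where the quantity $\mathcal C^{in}_\sigma(t)$, determined by the initial data, is bounded below through Sobolev norms of the data: $$c\big(\|\eta^{in}\|_{H^{-1/2}_xH^{-1}_y}+\|\psi^{in}\|_{H^{-3/2}_xH^{-2}_y}\big)\ \le\ \mathcal C^{in}_\sigma(t)+K\,\|\eta^{in}+\omega^{in}\|_{L^2_xH^{-1/2}_y}.$$ -/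

import Mathlib

open MeasureTheory Set
open scoped ENNReal ContDiff

/-!
Functions on the strip `𝕋 × ℝ`, `𝕋 = ℝ / 2πℤ`, are functions `ℝ → ℝ → ℝ` of `x` and `y` that are
`2π`-periodic in `x`.
-/

namespace ElectronCouette

noncomputable section

/-- The Japanese bracket `⟨a⟩ = (1 + a²)^{1/2}`. -/
def jap (a : ℝ) : ℝ := Real.sqrt (1 + a ^ 2)

/-- `∂_x f` for a function of `(x, y)`. -/
def dx (f : ℝ → ℝ → ℝ) (x y : ℝ) : ℝ := deriv (fun x' => f x' y) x

/-- `∂_y f` for a function of `(x, y)`. -/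
def dy (f : ℝ → ℝ → ℝ) (x y : ℝ) : ℝ := deriv (fun y' => f x y') y

/-- `∇ · u`. -/
def divergence (u₁ u₂ : ℝ → ℝ → ℝ) (x y : ℝ) : ℝ := dx u₁ x y + dy u₂ x y

/-- `∇^⊥ · u` with `∇^⊥ = (-∂_y, ∂_x)`. -/
def vorticity (u₁ u₂ : ℝ → ℝ → ℝ) (x y : ℝ) : ℝ := -dy u₁ x y + dx u₂ x y

/-- The `L²(𝕋 × ℝ)` norm, computed on one period. -/
def l2Norm (f : ℝ → ℝ → ℝ) : ℝ≥0∞ :=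
  eLpNorm (fun p : ℝ × ℝ => f p.1 p.2) 2
    (volume.restrict (Ioc 0 (2 * Real.pi) ×ˢ (univ : Set ℝ)))

/-- The average in `x` vanishes identically. -/
def ZeroAverage (f : ℝ → ℝ → ℝ) : Prop :=
  ∀ y, (1 / (2 * Real.pi)) * ∫ x in (0 : ℝ)..(2 * Real.pi), f x y = 0

/-! ### Fourier transform and anisotropic Sobolev norms -/

/-- `g` is the Fourier transform
`g(k, ξ) = (1/2π) ∬_{𝕋×ℝ} e^{-i(kx+ξy)} f(x,y) dx dy` of `f`, in the sense of distributions: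
`g(k, ·)` is a tempered function, and the `k`-th Fourier integral
`∫_𝕋 e^{-ikx} f(x, y) dx` equals `∫ e^{iξy} g(k, ξ) dξ` when tested against smooth compactly
supported functions of `y`. Such a `g` is unique up to null sets of `ξ`. -/
def IsFourierTransform (f : ℝ → ℝ → ℝ) (g : ℤ → ℝ → ℂ) : Prop :=
  (∀ k, AEStronglyMeasurable (g k) volume) ∧
  (∀ k, ∃ N : ℕ, Integrable (fun ξ : ℝ => ‖g k ξ‖ / (1 + ξ ^ 2) ^ N) volume) ∧
  ∀ k : ℤ, ∀ χ : ℝ → ℂ, ContDiff ℝ ∞ χ → HasCompactSupport χ →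
    ∫ y : ℝ, (∫ x in (0 : ℝ)..(2 * Real.pi),
        Complex.exp (-(Complex.I * (k : ℂ) * (x : ℂ))) * (f x y : ℂ)) * χ y =
      ∫ ξ : ℝ, g k ξ * ∫ y : ℝ, Complex.exp (Complex.I * (ξ : ℂ) * (y : ℂ)) * χ y

open Classical in
/-- The Fourier transform `f̂(k, ξ)` (well defined up to null sets of `ξ`). -/
def fourier (f : ℝ → ℝ → ℝ) : ℤ → ℝ → ℂ :=
  if h : ∃ g, IsFourierTransform f g then h.choose else 0

/-- The norm `(∑_k ∫ ⟨k⟩^{2r} ⟨ξ⟩^{2s} |G(k, ξ)|² dξ)^{1/2}` of a (vector valued) function on the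
frequency side. -/
def specNorm {E : Type} [NormedAddCommGroup E] (r s : ℝ) (G : ℤ → ℝ → E) : ℝ≥0∞ :=
  (∑' k : ℤ, ∫⁻ ξ : ℝ,
    ENNReal.ofReal (jap (k : ℝ) ^ (2 * r) * jap ξ ^ (2 * s) * ‖G k ξ‖ ^ 2)) ^ (1 / 2 : ℝ)

/-- `‖f‖_{H^r_x H^s_y}`. -/
def sobolevNorm (r s : ℝ) (f : ℝ → ℝ → ℝ) : ℝ≥0∞ := specNorm r s (fourier f)

/-- `f ∈ H^r_x H^s_y`. -/
def MemSobolev (r s : ℝ) (f : ℝ → ℝ → ℝ) : Prop :=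
  (∃ g, IsFourierTransform f g) ∧ sobolevNorm r s f < ⊤

/-- The Fourier transform of `ℚ[u] = ∇ Δ⁻¹ ψ`, `ψ = ∇ · u`; here `∇` has symbol `(ik, iξ)` and
`Δ⁻¹` has symbol `-1 / (k² + ξ²)`. -/
def fourierQ (u₁ u₂ : ℝ → ℝ → ℝ) (k : ℤ) (ξ : ℝ) : EuclideanSpace ℂ (Fin 2) :=
  !₂[Complex.I * (k : ℂ) * (-(1 / ((k : ℂ) ^ 2 + (ξ : ℂ) ^ 2)) * fourier (divergence u₁ u₂) k ξ),
    Complex.I * (ξ : ℂ) * (-(1 / ((k : ℂ) ^ 2 + (ξ : ℂ) ^ 2)) * fourier (divergence u₁ u₂) k ξ)]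

/-- `‖ℚ[u]‖_{L²}`, where `L² = H^0_x H^0_y`. -/
def normQ (u₁ u₂ : ℝ → ℝ → ℝ) : ℝ≥0∞ := specNorm 0 0 (fourierQ u₁ u₂)

/-! ### Smooth solutions of the linearized electron system -/

/-- An admissible unknown on `[0, ∞) × 𝕋 × ℝ`: smooth up to `t = 0`, `2π`-periodic in `x`, and in
`L²(𝕋 × ℝ)` with a norm that is bounded on bounded time intervals. -/
structure IsSmoothL2 (f : ℝ → ℝ → ℝ → ℝ) : Prop where
  smooth : ContDiffOn ℝ ∞ (fun p : ℝ × ℝ × ℝ => f p.1 p.2.1 p.2.2) (Ici (0 : ℝ) ×ˢ univ)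
  periodic : ∀ t, 0 ≤ t → ∀ x y, f t (x + 2 * Real.pi) y = f t x y
  bounded : ∀ T : ℝ, ∃ K : ℝ≥0∞, K < ⊤ ∧ ∀ t ∈ Icc 0 T, l2Norm (f t) ≤ K

/-- `(η, u, φ)` with `u = (u₁, u₂)` is a smooth solution of the electron Euler-Poisson system
linearized around the Couette flow, with electron mass `m` and charge `e`. -/
structure IsSmoothSolution (m e : ℝ) (η u₁ u₂ φ : ℝ → ℝ → ℝ → ℝ) : Prop where
  density : IsSmoothL2 η
  velocity_x : IsSmoothL2 u₁
  velocity_y : IsSmoothL2 u₂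
  potential : IsSmoothL2 φ
  continuity : ∀ t, 0 < t → ∀ x y,
    deriv (fun s => η s x y) t + y * dx (η t) x y + divergence (u₁ t) (u₂ t) x y = 0
  momentum_x : ∀ t, 0 < t → ∀ x y,
    deriv (fun s => u₁ s x y) t + y * dx (u₁ t) x y + u₂ t x y + 1 / m * dx (η t) x y
      = e / m * dx (φ t) x y
  momentum_y : ∀ t, 0 < t → ∀ x y,
    deriv (fun s => u₂ s x y) t + y * dx (u₂ t) x y + 1 / m * dy (η t) x y
      = e / m * dy (φ t) x y
  poisson : ∀ t, 0 ≤ t → ∀ x y,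
    dx (dx (φ t)) x y + dy (dy (φ t)) x y = 4 * Real.pi * e * η t x y

/-! ### The functional of the initial data in the lower bound -/

/-- `α(t, k, ξ) = k² + (ξ - kt)²`. -/
def alpha (k : ℤ) (ξ t : ℝ) : ℝ := (k : ℝ) ^ 2 + (ξ - k * t) ^ 2

/-- `∂_t α(t, k, ξ) = -2k(ξ - kt)`. -/
def alphaDot (k : ℤ) (ξ t : ℝ) : ℝ := -2 * k * (ξ - k * t)

/-- The coefficient matrix `L(t)` at the frequency `(k, ξ)`. -/
def coeffL (m e : ℝ) (k : ℤ) (ξ t : ℝ) : Matrix (Fin 2) (Fin 2) ℝ :=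
  !![-(1 / 4) * (alphaDot k ξ t / alpha k ξ t),
      -(Real.sqrt (1 / m) * alpha k ξ t ^ (1 / 2 : ℝ));
    4 * Real.pi * e ^ 2 / (Real.sqrt m * alpha k ξ t ^ (1 / 2 : ℝ))
        + 2 * (k : ℝ) ^ 2 * Real.sqrt m / alpha k ξ t ^ (3 / 2 : ℝ)
        + Real.sqrt (1 / m) * alpha k ξ t ^ (1 / 2 : ℝ),
      1 / 4 * (alphaDot k ξ t / alpha k ξ t)]

/-- The forcing vector `M(t) = (0, -2k² / α^{7/4})`. -/
def forcingM (k : ℤ) (ξ t : ℝ) : Fin 2 → ℝ :=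
  ![0, -(2 * (k : ℝ) ^ 2 / alpha k ξ t ^ (7 / 4 : ℝ))]

/-- `Φ` is the fundamental matrix, normalized at time `0`, of `X' = L(t) X`. -/
def IsFundamentalMatrix (L Φ : ℝ → Matrix (Fin 2) (Fin 2) ℝ) : Prop :=
  Φ 0 = 1 ∧ ∀ (t : ℝ) (i j : Fin 2), HasDerivAt (fun s => Φ s i j) ((L t * Φ t) i j) t

open Classical in
/-- The fundamental matrix (it is unique, and it exists when `L` is continuous). -/
def fundamentalMatrix (L : ℝ → Matrix (Fin 2) (Fin 2) ℝ) : ℝ → Matrix (Fin 2) (Fin 2) ℝ :=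
  if h : ∃ Φ, IsFundamentalMatrix L Φ then h.choose else 0

/-- The solution operator `S_L(t, s)` of `X' = L X` at the frequency `(k, ξ)`. -/
def solOp (m e : ℝ) (k : ℤ) (ξ t s : ℝ) : Matrix (Fin 2) (Fin 2) ℝ :=
  fundamentalMatrix (coeffL m e k ξ) t * (fundamentalMatrix (coeffL m e k ξ) s)⁻¹

/-- The weighted initial datum
`B^in = (η̂^in / (√m (k²+ξ²)^{1/4}), ψ̂^in / (k²+ξ²)^{3/4})`. -/
def initB (m : ℝ) (η₀ ψ₀ : ℝ → ℝ → ℝ) (k : ℤ) (ξ : ℝ) : Fin 2 → ℂ :=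
  ![fourier η₀ k ξ / ((Real.sqrt m * ((k : ℝ) ^ 2 + ξ ^ 2) ^ (1 / 4 : ℝ) : ℝ) : ℂ),
    fourier ψ₀ k ξ / ((((k : ℝ) ^ 2 + ξ ^ 2) ^ (3 / 4 : ℝ) : ℝ) : ℂ)]

/-- `R(t, B^in, F^in) = B^in + ∫_0^t S_L(0, s) M(s) F̂^in ds` with `F^in = η^in + ω^in`. -/
def dataR (m e : ℝ) (η₀ ψ₀ ω₀ : ℝ → ℝ → ℝ) (t : ℝ) (k : ℤ) (ξ : ℝ) :
    EuclideanSpace ℂ (Fin 2) :=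
  WithLp.toLp 2 fun i =>
    initB m η₀ ψ₀ k ξ i +
      ∫ s in (0 : ℝ)..t,
        (((solOp m e k ξ 0 s).mulVec (forcingM k ξ s) i : ℝ) : ℂ) *
          fourier (fun x y => η₀ x y + ω₀ x y) k ξ

/-- The quantity `C^in_σ(η^in, ψ^in, ω^in)` at time `t`, namely
`‖R(t, B^in, F^in)‖_{L²_x H^{-1/2}_y}`. -/
def lowerConst (m e : ℝ) (η₀ ψ₀ ω₀ : ℝ → ℝ → ℝ) (t : ℝ) : ℝ≥0∞ :=
  specNorm 0 (-1 / 2) (dataR m e η₀ ψ₀ ω₀ t)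

end

end ElectronCouette

/-! Fix a frequency `(k, ξ)` with `k ≠ 0` and follow it along the shear: at time `t` the unknowns
are read at `(k, ξ - kt)`, so that `∂_t + y∂_x` becomes `d/dt` and `-Δ` becomes `α(t)`. The sum `F =
η + ω` is transported, hence `F̂` is constant. Eliminating `φ` and `ω = F - η` leaves, for `X =
(η̂/(√m α^{1/4}), ψ̂/α^{3/4})`, the system `X' = L X + M F̂`. By Duhamel `X(t) = S_L(t,0) R(t)`,
where `R(t) = B^in + ∫_0^t S_L(0,s) M(s) ds F̂^in` is the vector whose weighted norm is the datum
functional.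

The heart is that `S_L` is bounded uniformly in `k`, `ξ` and both times. With `L = (-a, -b; b+d,
a)`, the form `(1 + d/b) A² + 2(a/b) AB + B²` is annihilated by `L` with frozen coefficients. Its
derivative along the flow therefore involves only `(d/b)'` and `(a/b)'`, which are `O(k²/α)`, and `∫
k²/α ds ≤ π` because `k²/α` is the derivative of an arctangent (`hasDerivAt_energy`,
`energy_bounds`, `sq_add_sq_le_of_ode`).

The weights are chosen so that `|ℚ̂|² + |η̂|²/m = α^{1/2} |X|²`. Together with `|R| ≲ |X|` and `⟨t⟩
≤ √2 ⟨ξ⟩ α^{1/2}` (`jap_le_mul_alphaRoot`), integration in frequency gives the growth `⟨t⟩^{1/2}`.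
For the second bound, `∫_0^t S_L(0,s) M(s) ds` is bounded (`abs_duhamelInt_le`), so `|B^in| ≤ |R| +
K |F̂^in|`, and `k² + ξ² ≤ ⟨k⟩²⟨ξ⟩²` turns the weights of `B^in` into Sobolev weights. The mode `k =
0` of the data vanishes.

The mode equation still has to be justified: only the unknowns themselves are in `L²`, not `y∂_xη`
or the gradients, and the transforms are defined almost everywhere. Each mode is therefore
multiplied by a cutoff in `y`. The quantity `Φ⁻¹X - (∫Φ⁻¹M) F`, with `Φ` the fundamental matrix, is
then constant up to commutators that contain `χ'` or `χ''` times undifferentiated unknowns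
(`hasDerivAt_pullback`). These tend to zero in `L²` as the cutoff widens, and a subsequence gives
exact conservation for almost every `ξ` (`ae_eq_of_tendsto_sub`). -/

namespace ElectronCouette

/-! ### Linear ordinary differential equations -/

/-- Coordinatewise truncation at height `R`. -/
noncomputable def clampPi {ι : Type*} (R : ℝ) (x : ι → ℝ) : ι → ℝ := fun i => max (-R) (min R (x i))

theorem abs_clamp_sub_le (R a b : ℝ) : |max (-R) (min R a) - max (-R) (min R b)| ≤ |a - b| := by
  refine (abs_max_sub_max_le_max _ _ _ _).trans (max_le (by simp) ?_)
  exact (abs_min_sub_min_le_max _ _ _ _).trans (max_le (by simp) le_rfl)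

theorem abs_clamp_le {R : ℝ} (hR : 0 ≤ R) (a : ℝ) :
    |max (-R) (min R a)| ≤ R ∧ |max (-R) (min R a)| ≤ |a| := by
  rcases max_cases (-R) (min R a) with h | h <;> rcases min_cases R a with h' | h' <;>
    constructor <;> rw [abs_le] <;> constructor <;>
    cases abs_cases a <;> linarith

theorem clamp_of_abs_le {R a : ℝ} (h : |a| ≤ R) : max (-R) (min R a) = a := by
  rw [abs_le] at h
  rw [min_eq_right h.2, max_eq_right h.1]

/-- A linear field is unbounded, so Picard–Lindelöf is applied to its truncation, which is bounded
and therefore solvable on all of `[-T, T]`. Grönwall then shows that the truncation was never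
active. -/
theorem exists_linear_ode_Icc {ι : Type*} [Fintype ι] {A : ℝ → (ι → ℝ) →L[ℝ] (ι → ℝ)}
    (hA : Continuous A) (x₀ : ι → ℝ) {T : ℝ} (hT : 0 < T) :
    ∃ α : ℝ → ι → ℝ, α 0 = x₀ ∧ ∀ t ∈ Ioo (-T) T, HasDerivAt α (A t (α t)) t := by
  obtain ⟨M, hM⟩ := (isCompact_Icc (a := -T) (b := T)).exists_bound_of_continuousOn hA.continuousOn
  have hM0 : 0 ≤ M := (norm_nonneg _).trans (hM 0 ⟨by linarith, hT.le⟩)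
  -- The height is the Grönwall bound for `‖α‖` at time `T`.
  set R : ℝ := ‖x₀‖ * Real.exp (M * T) with hR
  have hR0 : 0 ≤ R := by positivity
  have hclR : ∀ x : ι → ℝ, ‖clampPi R x‖ ≤ R := fun x =>
    (pi_norm_le_iff_of_nonneg hR0).2 fun i => (abs_clamp_le hR0 (x i)).1
  have hclx : ∀ x : ι → ℝ, ‖clampPi R x‖ ≤ ‖x‖ := fun x =>
    (pi_norm_le_iff_of_nonneg (norm_nonneg _)).2 fun i =>
      (abs_clamp_le hR0 (x i)).2.trans (norm_le_pi_norm x i)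
  have hlip : ∀ x y : ι → ℝ, ‖clampPi R x - clampPi R y‖ ≤ ‖x - y‖ := fun x y =>
    (pi_norm_le_iff_of_nonneg (norm_nonneg _)).2 fun i =>
      (abs_clamp_sub_le R (x i) (y i)).trans (norm_le_pi_norm (x - y) i)
  have hPL : IsPicardLindelof (fun t x => A t (clampPi R x)) (tmin := -T) (tmax := T)
      ⟨0, by constructor <;> linarith⟩ x₀ (Real.toNNReal (M * R * T)) 0
      (Real.toNNReal (M * R)) (Real.toNNReal M) := by
    constructor
    · intro t ht
      refine LipschitzOnWith.of_dist_le_mul fun x _ y _ => ?_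
      rw [dist_eq_norm, dist_eq_norm, ← map_sub, Real.coe_toNNReal _ hM0]
      exact ((A t).le_opNorm _).trans (mul_le_mul (hM t ht) (hlip x y) (norm_nonneg _) hM0)
    · intro x _
      exact (hA.clm_apply continuous_const).continuousOn
    · intro t ht x _
      rw [Real.coe_toNNReal _ (by positivity)]
      exact ((A t).le_opNorm _).trans (mul_le_mul (hM t ht) (hclR x) (norm_nonneg _) hM0)
    · rw [Real.coe_toNNReal _ (by positivity), Real.coe_toNNReal _ (by positivity)]
      simp
  obtain ⟨α, h0, hα⟩ := hPL.exists_eq_forall_mem_Icc_hasDerivWithinAt₀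
  have h0 : α 0 = x₀ := h0
  have hαc : ContinuousOn α (Icc (-T) T) := fun t ht => (hα t ht).continuousWithinAt
  have hαd : ∀ t ∈ Ioo (-T) T, HasDerivAt α (A t (clampPi R (α t))) t := fun t ht =>
    (hα t (Ioo_subset_Icc_self ht)).hasDerivAt (Icc_mem_nhds ht.1 ht.2)
  have hbd : ∀ t ∈ Icc (-T) T, ‖A t (clampPi R (α t))‖ ≤ M * ‖α t‖ + 0 := fun t ht => by
    rw [add_zero]
    exact ((A t).le_opNorm _).trans (mul_le_mul (hM t ht) (hclx _) (norm_nonneg _) hM0)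
  have hgb : ∀ t ∈ Icc 0 T, gronwallBound ‖x₀‖ M 0 (t - 0) ≤ R := fun t ht => by
    rw [gronwallBound_ε0, hR, sub_zero]
    gcongr
    exact ht.2
  have hfwd : ∀ t ∈ Ico 0 T, ‖α t‖ ≤ R := fun t ht => by
    have := norm_le_gronwallBound_of_norm_deriv_right_le (f := α)
      (f' := fun t => A t (clampPi R (α t))) (δ := ‖x₀‖) (K := M) (ε := 0) (a := 0) (b := t)
      (hαc.mono (Icc_subset_Icc (by linarith) ht.2.le))
      (fun s hs => (hαd s ⟨by linarith [hs.1], hs.2.trans ht.2⟩).hasDerivWithinAt)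
      (by rw [h0]) (fun s hs => hbd s ⟨by linarith [hs.1], (hs.2.trans ht.2).le⟩) t ⟨ht.1, le_rfl⟩
    exact this.trans (hgb t ⟨ht.1, ht.2.le⟩)
  -- Negative times: the same bound for the time-reversed curve.
  have hbwd : ∀ t ∈ Ico 0 T, ‖α (-t)‖ ≤ R := fun t ht => by
    have := norm_le_gronwallBound_of_norm_deriv_right_le (f := fun s => α (-s))
      (f' := fun t => -(A (-t) (clampPi R (α (-t))))) (δ := ‖x₀‖) (K := M) (ε := 0) (a := 0) (b := t)
      (hαc.comp continuous_neg.continuousOn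
        fun s hs => ⟨by linarith [hs.2, ht.2], by linarith [hs.1]⟩)
      (fun s hs => by
        have := (hαd (-s) ⟨by linarith [hs.2, ht.2], by linarith [hs.1]⟩).scomp s (hasDerivAt_neg s)
        simpa [Function.comp_def] using this.hasDerivWithinAt)
      (by simp [h0]) (fun s hs => by
        rw [norm_neg]
        exact hbd (-s) ⟨by linarith [hs.2, ht.2], by linarith [hs.1]⟩) t ⟨ht.1, le_rfl⟩
    exact this.trans (hgb t ⟨ht.1, ht.2.le⟩)
  refine ⟨α, h0, fun t ht => ?_⟩
  have hn : ‖α t‖ ≤ R := by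
    rcases le_total 0 t with h | h
    · exact hfwd t ⟨h, ht.2⟩
    · simpa using hbwd (-t) ⟨by linarith, by linarith [ht.1]⟩
  have : clampPi R (α t) = α t := by
    funext i
    exact clamp_of_abs_le ((norm_le_pi_norm (α t) i).trans hn)
  simpa [this] using hαd t ht

/-- The solutions on the intervals `(-(n+1), n+1)` agree on overlaps by uniqueness and are glued. -/
theorem exists_linear_ode {ι : Type*} [Fintype ι] {A : ℝ → (ι → ℝ) →L[ℝ] (ι → ℝ)}
    (hA : Continuous A) (x₀ : ι → ℝ) :
    ∃ α : ℝ → ι → ℝ, α 0 = x₀ ∧ ∀ t, HasDerivAt α (A t (α t)) t := by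
  choose α h0 hα using fun n : ℕ => exists_linear_ode_Icc hA x₀ (T := n + 1) (by positivity)
  have huniq : ∀ n m : ℕ, n ≤ m → EqOn (α n) (α m) (Ioo (-(n + 1 : ℝ)) (n + 1)) := fun n m hnm => by
    obtain ⟨M, hM⟩ := (isCompact_Icc (a := -(n + 1 : ℝ)) (b := n + 1)).exists_bound_of_continuousOn
      hA.continuousOn
    have hnm' : (n : ℝ) ≤ m := by exact_mod_cast hnm
    have hn0 : (0 : ℝ) ≤ n := n.cast_nonneg
    refine ODE_solution_unique_of_mem_Ioo (v := fun t x => A t x) (s := fun _ => univ)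
      (K := Real.toNNReal M) (t₀ := 0) ?_ ⟨by linarith, by linarith⟩
      (fun t ht => ⟨hα n t ht, mem_univ _⟩)
      (fun t ht => ⟨hα m t ⟨by linarith [ht.1], by linarith [ht.2]⟩, mem_univ _⟩) (by rw [h0, h0])
    intro t ht
    refine LipschitzOnWith.of_dist_le_mul fun x _ y _ => ?_
    rw [dist_eq_norm, dist_eq_norm, ← map_sub]
    refine ((A t).le_opNorm _).trans (mul_le_mul_of_nonneg_right ?_ (norm_nonneg _))
    exact (hM t (Ioo_subset_Icc_self ht)).trans (Real.le_coe_toNNReal M)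
  refine ⟨fun t => α ⌈|t|⌉₊ t, by simp [h0], fun t => ?_⟩
  -- The extra `1` makes `N` serve for every `s` near `t`, although the ceiling may jump at `t`.
  set N := ⌈|t|⌉₊ + 1 with hN
  have habs : |t| ≤ ⌈|t|⌉₊ := Nat.le_ceil _
  have hev : (fun s => α ⌈|s|⌉₊ s) =ᶠ[nhds t] α N := by
    have : {s : ℝ | |s| < |t| + 1} ∈ nhds t :=
      (isOpen_lt continuous_abs continuous_const).mem_nhds (by simp)
    filter_upwards [this] with s hs
    have hs1 : ⌈|s|⌉₊ ≤ N := by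
      rw [Nat.ceil_le, hN]; push_cast
      have : |s| < |t| + 1 := hs
      linarith
    refine huniq _ _ hs1 ?_
    have h2 : |s| ≤ ⌈|s|⌉₊ := Nat.le_ceil _
    have := abs_le.1 h2
    exact ⟨by linarith [this.1], by linarith [this.2]⟩
  have hmem : t ∈ Ioo (-((N : ℝ) + 1)) (N + 1) := by
    have := abs_le.1 habs
    rw [hN]; push_cast
    exact ⟨by linarith [this.1], by linarith [this.2]⟩
  have h := (hα N t hmem).congr_of_eventuallyEq hev
  have h1 : α ⌈|t|⌉₊ t = α N t := hev.self_of_nhds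
  simpa [h1] using h

theorem exists_isFundamentalMatrix {L : ℝ → Matrix (Fin 2) (Fin 2) ℝ} (hL : Continuous L) :
    ∃ Φ, IsFundamentalMatrix L Φ := by
  have hA : Continuous fun t => LinearMap.toContinuousLinearMap (Matrix.mulVecLin (L t)) := by
    refine continuous_clm_apply.2 fun x => ?_
    simpa using hL.matrix_mulVec continuous_const
  choose α h0 hα using fun j : Fin 2 => exists_linear_ode hA (Pi.single j (1 : ℝ))
  refine ⟨fun t => Matrix.of fun i j => α j t i, ?_, fun t i j => ?_⟩
  · ext i j
    simp [h0, Matrix.one_apply, Pi.single_apply]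
  · have := hasDerivAt_pi.1 (hα j t) i
    simpa [Matrix.mul_apply, Matrix.mulVec, dotProduct] using this

theorem isFundamentalMatrix_fundamentalMatrix {L : ℝ → Matrix (Fin 2) (Fin 2) ℝ}
    (hL : Continuous L) : IsFundamentalMatrix L (fundamentalMatrix L) := by
  have h := exists_isFundamentalMatrix hL
  rw [fundamentalMatrix, dif_pos h]
  exact h.choose_spec

/-- Liouville's formula. It makes `Φ⁻¹` the adjugate of `Φ`, hence `S_L(0, s)` explicit. -/
theorem IsFundamentalMatrix.det_eq_one {L Φ : ℝ → Matrix (Fin 2) (Fin 2) ℝ}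
    (h : IsFundamentalMatrix L Φ) (htr : ∀ t, (L t).trace = 0) (t : ℝ) : (Φ t).det = 1 := by
  have hd : ∀ t, HasDerivAt (fun s => (Φ s).det) 0 t := fun t => by
    have := ((h.2 t 0 0).mul (h.2 t 1 1)).sub ((h.2 t 0 1).mul (h.2 t 1 0))
    simp only [Matrix.det_fin_two]
    refine this.congr_deriv ?_
    have htr := htr t
    rw [Matrix.trace_fin_two] at htr
    simp only [Matrix.mul_apply, Fin.sum_univ_two]
    linear_combination (Φ t 0 0 * Φ t 1 1 - Φ t 0 1 * Φ t 1 0) * htr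
  have := is_const_of_deriv_eq_zero (fun t => (hd t).differentiableAt) (fun t => (hd t).deriv) t 0
  rw [this, h.1, Matrix.det_one]

section

/-! ### The frequency weight `α` -/

theorem alpha_def (k : ℤ) (ξ t : ℝ) : alpha k ξ t = (k : ℝ) ^ 2 + (ξ - k * t) ^ 2 := rfl

theorem one_le_sq_intCast {k : ℤ} (hk : k ≠ 0) : (1 : ℝ) ≤ (k : ℝ) ^ 2 := by
  have h : (0 : ℤ) < k ^ 2 := by positivity
  exact_mod_cast Int.add_one_le_iff.2 h

theorem sq_le_alpha (k : ℤ) (ξ t : ℝ) : (k : ℝ) ^ 2 ≤ alpha k ξ t := by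
  rw [alpha_def]; nlinarith [sq_nonneg (ξ - k * t)]

theorem one_le_alpha {k : ℤ} (hk : k ≠ 0) (ξ t : ℝ) : 1 ≤ alpha k ξ t :=
  (one_le_sq_intCast hk).trans (sq_le_alpha k ξ t)

theorem alpha_pos {k : ℤ} (hk : k ≠ 0) (ξ t : ℝ) : 0 < alpha k ξ t :=
  one_pos.trans_le (one_le_alpha hk ξ t)

theorem hasDerivAt_alpha (k : ℤ) (ξ t : ℝ) : HasDerivAt (alpha k ξ) (alphaDot k ξ t) t := by
  have h := ((((hasDerivAt_id t).const_mul (k : ℝ)).const_sub ξ).pow 2).const_add ((k : ℝ) ^ 2)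
  refine h.congr_deriv ?_
  simp [alphaDot]; ring

theorem hasDerivAt_alphaDot (k : ℤ) (ξ t : ℝ) :
    HasDerivAt (alphaDot k ξ) (2 * (k : ℝ) ^ 2) t := by
  have h := (((hasDerivAt_id t).const_mul (k : ℝ)).const_sub ξ).const_mul (-2 * (k : ℝ))
  refine h.congr_deriv ?_
  ring

theorem alphaDot_sq_le (k : ℤ) (ξ t : ℝ) :
    alphaDot k ξ t ^ 2 ≤ 4 * (k : ℝ) ^ 2 * alpha k ξ t := by
  rw [alphaDot, alpha_def]
  nlinarith [sq_nonneg ((k : ℝ) ^ 2)]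

theorem continuous_alpha (k : ℤ) (ξ : ℝ) : Continuous (alpha k ξ) :=
  continuous_iff_continuousAt.2 fun t => (hasDerivAt_alpha k ξ t).continuousAt

theorem continuous_alphaDot (k : ℤ) (ξ : ℝ) : Continuous (alphaDot k ξ) :=
  continuous_iff_continuousAt.2 fun t => (hasDerivAt_alphaDot k ξ t).continuousAt

/-- The weight `k²/α` has a primitive of oscillation at most `π`; every bound uniform in time comes
from this. -/
theorem hasDerivAt_arctan_sub {k : ℤ} (hk : k ≠ 0) (ξ t : ℝ) :
    HasDerivAt (fun s => Real.arctan (s - ξ / k)) ((k : ℝ) ^ 2 / alpha k ξ t) t := by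
  have h := ((hasDerivAt_id t).sub_const (ξ / (k : ℝ))).arctan
  refine h.congr_deriv ?_
  have hk' : (k : ℝ) ≠ 0 := by exact_mod_cast hk
  have h1 : (1 : ℝ) + (t - ξ / k) ^ 2 ≠ 0 := by positivity
  have h2 : alpha k ξ t = (k : ℝ) ^ 2 * (1 + (t - ξ / k) ^ 2) := by
    rw [alpha_def]; field_simp; ring
  rw [h2]
  simp only [id]
  field_simp

theorem rpow_three_halves {a : ℝ} (ha : 0 < a) : a ^ (3 / 2 : ℝ) = a * Real.sqrt a := by
  rw [show (3 / 2 : ℝ) = 1 + 1 / 2 by norm_num, Real.rpow_add ha, Real.rpow_one, Real.sqrt_eq_rpow]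

theorem continuous_coeffL (m e : ℝ) {k : ℤ} (hk : k ≠ 0) (ξ : ℝ) (hm : 0 < m) :
    Continuous (coeffL m e k ξ) := by
  have ha := continuous_alpha k ξ
  have hd := continuous_alphaDot k ξ
  have hne : ∀ t, alpha k ξ t ≠ 0 := fun t => (alpha_pos hk ξ t).ne'
  have hr : ∀ p : ℝ, Continuous fun t => alpha k ξ t ^ p := fun p =>
    ha.rpow_const fun t => Or.inl (hne t)
  have hrne : ∀ (p : ℝ) t, alpha k ξ t ^ p ≠ 0 := fun p t =>
    (Real.rpow_pos_of_pos (alpha_pos hk ξ t) p).ne'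
  have hm' : Real.sqrt m ≠ 0 := (Real.sqrt_pos.2 hm).ne'
  refine continuous_matrix fun i j => ?_
  fin_cases i <;> fin_cases j <;> simp only [coeffL, Fin.zero_eta, Fin.mk_one, Matrix.of_apply,
    Matrix.cons_val', Matrix.cons_val_zero, Matrix.cons_val_one, Matrix.cons_val_fin_one,
    Fin.isValue]
  · exact continuous_const.mul (hd.div ha hne)
  · exact (continuous_const.mul (hr _)).neg
  · refine (Continuous.add ?_ ?_).add (continuous_const.mul (hr _))
    · exact continuous_const.div (continuous_const.mul (hr _)) fun t => mul_ne_zero hm' (hrne _ t)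
    · exact continuous_const.div (hr _) (hrne _)
  · exact continuous_const.mul (hd.div ha hne)

theorem trace_coeffL (m e : ℝ) (k : ℤ) (ξ t : ℝ) : (coeffL m e k ξ t).trace = 0 := by
  simp [coeffL, Matrix.trace_fin_two]; 

/-! ### Energy estimate -/

/-- The energy `(1 + d/b) A² + 2 (a/b) A B + B²` adapted to the matrix `L = (-a, -b; b + d, a)`. -/
noncomputable def energy (m e : ℝ) (k : ℤ) (ξ : ℝ) (A B : ℝ → ℝ) (t : ℝ) : ℝ :=
  (1 + 4 * Real.pi * e ^ 2 / alpha k ξ t + 2 * m * (k : ℝ) ^ 2 / alpha k ξ t ^ 2) * A t ^ 2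
    + 2 * (Real.sqrt m / 4 * (alphaDot k ξ t / (alpha k ξ t * Real.sqrt (alpha k ξ t)))) * A t * B t
    + B t ^ 2

/-- The rate of change of the energy along `X' = L X`. -/
noncomputable def energyRate (m e : ℝ) (k : ℤ) (ξ : ℝ) (A B : ℝ → ℝ) (t : ℝ) : ℝ :=
  -(4 * Real.pi * e ^ 2 * alphaDot k ξ t / alpha k ξ t ^ 2
      + 4 * m * (k : ℝ) ^ 2 * alphaDot k ξ t / alpha k ξ t ^ 3) * A t ^ 2
    + Real.sqrt m / 2 * ((2 * (k : ℝ) ^ 2 - 3 / 2 * (alphaDot k ξ t ^ 2 / alpha k ξ t))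
      / (alpha k ξ t * Real.sqrt (alpha k ξ t))) * A t * B t

variable {m e : ℝ} {k : ℤ} {ξ : ℝ} {A B : ℝ → ℝ}

/-- For frozen coefficients the form is `1/b` times the Hamiltonian of the trace-free matrix `L`, so
all terms without derivatives of the coefficients cancel. What is left is `(d/b)' A² + 2 (a/b)' A
B`. -/
theorem hasDerivAt_energy (hm : 0 < m) (hk : k ≠ 0) {t : ℝ}
    (hA : HasDerivAt A (coeffL m e k ξ t 0 0 * A t + coeffL m e k ξ t 0 1 * B t) t)
    (hB : HasDerivAt B (coeffL m e k ξ t 1 0 * A t + coeffL m e k ξ t 1 1 * B t) t) :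
    HasDerivAt (energy m e k ξ A B) (energyRate m e k ξ A B t) t := by
  have hα := alpha_pos hk ξ t
  have h1 := hasDerivAt_alpha k ξ t
  have h2 := hasDerivAt_alphaDot k ξ t
  have hw := h1.sqrt hα.ne'
  have hwpos := Real.sqrt_pos.2 hα
  have hrpos := Real.sqrt_pos.2 hm
  have hww : Real.sqrt (alpha k ξ t) ^ 2 = alpha k ξ t := Real.sq_sqrt hα.le
  have hrr : Real.sqrt m ^ 2 = m := Real.sq_sqrt hm.le
  have hd := ((((((hasDerivAt_const t (4 * Real.pi * e ^ 2)).div h1 hα.ne').const_add 1).add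
    ((hasDerivAt_const t (2 * m * (k : ℝ) ^ 2)).div (h1.pow 2) (pow_ne_zero 2 hα.ne'))).mul
      (hA.pow 2)).add
      (((((h2.div (h1.mul hw) (mul_pos hα hwpos).ne').const_mul (Real.sqrt m / 4)).const_mul 2).mul
        hA).mul hB)).add (hB.pow 2)
  refine hd.congr_deriv ?_
  have e00 : coeffL m e k ξ t 0 0 = -(1 / 4) * (alphaDot k ξ t / alpha k ξ t) := rfl
  have e11 : coeffL m e k ξ t 1 1 = 1 / 4 * (alphaDot k ξ t / alpha k ξ t) := rfl
  have e01 : coeffL m e k ξ t 0 1 = -(Real.sqrt (alpha k ξ t) / Real.sqrt m) := by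
    rw [Real.sqrt_eq_rpow (alpha k ξ t)]
    simp [coeffL]; ring
  have e10 : coeffL m e k ξ t 1 0 = 4 * Real.pi * e ^ 2 / (Real.sqrt m * Real.sqrt (alpha k ξ t))
        + 2 * (k : ℝ) ^ 2 * Real.sqrt m / (alpha k ξ t * Real.sqrt (alpha k ξ t))
        + Real.sqrt (alpha k ξ t) / Real.sqrt m := by
    rw [← rpow_three_halves hα, Real.sqrt_eq_rpow (alpha k ξ t)]
    simp [coeffL]; ring
  simp only [e00, e01, e10, e11, energyRate, Pi.div_apply, Pi.mul_apply, Pi.pow_apply, Pi.add_apply]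
  -- After `α = w²` and `m = r²` the claim is an identity of rational functions.
  generalize Real.sqrt (alpha k ξ t) = w at *
  generalize hr : Real.sqrt m = r at *
  generalize alpha k ξ t = a at *
  generalize alphaDot k ξ t = d at *
  subst hww
  subst hrr
  clear hd h1 h2 hw hA hB e00 e01 e10 e11
  field_simp
  ring

/-- With `g = a/b` and `q = m k²/α²`, the term `2 q A²` contained in `d/b` absorbs the cross term:
`2|g A B| ≤ 4 g² A² + B²/4` and `4 g² ≤ q`. Coercivity thus needs no smallness of `m`. -/
theorem energy_bounds (hm : 0 < m) (hk : k ≠ 0) (t : ℝ) :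
    3 / 4 * (A t ^ 2 + B t ^ 2) ≤ energy m e k ξ A B t ∧
    energy m e k ξ A B t ≤ (2 + 4 * Real.pi * e ^ 2 + 3 * m) * (A t ^ 2 + B t ^ 2) := by
  have hα := alpha_pos hk ξ t
  have hα1 := one_le_alpha hk ξ t
  have hkα := sq_le_alpha k ξ t
  have hd2 := alphaDot_sq_le k ξ t
  have hwpos := Real.sqrt_pos.2 hα
  have hww : Real.sqrt (alpha k ξ t) ^ 2 = alpha k ξ t := Real.sq_sqrt hα.le
  have hrr : Real.sqrt m ^ 2 = m := Real.sq_sqrt hm.le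
  set g := Real.sqrt m / 4 * (alphaDot k ξ t / (alpha k ξ t * Real.sqrt (alpha k ξ t))) with hg
  set q := m * (k : ℝ) ^ 2 / alpha k ξ t ^ 2 with hq
  have hq0 : 0 ≤ q := by positivity
  have hqm : q ≤ m := by
    rw [hq, div_le_iff₀ (by positivity)]
    refine mul_le_mul_of_nonneg_left ?_ hm.le
    nlinarith
  have hgq : 4 * g ^ 2 ≤ q := by
    rw [hg, hq, mul_pow, div_pow, div_pow, mul_pow, hrr, hww]
    rw [show 4 * (m / 4 ^ 2 * (alphaDot k ξ t ^ 2 / (alpha k ξ t ^ 2 * alpha k ξ t)))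
      = (m / 4 * alphaDot k ξ t ^ 2 / alpha k ξ t) / alpha k ξ t ^ 2 by field_simp]
    gcongr
    rw [div_le_iff₀ hα]
    nlinarith
  set P := 4 * Real.pi * e ^ 2 / alpha k ξ t with hP
  have hP0 : 0 ≤ P := by have := Real.pi_pos; positivity
  have hP1 : P ≤ 4 * Real.pi * e ^ 2 :=
    div_le_self (by have := Real.pi_pos; positivity) hα1
  have hE : energy m e k ξ A B t = (1 + P + 2 * q) * A t ^ 2 + 2 * g * A t * B t + B t ^ 2 := by
    rw [energy, hP, hq, hg]; ring
  rw [hE]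
  have hA2 := sq_nonneg (A t)
  have hB2 := sq_nonneg (B t)
  constructor
  · nlinarith [sq_nonneg (2 * g * A t + B t / 2), mul_nonneg hP0 hA2, mul_nonneg hq0 hA2,
      mul_le_mul_of_nonneg_right hgq hA2]
  · nlinarith [sq_nonneg (2 * g * A t - B t / 2), mul_le_mul_of_nonneg_right hP1 hA2,
      mul_le_mul_of_nonneg_right hqm hA2, mul_nonneg (hP0.trans hP1) hB2, mul_nonneg hm.le hB2,
      mul_le_mul_of_nonneg_right hgq hA2]

/-- Each coefficient is `O(k²/α)`: `|α̇| ≤ 2α` and `1/α ≤ k²/α` for the first, `α̇² ≤ 4k²α` and `√α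
≥ 1` for the second. -/
theorem abs_energyRate_le (hm : 0 < m) (hk : k ≠ 0) (t : ℝ) :
    |energyRate m e k ξ A B t| ≤ (k : ℝ) ^ 2 / alpha k ξ t *
      ((8 * Real.pi * e ^ 2 + 8 * m + 4 * Real.sqrt m) * (A t ^ 2 + B t ^ 2)) := by
  have hα := alpha_pos hk ξ t
  have hα1 := one_le_alpha hk ξ t
  have hkα := sq_le_alpha k ξ t
  have hk1 := one_le_sq_intCast hk
  have hd2 := alphaDot_sq_le k ξ t
  have hwpos := Real.sqrt_pos.2 hα
  have hw1 : 1 ≤ Real.sqrt (alpha k ξ t) := Real.one_le_sqrt.2 hα1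
  have hπ := Real.pi_pos
  have hr0 := Real.sqrt_nonneg m
  have hd : |alphaDot k ξ t| ≤ 2 * alpha k ξ t := by
    refine abs_le_of_sq_le_sq ?_ (by positivity)
    nlinarith
  set q := (k : ℝ) ^ 2 / alpha k ξ t with hq
  have hq0 : 0 ≤ q := by positivity
  have hinv : 1 / alpha k ξ t ≤ q := by rw [hq]; gcongr
  have h1 : |4 * Real.pi * e ^ 2 * alphaDot k ξ t / alpha k ξ t ^ 2
      + 4 * m * (k : ℝ) ^ 2 * alphaDot k ξ t / alpha k ξ t ^ 3| ≤ (8 * Real.pi * e ^ 2 + 8 * m) * q := by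
    have hx : 4 * Real.pi * e ^ 2 * alphaDot k ξ t / alpha k ξ t ^ 2
      + 4 * m * (k : ℝ) ^ 2 * alphaDot k ξ t / alpha k ξ t ^ 3 =
      (alphaDot k ξ t / alpha k ξ t) * (4 * Real.pi * e ^ 2 * (1 / alpha k ξ t)
        + 4 * m * (q * (1 / alpha k ξ t))) := by rw [hq]; field_simp
    have hi : 1 / alpha k ξ t ≤ 1 := by rw [div_le_one hα]; exact hα1
    rw [hx, abs_mul]
    have hy : |alphaDot k ξ t / alpha k ξ t| ≤ 2 := by
      rw [abs_div, abs_of_pos hα, div_le_iff₀ hα]; exact hd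
    have hz : |4 * Real.pi * e ^ 2 * (1 / alpha k ξ t) + 4 * m * (q * (1 / alpha k ξ t))|
        ≤ 4 * Real.pi * e ^ 2 * q + 4 * m * (q * 1) := by
      rw [abs_of_nonneg (by positivity)]
      gcongr
    refine (mul_le_mul hy hz (abs_nonneg _) (by norm_num)).trans (le_of_eq ?_)
    ring
  have h2 : |Real.sqrt m / 2 * ((2 * (k : ℝ) ^ 2 - 3 / 2 * (alphaDot k ξ t ^ 2 / alpha k ξ t))
      / (alpha k ξ t * Real.sqrt (alpha k ξ t)))| ≤ 4 * Real.sqrt m * q := by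
    have hx : |2 * (k : ℝ) ^ 2 - 3 / 2 * (alphaDot k ξ t ^ 2 / alpha k ξ t)| ≤ 8 * (k : ℝ) ^ 2 := by
      have : alphaDot k ξ t ^ 2 / alpha k ξ t ≤ 4 * (k : ℝ) ^ 2 := by
        rw [div_le_iff₀ hα]; exact hd2
      have h0 : 0 ≤ alphaDot k ξ t ^ 2 / alpha k ξ t := by positivity
      rw [abs_le]; constructor <;> nlinarith
    have hy : |(2 * (k : ℝ) ^ 2 - 3 / 2 * (alphaDot k ξ t ^ 2 / alpha k ξ t))
      / (alpha k ξ t * Real.sqrt (alpha k ξ t))| ≤ 8 * q := by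
      rw [abs_div, abs_of_pos (mul_pos hα hwpos), div_le_iff₀ (mul_pos hα hwpos)]
      refine hx.trans ?_
      rw [hq, show 8 * ((k : ℝ) ^ 2 / alpha k ξ t) * (alpha k ξ t * Real.sqrt (alpha k ξ t))
        = 8 * (k : ℝ) ^ 2 * Real.sqrt (alpha k ξ t) by field_simp]
      exact le_mul_of_one_le_right (by positivity) hw1
    rw [abs_mul, abs_of_nonneg (by positivity)]
    refine (mul_le_mul_of_nonneg_left hy (by positivity)).trans (le_of_eq ?_)
    ring
  rw [energyRate, mul_assoc _ (A t)]
  refine (abs_add_le _ _).trans ?_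
  rw [abs_mul, abs_neg, abs_mul _ (A t * B t), abs_mul (A t)]
  have h3 : |A t| * |B t| ≤ A t ^ 2 + B t ^ 2 := by
    have := sq_abs (A t); have := sq_abs (B t)
    nlinarith [sq_nonneg (|A t| - |B t|), sq_nonneg (A t), sq_nonneg (B t)]
  have h4 : |A t ^ 2| ≤ A t ^ 2 + B t ^ 2 := by
    rw [abs_of_nonneg (sq_nonneg _)]; nlinarith [sq_nonneg (B t)]
  calc _ ≤ ((8 * Real.pi * e ^ 2 + 8 * m) * q) * (A t ^ 2 + B t ^ 2)
        + (4 * Real.sqrt m * q) * (A t ^ 2 + B t ^ 2) := by gcongr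
    _ = _ := by ring

/-- The constant of the two-sided energy estimate. -/
noncomputable def growthConst (m e : ℝ) : ℝ :=
  4 / 3 * (2 + 4 * Real.pi * e ^ 2 + 3 * m) *
    Real.exp (4 / 3 * (8 * Real.pi * e ^ 2 + 8 * m + 4 * Real.sqrt m) * Real.pi)

theorem growthConst_pos (hm : 0 < m) : 0 < growthConst m e := by
  have := Real.pi_pos
  unfold growthConst; positivity

/-- Grönwall in both time directions: with `θ' = k²/α`, the product `E e^{cθ}` increases and `E
e^{-cθ}` decreases, while `θ` varies by at most `π`. No order between `s` and `t` is needed, so the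
bound also controls the inverse flow. -/
theorem sq_add_sq_le_of_ode (hm : 0 < m) (hk : k ≠ 0)
    (hA : ∀ t, HasDerivAt A (coeffL m e k ξ t 0 0 * A t + coeffL m e k ξ t 0 1 * B t) t)
    (hB : ∀ t, HasDerivAt B (coeffL m e k ξ t 1 0 * A t + coeffL m e k ξ t 1 1 * B t) t) (t s : ℝ) :
    A t ^ 2 + B t ^ 2 ≤ growthConst m e * (A s ^ 2 + B s ^ 2) := by
  have hπ := Real.pi_pos
  set c := 4 / 3 * (8 * Real.pi * e ^ 2 + 8 * m + 4 * Real.sqrt m) with hc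
  have hc0 : 0 ≤ c := by positivity
  set E := energy m e k ξ A B with hE
  set θ : ℝ → ℝ := fun s => Real.arctan (s - ξ / k) with hθ
  have hEd : ∀ t, HasDerivAt E (energyRate m e k ξ A B t) t := fun t =>
    hasDerivAt_energy hm hk (hA t) (hB t)
  have hrate : ∀ t, |energyRate m e k ξ A B t| ≤ c * ((k : ℝ) ^ 2 / alpha k ξ t) * E t := fun t => by
    refine (abs_energyRate_le hm hk t).trans ?_
    have hb := (energy_bounds (e := e) (ξ := ξ) (A := A) (B := B) hm hk t).1
    have hα := alpha_pos hk ξ t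
    have : A t ^ 2 + B t ^ 2 ≤ 4 / 3 * E t := by rw [hE]; linarith
    calc _ ≤ (k : ℝ) ^ 2 / alpha k ξ t *
      ((8 * Real.pi * e ^ 2 + 8 * m + 4 * Real.sqrt m) * (4 / 3 * E t)) := by gcongr
      _ = _ := by rw [hc]; ring
  have hθd : ∀ t, HasDerivAt θ ((k : ℝ) ^ 2 / alpha k ξ t) t := hasDerivAt_arctan_sub hk ξ
  have hup : Monotone fun t => E t * Real.exp (c * θ t) := by
    refine monotone_of_deriv_nonneg
      (fun t => ((hEd t).mul ((hθd t).const_mul c).exp).differentiableAt) fun t => ?_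
    have hd : HasDerivAt (fun t => E t * Real.exp (c * θ t)) _ t :=
      (hEd t).mul ((hθd t).const_mul c).exp
    rw [hd.deriv]
    have := (abs_le.1 (hrate t)).1
    have := Real.exp_pos (c * θ t)
    nlinarith
  have hdown : Antitone fun t => E t * Real.exp (-c * θ t) := by
    refine antitone_of_deriv_nonpos
      (fun t => ((hEd t).mul ((hθd t).const_mul (-c)).exp).differentiableAt) fun t => ?_
    have hd : HasDerivAt (fun t => E t * Real.exp (-c * θ t)) _ t :=
      (hEd t).mul ((hθd t).const_mul (-c)).exp
    rw [hd.deriv]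
    have := (abs_le.1 (hrate t)).2
    have := Real.exp_pos (-c * θ t)
    nlinarith
  have hEnn : ∀ t, 0 ≤ E t := fun t =>
    (by positivity : (0 : ℝ) ≤ 3 / 4 * (A t ^ 2 + B t ^ 2)).trans (energy_bounds hm hk t).1
  have hθb : ∀ s t, θ s - θ t ≤ Real.pi := fun s t => by
    have := Real.arctan_lt_pi_div_two (s - ξ / k)
    have := Real.neg_pi_div_two_lt_arctan (t - ξ / k)
    simp only [hθ]; linarith
  have key : E t ≤ E s * Real.exp (c * Real.pi) := by
    rcases le_total s t with h | h
    · have h1 : E t * Real.exp (-c * θ t) ≤ E s * Real.exp (-c * θ s) := hdown h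
      calc E t = E t * Real.exp (-c * θ t) * Real.exp (c * θ t) := by
            rw [mul_assoc, ← Real.exp_add]; simp
        _ ≤ E s * Real.exp (-c * θ s) * Real.exp (c * θ t) := by gcongr
        _ = E s * Real.exp (c * (θ t - θ s)) := by rw [mul_assoc, ← Real.exp_add]; ring_nf
        _ ≤ _ := by
          have := hEnn s
          have := hθb t s
          gcongr
    · have h1 : E t * Real.exp (c * θ t) ≤ E s * Real.exp (c * θ s) := hup h
      calc E t = E t * Real.exp (c * θ t) * Real.exp (-c * θ t) := by
            rw [mul_assoc, ← Real.exp_add]; simp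
        _ ≤ E s * Real.exp (c * θ s) * Real.exp (-c * θ t) := by gcongr
        _ = E s * Real.exp (c * (θ s - θ t)) := by rw [mul_assoc, ← Real.exp_add]; ring_nf
        _ ≤ _ := by
          have := hEnn s
          have := hθb s t
          gcongr
  have hlow := (energy_bounds (e := e) (ξ := ξ) (A := A) (B := B) hm hk t).1
  have hupp := (energy_bounds (e := e) (ξ := ξ) (A := A) (B := B) hm hk s).2
  calc A t ^ 2 + B t ^ 2 ≤ 4 / 3 * E t := by rw [hE]; linarith
    _ ≤ 4 / 3 * (((2 + 4 * Real.pi * e ^ 2 + 3 * m) * (A s ^ 2 + B s ^ 2)) *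
          Real.exp (c * Real.pi)) := by
        gcongr
        refine key.trans ?_
        gcongr
    _ = _ := by rw [growthConst, hc]; ring

end

/-! ### The Fourier transform of a single mode in `y` -/

/-- The `k`-th Fourier integral in `x`. -/
noncomputable def mode (k : ℤ) (f : ℝ → ℝ → ℝ) (y : ℝ) : ℂ :=
  ∫ x in (0 : ℝ)..(2 * Real.pi), Complex.exp (-(Complex.I * (k : ℂ) * (x : ℂ))) * (f x y : ℂ)

/-- The conjugate Fourier integral of a test function. -/
noncomputable def testFT (χ : ℝ → ℂ) (ξ : ℝ) : ℂ :=
  ∫ y : ℝ, Complex.exp (Complex.I * (ξ : ℂ) * (y : ℂ)) * χ y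

/-- The Fourier integral of an integrable function. -/
noncomputable def intFT (G : ℝ → ℂ) (ξ : ℝ) : ℂ :=
  ∫ y : ℝ, Complex.exp (-(Complex.I * (ξ : ℂ) * (y : ℂ))) * G y

/-- A function with polynomially bounded growth, in the integral sense. -/
def IsTempered (g : ℝ → ℂ) : Prop :=
  AEStronglyMeasurable g volume ∧
    ∃ N : ℕ, Integrable (fun ξ : ℝ => ‖g ξ‖ / (1 + ξ ^ 2) ^ N) volume

/-- `g` is the distributional Fourier transform of `2π` times `F`. -/
def IsModeFT (F g : ℝ → ℂ) : Prop :=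
  IsTempered g ∧ ∀ χ : ℝ → ℂ, ContDiff ℝ ∞ χ → HasCompactSupport χ →
    ∫ y : ℝ, F y * χ y = ∫ ξ : ℝ, g ξ * testFT χ ξ

theorem isFourierTransform_iff {f : ℝ → ℝ → ℝ} {g : ℤ → ℝ → ℂ} :
    IsFourierTransform f g ↔ ∀ k, IsModeFT (mode k f) (g k) :=
  ⟨fun h k => ⟨⟨h.1 k, h.2.1 k⟩, h.2.2 k⟩,
    fun h => ⟨fun k => (h k).1.1, fun k => (h k).1.2, fun k => (h k).2⟩⟩

open FourierTransform in
theorem testFT_eq_fourierInv (χ : ℝ → ℂ) (ξ : ℝ) : testFT χ ξ = 𝓕⁻ χ (ξ / (2 * Real.pi)) := by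
  rw [testFT, Real.fourierInv_eq']
  congr 1; ext y
  rw [smul_eq_mul]
  congr 2
  simp only [RCLike.inner_apply, conj_trivial]
  push_cast
  have : (Real.pi : ℂ) ≠ 0 := by exact_mod_cast Real.pi_ne_zero
  field_simp

open FourierTransform in
theorem intFT_eq_fourier (G : ℝ → ℂ) (ξ : ℝ) : intFT G ξ = 𝓕 G (ξ / (2 * Real.pi)) := by
  rw [intFT, Real.fourier_eq']
  congr 1; ext y
  rw [smul_eq_mul]
  congr 2
  simp only [RCLike.inner_apply, conj_trivial]
  push_cast
  have : (Real.pi : ℂ) ≠ 0 := by exact_mod_cast Real.pi_ne_zero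
  field_simp

theorem integrable_div_of_le {g : ℝ → ℂ} (hg : AEStronglyMeasurable g volume) {N M : ℕ} (h : N ≤ M)
    (hN : Integrable (fun ξ : ℝ => ‖g ξ‖ / (1 + ξ ^ 2) ^ N) volume) :
    Integrable (fun ξ : ℝ => ‖g ξ‖ / (1 + ξ ^ 2) ^ M) volume := by
  refine hN.mono' ?_ (Filter.Eventually.of_forall fun ξ => ?_)
  · exact (hg.norm.aemeasurable.div
      (by fun_prop : Measurable fun ξ : ℝ => (1 + ξ ^ 2) ^ M).aemeasurable).aestronglyMeasurable
  · rw [Real.norm_of_nonneg (by positivity)]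
    gcongr
    nlinarith [sq_nonneg ξ]

/-! ### Tempered functions and their pairing with test functions. -/

namespace IsTempered

variable {g h : ℝ → ℂ}

theorem add (hg : IsTempered g) (hh : IsTempered h) : IsTempered fun ξ => g ξ + h ξ := by
  obtain ⟨hgm, N, hN⟩ := hg
  obtain ⟨hhm, M, hM⟩ := hh
  refine ⟨hgm.add hhm, max N M, ((integrable_div_of_le hgm (le_max_left N M) hN).add
    (integrable_div_of_le hhm (le_max_right N M) hM)).mono' ?_
    (Filter.Eventually.of_forall fun ξ => ?_)⟩
  · exact ((hgm.add hhm).norm.aemeasurable.div (by fun_prop :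
      Measurable fun ξ : ℝ => (1 + ξ ^ 2) ^ max N M).aemeasurable).aestronglyMeasurable
  · rw [Real.norm_of_nonneg (by positivity), Pi.add_apply, ← add_div]
    gcongr
    exact norm_add_le _ _

theorem mul_of_le (hg : IsTempered g) {p : ℝ → ℂ} (hp : Continuous p) {C : ℝ} {M : ℕ}
    (hC : ∀ ξ, ‖p ξ‖ ≤ C * (1 + ξ ^ 2) ^ M) : IsTempered fun ξ => p ξ * g ξ := by
  obtain ⟨hgm, N, hN⟩ := hg
  have hm := hp.aestronglyMeasurable.mul hgm
  refine ⟨hm, M + N, (hN.const_mul C).mono' ?_ (Filter.Eventually.of_forall fun ξ => ?_)⟩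
  · exact (hm.norm.aemeasurable.div (by fun_prop :
      Measurable fun ξ : ℝ => (1 + ξ ^ 2) ^ (M + N)).aemeasurable).aestronglyMeasurable
  · rw [Real.norm_of_nonneg (by positivity), norm_mul, pow_add]
    have h1 : (0 : ℝ) < (1 + ξ ^ 2) ^ M := by positivity
    have h2 : (0 : ℝ) < (1 + ξ ^ 2) ^ N := by positivity
    rw [div_le_iff₀ (by positivity)]
    calc ‖p ξ‖ * ‖g ξ‖ ≤ C * (1 + ξ ^ 2) ^ M * ‖g ξ‖ := by gcongr; exact hC ξ
      _ = _ := by field_simp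

theorem const_mul (hg : IsTempered g) (c : ℂ) : IsTempered fun ξ => c * g ξ :=
  hg.mul_of_le continuous_const (C := ‖c‖) (M := 0) (by simp)

theorem mul_id (hg : IsTempered g) : IsTempered fun ξ : ℝ => (ξ : ℂ) * g ξ :=
  hg.mul_of_le Complex.continuous_ofReal (C := 1) (M := 1) fun ξ => by
    simp only [Complex.norm_real, Real.norm_eq_abs]
    cases abs_cases ξ <;> nlinarith [sq_nonneg (ξ - 1), sq_nonneg (ξ + 1)]

open FourierTransform in
-- The transform of a test function is Schwartz, so it beats the polynomial weight of `g`.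
theorem integrable_mul_testFT (hg : IsTempered g) {χ : ℝ → ℂ} (hχ : ContDiff ℝ ∞ χ)
    (hc : HasCompactSupport χ) : Integrable (fun ξ => g ξ * testFT χ ξ) := by
  obtain ⟨hgm, N, hN⟩ := hg
  set ψ : SchwartzMap ℝ ℂ := 𝓕⁻ (hc.toSchwartzMap hχ) with hψ
  have hψt : ∀ ξ, testFT χ ξ = ψ (ξ / (2 * Real.pi)) := fun ξ => by
    rw [testFT_eq_fourierInv, hψ, SchwartzMap.fourierInv_coe]; rfl
  have hπ := Real.pi_pos
  obtain ⟨C, hC⟩ : ∃ C, ∀ w : ℝ, (1 + ‖w‖) ^ (2 * N) * ‖ψ w‖ ≤ C := by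
    have h := SchwartzMap.one_add_le_sup_seminorm_apply (𝕜 := ℝ) (m := (2 * N, 0)) (k := 2 * N)
      (n := 0) le_rfl le_rfl ψ
    simp only [norm_iteratedFDeriv_zero] at h
    exact ⟨_, h⟩
  refine (hN.mul_const ((2 * Real.pi) ^ (2 * N) * C)).mono' ?_
    (Filter.Eventually.of_forall fun ξ => ?_)
  · refine hgm.mul (Continuous.aestronglyMeasurable ?_)
    rw [funext hψt]
    exact ψ.continuous.comp (continuous_id.div_const _)
  · rw [norm_mul, hψt, div_mul_eq_mul_div, le_div_iff₀ (by positivity), mul_assoc]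
    refine mul_le_mul_of_nonneg_left ?_ (norm_nonneg _)
    set w := ξ / (2 * Real.pi) with hw
    have hξ : ξ = 2 * Real.pi * w := by rw [hw]; field_simp
    have h1 : 1 + ξ ^ 2 ≤ (2 * Real.pi * (1 + ‖w‖)) ^ 2 := by
      rw [hξ, Real.norm_eq_abs]
      have := sq_abs w
      have := abs_nonneg w
      have h3 : 1 ≤ (2 * Real.pi) ^ 2 := by nlinarith [Real.pi_gt_three]
      have h4 : 0 ≤ (2 * Real.pi) ^ 2 * |w| := by positivity
      rw [mul_pow, mul_pow]
      nlinarith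
    calc ‖ψ w‖ * (1 + ξ ^ 2) ^ N ≤ ‖ψ w‖ * ((2 * Real.pi * (1 + ‖w‖)) ^ 2) ^ N := by gcongr
      _ = (2 * Real.pi) ^ (2 * N) * ((1 + ‖w‖) ^ (2 * N) * ‖ψ w‖) := by
        rw [← pow_mul, mul_pow]; ring
      _ ≤ _ := by gcongr; exact hC w

end IsTempered

/-! ### Uniqueness of the distributional Fourier transform. -/

open FourierTransform in
theorem integral_fourier_mul_eq_of_integrable {f g : ℝ → ℂ} (hf : Integrable f)
    (hg : Integrable g) : ∫ ξ, 𝓕 f ξ * g ξ = ∫ x, f x * 𝓕 g x := by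
  simpa using! VectorFourier.integral_fourierIntegral_smul_eq_flip (L := innerₗ ℝ)
    Real.continuous_fourierChar continuous_inner hf hg

theorem testFT_translate (χ : ℝ → ℂ) (a ξ : ℝ) :
    testFT (fun y => χ (y - a)) ξ = Complex.exp (Complex.I * ξ * a) * testFT χ ξ := by
  rw [testFT, testFT, ← integral_const_mul, ← integral_add_right_eq_self _ a]
  congr 1; ext y
  rw [add_sub_cancel_right, ← mul_assoc, ← Complex.exp_add]
  push_cast
  ring_nf

open FourierTransform in
-- Any test function is `𝓕 τ` with `τ` Schwartz, and the multiplication formula moves the transform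
-- onto `G`, where it vanishes.
theorem ae_eq_zero_of_fourierInv_eq_zero {G : ℝ → ℂ} (hG : Integrable G)
    (h : ∀ w, 𝓕⁻ G w = 0) : ∀ᵐ ξ, G ξ = 0 := by
  have hF : ∀ w, 𝓕 G w = 0 := fun w => by
    have := h (-w)
    rwa [Real.fourierInv_eq_fourier_neg, neg_neg] at this
  refine ae_eq_zero_of_integral_contDiff_smul_eq_zero hG.locallyIntegrable fun σ hσ hσc => ?_
  have hσ' : ContDiff ℝ ∞ fun x => (σ x : ℂ) := Complex.ofRealCLM.contDiff.comp hσ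
  have hσc' : HasCompactSupport fun x => (σ x : ℂ) := hσc.comp_left Complex.ofReal_zero
  set τ : SchwartzMap ℝ ℂ := 𝓕⁻ (hσc'.toSchwartzMap hσ') with hτ
  have hστ : ∀ x, (σ x : ℂ) = 𝓕 (τ : ℝ → ℂ) x := fun x => by
    rw [← SchwartzMap.fourier_coe, hτ, FourierTransform.fourier_fourierInv_eq]; rfl
  calc ∫ x, σ x • G x = ∫ x, 𝓕 (τ : ℝ → ℂ) x * G x := by
        congr 1; ext x; rw [← hστ, Complex.real_smul]
    _ = ∫ x, τ x * 𝓕 G x := integral_fourier_mul_eq_of_integrable τ.integrable hG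
    _ = 0 := by simp [hF]

/-- For a bump function supported in `[-1/(n+1), 1/(n+1)]` the Fourier integral does not vanish
on `[-(n+1), n+1]`. -/
theorem exists_testFT_ne_zero (n : ℕ) : ∃ χ : ℝ → ℂ, ContDiff ℝ ∞ χ ∧ HasCompactSupport χ ∧
    ∀ ξ : ℝ, |ξ| ≤ n + 1 → testFT χ ξ ≠ 0 := by
  have hn : (0 : ℝ) < 1 / (n + 1) := by positivity
  let b : ContDiffBump (0 : ℝ) := ⟨1 / (n + 1) / 2, 1 / (n + 1), by positivity, by linarith⟩
  refine ⟨fun y => (b y : ℂ), Complex.ofRealCLM.contDiff.comp b.contDiff,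
    b.hasCompactSupport.comp_left Complex.ofReal_zero, fun ξ hξ h0 => ?_⟩
  have hint : Integrable fun y : ℝ => Complex.exp (Complex.I * ξ * y) * (b y : ℂ) := by
    refine Continuous.integrable_of_hasCompactSupport ?_ ?_
    · have := b.continuous
      fun_prop
    · exact (b.hasCompactSupport.comp_left Complex.ofReal_zero).mul_left
  have hre : (testFT (fun y => (b y : ℂ)) ξ).re = ∫ y : ℝ, Real.cos (ξ * y) * b y := by
    rw [testFT, ← RCLike.re_eq_complex_re, ← integral_re hint]
    congr 1; ext y
    rw [RCLike.re_eq_complex_re, Complex.re_mul_ofReal,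
      show Complex.I * ξ * y = ((ξ * y : ℝ) : ℂ) * Complex.I by push_cast; ring,
      Complex.exp_ofReal_mul_I_re]
  -- On the support `|ξ y| ≤ 1`, so the cosine is positive and the real part of the transform cannot
  -- vanish.
  have hpos : ∀ y : ℝ, 0 ≤ Real.cos (ξ * y) * b y := fun y => by
    by_cases hy : y ∈ Metric.ball (0 : ℝ) b.rOut
    · refine mul_nonneg (Real.cos_pos_of_le_one ?_).le b.nonneg
      have hy' : |y| < 1 / (n + 1) := by simpa [b] using hy
      rw [abs_mul]
      calc |ξ| * |y| ≤ (n + 1) * (1 / (n + 1)) := by gcongr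
        _ = 1 := by field_simp
    · have : b y = 0 := b.zero_of_le_dist (by simpa using hy)
      simp [this]
  have hcont : Continuous fun y : ℝ => Real.cos (ξ * y) * b y := by
    have := b.continuous
    fun_prop
  have h1 : 0 < ∫ y : ℝ, Real.cos (ξ * y) * b y := by
    refine hcont.integral_pos_of_hasCompactSupport_nonneg_nonzero
      (b.hasCompactSupport.mul_left) hpos (x := 0) ?_
    have : b 0 = 1 := b.one_of_mem_closedBall (by simp [b]; positivity)
    simp [this]
  rw [← hre, h0] at h1
  simp at h1

open FourierTransform in
-- Translating one test function `χ` multiplies its transform by all characters. Hence the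
-- integrable function `h · testFT χ` has zero Fourier transform and vanishes almost everywhere; `χ`
-- is chosen with `testFT χ ≠ 0` on a large interval.
theorem IsTempered.ae_eq_zero {h : ℝ → ℂ} (hh : IsTempered h)
    (h0 : ∀ χ : ℝ → ℂ, ContDiff ℝ ∞ χ → HasCompactSupport χ → ∫ ξ, h ξ * testFT χ ξ = 0) :
    ∀ᵐ ξ, h ξ = 0 := by
  have key : ∀ n : ℕ, ∀ᵐ ξ : ℝ, |ξ| ≤ n + 1 → h ξ = 0 := fun n => by
    obtain ⟨χ, hχ, hc, hne⟩ := exists_testFT_ne_zero n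
    have hG := hh.integrable_mul_testFT hχ hc
    have := ae_eq_zero_of_fourierInv_eq_zero hG fun w => by
      have ht := h0 (fun y => χ (y - 2 * Real.pi * w)) (hχ.comp (contDiff_id.sub contDiff_const))
        (hc.comp_homeomorph (Homeomorph.subRight (2 * Real.pi * w)))
      rw [Real.fourierInv_eq', ← ht]
      congr 1; ext ξ
      rw [testFT_translate, smul_eq_mul, ← mul_assoc, ← mul_assoc, mul_comm (h ξ)]
      congr 3
      simp only [RCLike.inner_apply, conj_trivial]
      push_cast; ring
    filter_upwards [this] with ξ hξ hle
    exact (mul_eq_zero.1 hξ).resolve_right (hne ξ hle)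
  filter_upwards [ae_all_iff.2 key] with ξ hξ
  obtain ⟨n, hn⟩ := exists_nat_ge |ξ|
  exact hξ n (by linarith)

theorem IsModeFT.unique {F g g' : ℝ → ℂ} (h : IsModeFT F g) (h' : IsModeFT F g') :
    ∀ᵐ ξ, g ξ = g' ξ := by
  have ht := h.1.add (h'.1.const_mul (-1))
  have := ht.ae_eq_zero fun χ hχ hc => by
    have h1 := h.1.integrable_mul_testFT hχ hc
    have h2 := h'.1.integrable_mul_testFT hχ hc
    calc ∫ ξ, (g ξ + -1 * g' ξ) * testFT χ ξ = ∫ ξ, (g ξ * testFT χ ξ - g' ξ * testFT χ ξ) := by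
          congr 1; ext ξ; ring
      _ = 0 := by rw [integral_sub h1 h2, ← h.2 χ hχ hc, ← h'.2 χ hχ hc, sub_self]
  filter_upwards [this] with ξ hξ
  linear_combination hξ

/-! ### Linearity and differentiation of mode transforms. -/

theorem IsModeFT.add {F G g h : ℝ → ℂ} (hF : Continuous F) (hG : Continuous G)
    (hg : IsModeFT F g) (hh : IsModeFT G h) : IsModeFT (fun y => F y + G y) fun ξ => g ξ + h ξ := by
  refine ⟨hg.1.add hh.1, fun χ hχ hc => ?_⟩
  simp only [add_mul]
  rw [integral_add, integral_add, hg.2 χ hχ hc, hh.2 χ hχ hc]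
  · exact hg.1.integrable_mul_testFT hχ hc
  · exact hh.1.integrable_mul_testFT hχ hc
  · exact (hF.mul hχ.continuous).integrable_of_hasCompactSupport hc.mul_left
  · exact (hG.mul hχ.continuous).integrable_of_hasCompactSupport hc.mul_left

theorem IsModeFT.const_mul {F g : ℝ → ℂ} (hg : IsModeFT F g) (c : ℂ) :
    IsModeFT (fun y => c * F y) fun ξ => c * g ξ := by
  refine ⟨hg.1.const_mul c, fun χ hχ hc => ?_⟩
  simp only [mul_assoc]
  rw [integral_const_mul, integral_const_mul, hg.2 χ hχ hc]

theorem isModeFT_zero : IsModeFT (fun _ => 0) fun _ => 0 :=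
  ⟨⟨aestronglyMeasurable_const, 0, by simp⟩, by simp⟩

theorem testFT_deriv {χ : ℝ → ℂ} (hχ : ContDiff ℝ ∞ χ) (hc : HasCompactSupport χ) (ξ : ℝ) :
    testFT (deriv χ) ξ = -(Complex.I * ξ) * testFT χ ξ := by
  have he : ∀ y : ℝ, HasDerivAt (fun y : ℝ => Complex.exp (Complex.I * ξ * y))
      (Complex.I * ξ * Complex.exp (Complex.I * ξ * y)) y := fun y => by
    have := ((hasDerivAt_id (y : ℂ)).const_mul (Complex.I * (ξ : ℂ))).cexp.comp_ofReal
    simpa [mul_comm] using this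
  have hd : ∀ y, HasDerivAt χ (deriv χ y) y := fun y =>
    (hχ.differentiable (by simp)).differentiableAt.hasDerivAt
  have hdc : Continuous (deriv χ) := hχ.continuous_deriv (by simp)
  have hχc := hχ.continuous
  have := integral_mul_deriv_eq_deriv_mul_of_integrable (u := fun y : ℝ => Complex.exp (Complex.I * ξ * y))
    (v := χ) (u' := fun y : ℝ => Complex.I * ξ * Complex.exp (Complex.I * ξ * y)) (v' := deriv χ)
    (fun y _ => he y) (fun y _ => hd y)
    (Continuous.integrable_of_hasCompactSupport (by fun_prop) hc.deriv.mul_left)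
    (Continuous.integrable_of_hasCompactSupport (by fun_prop) hc.mul_left)
    (Continuous.integrable_of_hasCompactSupport (by fun_prop) hc.mul_left)
  rw [testFT, this, testFT, ← integral_const_mul, ← integral_neg]
  congr 1; ext y; ring

/-- Integration by parts against the compactly supported test function, so `F` and `F'` need no
decay. -/
theorem IsModeFT.deriv {F F' g : ℝ → ℂ} (hg : IsModeFT F g) (hF : ∀ y, HasDerivAt F (F' y) y)
    (hF' : Continuous F') : IsModeFT F' fun ξ => Complex.I * (ξ * g ξ) := by
  refine ⟨hg.1.mul_id.const_mul _, fun χ hχ hc => ?_⟩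
  have hFc : Continuous F := continuous_iff_continuousAt.2 fun y => (hF y).continuousAt
  have hd : ∀ y, HasDerivAt χ (_root_.deriv χ y) y := fun y =>
    (hχ.differentiable (by simp)).differentiableAt.hasDerivAt
  have hdc : ContDiff ℝ ∞ (_root_.deriv χ) := by
    have := (contDiff_infty_iff_deriv.1 hχ).2
    exact this
  have hχc := hχ.continuous
  have hdc' := hdc.continuous
  have := integral_mul_deriv_eq_deriv_mul_of_integrable (u := F) (v := χ) (u' := F')
    (v' := _root_.deriv χ) (fun y _ => hF y) (fun y _ => hd y)
    (Continuous.integrable_of_hasCompactSupport (by fun_prop) hc.deriv.mul_left)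
    (Continuous.integrable_of_hasCompactSupport (by fun_prop) hc.mul_left)
    (Continuous.integrable_of_hasCompactSupport (by fun_prop) hc.mul_left)
  rw [hg.2 _ hdc hc.deriv] at this
  rw [eq_comm, neg_eq_iff_eq_neg] at this
  rw [this, ← integral_neg]
  congr 1; ext ξ
  rw [testFT_deriv hχ hc]
  ring

/-! ### Plancherel -/

theorem lintegral_comp_div_two_pi (f : ℝ → ℝ≥0∞) :
    ∫⁻ ξ : ℝ, f (ξ / (2 * Real.pi)) = ENNReal.ofReal (2 * Real.pi) * ∫⁻ w : ℝ, f w := by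
  have hπ := Real.two_pi_pos
  have h := Real.smul_map_volume_mul_left (a := (2 * Real.pi)⁻¹) (by positivity)
  have hm := lintegral_map_equiv (μ := volume) f
    (Homeomorph.mulLeft₀ ((2 * Real.pi)⁻¹) (by positivity)).toMeasurableEquiv
  have h2 : Measure.map (fun x => (2 * Real.pi)⁻¹ * x) volume
      = ENNReal.ofReal (2 * Real.pi) • (volume : Measure ℝ) := by
    conv_rhs => rw [← h, smul_smul, ← ENNReal.ofReal_mul hπ.le, abs_of_pos (by positivity),
      mul_inv_cancel₀ hπ.ne', ENNReal.ofReal_one, one_smul]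
  have h3 : (⇑(Homeomorph.mulLeft₀ ((2 * Real.pi)⁻¹) (by positivity)).toMeasurableEquiv : ℝ → ℝ)
      = fun x => (2 * Real.pi)⁻¹ * x := rfl
  rw [h3, h2, lintegral_smul_measure] at hm
  rw [smul_eq_mul] at hm
  rw [hm]
  congr 1; ext ξ
  rw [div_eq_inv_mul]

theorem eLpNorm_two_sq {α E : Type*} [MeasurableSpace α] {μ : Measure α} [NormedAddCommGroup E]
    (f : α → E) : eLpNorm f 2 μ ^ 2 = ∫⁻ x, ‖f x‖ₑ ^ 2 ∂μ := by
  rw [eLpNorm_eq_lintegral_rpow_enorm_toReal (by simp) (by simp)]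
  rw [← ENNReal.rpow_natCast, ← ENNReal.rpow_mul]
  simp

/-- The exponent `N = 1` suffices: with `v = (1 + ξ²)⁻¹ ≤ 1` one has `‖g‖ v ≤ ‖g‖² + v`. -/
theorem isTempered_of_memLp {g : ℝ → ℂ} (hg : MemLp g 2 volume) : IsTempered g := by
  refine ⟨hg.1, 1, (hg.integrable_norm_pow (p := 2) (by simp) |>.add integrable_inv_one_add_sq).mono'
    ?_ (Filter.Eventually.of_forall fun ξ => ?_)⟩
  · exact (hg.1.norm.aemeasurable.div
      (by fun_prop : Measurable fun ξ : ℝ => (1 + ξ ^ 2) ^ 1).aemeasurable).aestronglyMeasurable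
  · rw [Real.norm_of_nonneg (by positivity), div_eq_mul_inv, pow_one]
    simp only [Pi.add_apply]
    have h1 : 0 < (1 + ξ ^ 2)⁻¹ := by positivity
    have h2 : (1 + ξ ^ 2)⁻¹ ≤ 1 := inv_le_one_of_one_le₀ (by nlinarith [sq_nonneg ξ])
    nlinarith [sq_nonneg (‖g ξ‖ - (1 + ξ ^ 2)⁻¹), norm_nonneg (g ξ), sq_nonneg (‖g ξ‖)]

open FourierTransform in
/-- Existence of the Fourier transform of a square integrable mode, with Plancherel's identity. -/
theorem exists_isModeFT {F : ℝ → ℂ} (hF : MemLp F 2 volume) :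
    ∃ g : ℝ → ℂ, IsModeFT F g ∧
      ∫⁻ ξ, ‖g ξ‖ₑ ^ 2 = ENNReal.ofReal (1 / (2 * Real.pi)) * ∫⁻ y, ‖F y‖ₑ ^ 2 := by
  have hπ := Real.two_pi_pos
  set Fl : Lp ℂ 2 (volume : Measure ℝ) := hF.toLp F with hFl
  set G : Lp ℂ 2 (volume : Measure ℝ) := 𝓕 Fl with hG
  -- The transform `𝓕` uses `e^{-2πiyw}`; passing to `ξ = 2πw` and to the prefactor `1/2π` gives the
  -- present normalization.
  set g : ℝ → ℂ := fun ξ => ((1 / (2 * Real.pi) : ℝ) : ℂ) * G (ξ / (2 * Real.pi)) with hg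
  have hgm : AEStronglyMeasurable g volume :=
    (((Lp.stronglyMeasurable G).comp_measurable (measurable_id.div_const _)).const_mul _
      ).aestronglyMeasurable
  have hnorm : ∫⁻ y, ‖G y‖ₑ ^ 2 = ∫⁻ y, ‖F y‖ₑ ^ 2 := by
    rw [← eLpNorm_two_sq, ← eLpNorm_two_sq, ← eLpNorm_congr_ae hF.coeFn_toLp, ← Lp.enorm_def,
      ← Lp.enorm_def]
    have : ‖G‖ = ‖Fl‖ := Lp.norm_fourier_eq Fl
    rw [← ofReal_norm, ← ofReal_norm, this]
  have hpl : ∫⁻ ξ, ‖g ξ‖ₑ ^ 2 = ENNReal.ofReal (1 / (2 * Real.pi)) * ∫⁻ y, ‖F y‖ₑ ^ 2 := by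
    have h1 : ∀ ξ, ‖g ξ‖ₑ ^ 2 = ENNReal.ofReal (1 / (2 * Real.pi)) ^ 2 *
        ‖G (ξ / (2 * Real.pi))‖ₑ ^ 2 := fun ξ => by
      rw [hg]
      simp only
      rw [enorm_mul, mul_pow, ← ofReal_norm, Complex.norm_real,
        Real.norm_of_nonneg (by positivity)]
    simp_rw [h1]
    rw [lintegral_const_mul' _ _ (by simp), lintegral_comp_div_two_pi (fun w => ‖G w‖ₑ ^ 2), hnorm,
      ← mul_assoc, pow_two, mul_assoc (ENNReal.ofReal _), ← ENNReal.ofReal_mul (by positivity)]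
    rw [one_div_mul_cancel hπ.ne', ENNReal.ofReal_one, mul_one]
  have hgL : MemLp g 2 volume := by
    refine ⟨hgm, ?_⟩
    have : eLpNorm g 2 volume ^ 2 < ⊤ := by
      rw [eLpNorm_two_sq, hpl, ← eLpNorm_two_sq]
      exact ENNReal.mul_lt_top (by simp) (ENNReal.pow_lt_top hF.2)
    exact (ENNReal.pow_lt_top_iff.1 this).resolve_right (by norm_num)
  refine ⟨g, ⟨isTempered_of_memLp hgL, fun χ hχ hc => ?_⟩, hpl⟩
  set X : SchwartzMap ℝ ℂ := hc.toSchwartzMap hχ with hX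
  have h1 : ∫ y, F y * χ y = (Fl : TemperedDistribution ℝ ℂ) X := by
    rw [Lp.toTemperedDistribution_apply]
    refine integral_congr_ae ?_
    filter_upwards [hF.coeFn_toLp] with y hy
    rw [hFl, hy, smul_eq_mul, mul_comm]; rfl
  -- As tempered distributions: `χ = 𝓕 (𝓕⁻ χ)`, and the outer transform is moved onto the `L²`
  -- function.
  have h2 : (Fl : TemperedDistribution ℝ ℂ) X = (G : TemperedDistribution ℝ ℂ) (𝓕⁻ X) := by
    rw [hG, ← Lp.fourier_toTemperedDistribution_eq, TemperedDistribution.fourier_apply,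
      FourierTransform.fourier_fourierInv_eq]
  have h3 : ∀ ξ, g ξ * testFT χ ξ = ((1 / (2 * Real.pi) : ℝ) : ℂ) *
      (fun w => G w * 𝓕⁻ χ w) (ξ / (2 * Real.pi)) := fun ξ => by
    rw [testFT_eq_fourierInv, hg]; simp only; ring
  rw [h1, h2, Lp.toTemperedDistribution_apply]
  simp_rw [h3]
  rw [integral_const_mul, Measure.integral_comp_div (fun w => G w * 𝓕⁻ χ w), abs_of_pos hπ, Complex.real_smul, ← mul_assoc,
    ← Complex.ofReal_mul, one_div_mul_cancel hπ.ne', Complex.ofReal_one, one_mul]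
  congr 1; ext w
  rw [smul_eq_mul, mul_comm, SchwartzMap.fourierInv_coe]; rfl

theorem IsModeFT.plancherel {F g : ℝ → ℂ} (h : IsModeFT F g) (hF : MemLp F 2 volume) :
    ∫⁻ ξ, ‖g ξ‖ₑ ^ 2 = ENNReal.ofReal (1 / (2 * Real.pi)) * ∫⁻ y, ‖F y‖ₑ ^ 2 := by
  obtain ⟨g', h', hp⟩ := exists_isModeFT hF
  rw [← hp]
  refine lintegral_congr_ae ?_
  filter_upwards [h.unique h'] with ξ hξ
  rw [hξ]

/-! ### Fourier integrals of integrable functions. -/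

theorem continuous_intFT {G : ℝ → ℂ} (hG : Integrable G) : Continuous (intFT G) := by
  refine continuous_of_dominated (bound := fun y => ‖G y‖) (fun ξ => ?_)
    (fun ξ => Filter.Eventually.of_forall fun y => ?_) hG.norm
    (Filter.Eventually.of_forall fun y => by fun_prop)
  · exact (Continuous.aestronglyMeasurable (by fun_prop)).mul hG.1
  · rw [norm_mul, show -(Complex.I * (ξ : ℂ) * y) = ((-(ξ * y) : ℝ) : ℂ) * Complex.I by
      push_cast; ring, Complex.norm_exp_ofReal_mul_I, one_mul]

theorem norm_intFT_le (G : ℝ → ℂ) (ξ : ℝ) : ‖intFT G ξ‖ ≤ ∫ y, ‖G y‖ := by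
  refine (norm_integral_le_integral_norm _).trans (le_of_eq ?_)
  congr 1; ext y
  rw [norm_mul, show -(Complex.I * (ξ : ℂ) * y) = ((-(ξ * y) : ℝ) : ℂ) * Complex.I by
      push_cast; ring, Complex.norm_exp_ofReal_mul_I, one_mul]

open FourierTransform in
theorem isModeFT_intFT {G : ℝ → ℂ} (hG : Integrable G) :
    IsModeFT G fun ξ => ((1 / (2 * Real.pi) : ℝ) : ℂ) * intFT G ξ := by
  have hπ := Real.two_pi_pos
  have hcont := continuous_intFT hG
  refine ⟨IsTempered.const_mul ⟨hcont.aestronglyMeasurable, 1, ?_⟩ _, fun χ hχ hc => ?_⟩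
  · refine (integrable_inv_one_add_sq.const_mul (∫ y, ‖G y‖)).mono' ?_
      (Filter.Eventually.of_forall fun ξ => ?_)
    · exact (hcont.norm.div (by fun_prop) fun ξ => by positivity).aestronglyMeasurable
    · rw [Real.norm_of_nonneg (by positivity), div_eq_mul_inv, pow_one]
      gcongr
      exact norm_intFT_le G ξ
  · set X : SchwartzMap ℝ ℂ := hc.toSchwartzMap hχ with hX
    have hinv : ∀ y, χ y = 𝓕 (𝓕⁻ χ) y := fun y => by
      have : (X : ℝ → ℂ) y = 𝓕 (𝓕⁻ (X : ℝ → ℂ)) y := by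
        rw [← SchwartzMap.fourierInv_coe, ← SchwartzMap.fourier_coe,
          FourierTransform.fourier_fourierInv_eq]
      exact this
    have hint : Integrable (𝓕⁻ χ) := by
      have := (𝓕⁻ X).integrable (μ := volume)
      rwa [SchwartzMap.fourierInv_coe] at this
    have h3 : ∀ ξ, ((1 / (2 * Real.pi) : ℝ) : ℂ) * intFT G ξ * testFT χ ξ =
        ((1 / (2 * Real.pi) : ℝ) : ℂ) * (fun w => 𝓕 G w * 𝓕⁻ χ w) (ξ / (2 * Real.pi)) := fun ξ => by
      rw [testFT_eq_fourierInv, intFT_eq_fourier]; simp only; ring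
    simp_rw [h3]
    rw [integral_const_mul, Measure.integral_comp_div (fun w => 𝓕 G w * 𝓕⁻ χ w), abs_of_pos hπ, Complex.real_smul,
      ← mul_assoc, ← Complex.ofReal_mul, one_div_mul_cancel hπ.ne', Complex.ofReal_one, one_mul,
      integral_fourier_mul_eq_of_integrable hG hint]
    congr 1; ext y
    rw [hinv y]

theorem lintegral_intFT_sq {G : ℝ → ℂ} (hG : Integrable G) (hG2 : MemLp G 2 volume) :
    ∫⁻ ξ, ‖intFT G ξ‖ₑ ^ 2 = ENNReal.ofReal (2 * Real.pi) * ∫⁻ y, ‖G y‖ₑ ^ 2 := by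
  have hπ := Real.two_pi_pos
  have h := (isModeFT_intFT hG).plancherel hG2
  have h1 : ∀ ξ, ‖((1 / (2 * Real.pi) : ℝ) : ℂ) * intFT G ξ‖ₑ ^ 2
      = ENNReal.ofReal (1 / (2 * Real.pi)) ^ 2 * ‖intFT G ξ‖ₑ ^ 2 := fun ξ => by
    rw [enorm_mul, mul_pow, ← ofReal_norm, Complex.norm_real,
        Real.norm_of_nonneg (by positivity)]
  simp_rw [h1] at h
  rw [lintegral_const_mul' _ _ (by simp)] at h
  have h2 : ENNReal.ofReal (2 * Real.pi) * ENNReal.ofReal (1 / (2 * Real.pi)) = 1 := by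
    rw [← ENNReal.ofReal_mul hπ.le, mul_one_div_cancel hπ.ne', ENNReal.ofReal_one]
  calc ∫⁻ ξ, ‖intFT G ξ‖ₑ ^ 2
      = (ENNReal.ofReal (2 * Real.pi) * ENNReal.ofReal (1 / (2 * Real.pi))) ^ 2 *
          ∫⁻ ξ, ‖intFT G ξ‖ₑ ^ 2 := by rw [h2]; simp
    _ = ENNReal.ofReal (2 * Real.pi) ^ 2 *
          (ENNReal.ofReal (1 / (2 * Real.pi)) * ∫⁻ y, ‖G y‖ₑ ^ 2) := by
        rw [mul_pow, mul_assoc, h]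
    _ = _ := by rw [pow_two, ← mul_assoc, mul_assoc (ENNReal.ofReal _), h2, mul_one]

/-! ### Differentiation of interval integrals with parameters -/

/-- Continuity is asked only for positive parameters, where the equations give time derivatives. The
dominating constant comes from compactness over `[s₀/2, 2s₀]`. -/
theorem hasDerivAt_intervalIntegral_of_continuousOn {h h' : ℝ → ℝ → ℂ} {a b s₀ : ℝ} (hs₀ : 0 < s₀)
    (hc : ContinuousOn (Function.uncurry h) (Ioi 0 ×ˢ univ))
    (hc' : ContinuousOn (Function.uncurry h') (Ioi 0 ×ˢ univ))
    (hd : ∀ s, 0 < s → ∀ y, HasDerivAt (fun s => h s y) (h' s y) s) :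
    HasDerivAt (fun s => ∫ y in a..b, h s y) (∫ y in a..b, h' s₀ y) s₀ := by
  have hsl : ∀ {h : ℝ → ℝ → ℂ}, ContinuousOn (Function.uncurry h) (Ioi 0 ×ˢ univ) →
      ∀ s, 0 < s → Continuous (h s) := fun {h} hc s hs => by
    have : Continuous fun y => Function.uncurry h (s, y) :=
      hc.comp_continuous (by fun_prop) fun y => ⟨hs, mem_univ _⟩
    exact this
  have hK : IsCompact (Icc (s₀ / 2) (2 * s₀) ×ˢ uIcc a b) := isCompact_Icc.prod isCompact_uIcc
  obtain ⟨C, hC⟩ := hK.exists_bound_of_continuousOn (hc'.mono fun p hp =>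
    ⟨(by linarith : (0 : ℝ) < s₀ / 2).trans_le hp.1.1, mem_univ _⟩)
  refine (intervalIntegral.hasDerivAt_integral_of_dominated_loc_of_deriv_le (F := h) (F' := h')
    (s := Icc (s₀ / 2) (2 * s₀)) (bound := fun _ => C)
    (Icc_mem_nhds (by linarith) (by linarith)) ?_ ?_ ?_ ?_ ?_ ?_).2
  · filter_upwards [Ioi_mem_nhds hs₀] with s hs
    exact (hsl hc s hs).aestronglyMeasurable
  · exact (hsl hc s₀ hs₀).intervalIntegrable _ _
  · exact (hsl hc' s₀ hs₀).aestronglyMeasurable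
  · exact Filter.Eventually.of_forall fun y hy s hs => hC (s, y) ⟨hs, uIoc_subset_uIcc hy⟩
  · simp
  · exact Filter.Eventually.of_forall fun y _ s hs =>
      hd s ((by linarith : (0 : ℝ) < s₀ / 2).trans_le hs.1) y

theorem continuousOn_intervalIntegral {X : Type*} [TopologicalSpace X] [FirstCountableTopology X]
    {U : Set X} {h : X → ℝ → ℂ} (hc : ContinuousOn (Function.uncurry h) (U ×ˢ univ)) (a b : ℝ) :
    ContinuousOn (fun s => ∫ y in a..b, h s y) U := by
  rw [continuousOn_iff_continuous_domRestrict]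
  refine intervalIntegral.continuous_parametric_intervalIntegral_of_continuous'
    (f := fun (s : U) y => h s y) ?_ a b
  exact hc.comp_continuous (f := fun p : U × ℝ => ((p.1 : X), p.2)) (by fun_prop)
    fun p => ⟨p.1.2, mem_univ _⟩

/-! ### Modes of functions on the strip -/

/-- Smooth functions on the strip, `2π`-periodic in `x`. -/
structure IsSmoothPeriodic (f : ℝ → ℝ → ℝ) : Prop where
  smooth : ContDiff ℝ ∞ (Function.uncurry f)
  periodic : ∀ x y, f (x + 2 * Real.pi) y = f x y

namespace IsSmoothPeriodic

variable {f g : ℝ → ℝ → ℝ}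

theorem hasDerivAt_dx (hf : IsSmoothPeriodic f) (x y : ℝ) :
    HasDerivAt (fun x => f x y) (fderiv ℝ (Function.uncurry f) (x, y) (1, 0)) x := by
  have h : HasFDerivAt (Function.uncurry f) (fderiv ℝ (Function.uncurry f) (x, y)) (x, y) :=
    (hf.smooth.differentiable (by simp)).differentiableAt.hasFDerivAt
  exact h.comp_hasDerivAt x ((hasDerivAt_id x).prodMk (hasDerivAt_const x y))

theorem hasDerivAt_dy (hf : IsSmoothPeriodic f) (x y : ℝ) :
    HasDerivAt (fun y => f x y) (fderiv ℝ (Function.uncurry f) (x, y) (0, 1)) y := by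
  have h : HasFDerivAt (Function.uncurry f) (fderiv ℝ (Function.uncurry f) (x, y)) (x, y) :=
    (hf.smooth.differentiable (by simp)).differentiableAt.hasFDerivAt
  exact h.comp_hasDerivAt y ((hasDerivAt_const y x).prodMk (hasDerivAt_id y))

theorem dx_eq (hf : IsSmoothPeriodic f) (x y : ℝ) :
    dx f x y = fderiv ℝ (Function.uncurry f) (x, y) (1, 0) := (hf.hasDerivAt_dx x y).deriv

theorem dy_eq (hf : IsSmoothPeriodic f) (x y : ℝ) :
    dy f x y = fderiv ℝ (Function.uncurry f) (x, y) (0, 1) := (hf.hasDerivAt_dy x y).deriv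

theorem dx (hf : IsSmoothPeriodic f) : IsSmoothPeriodic (dx f) := by
  constructor
  · have h : Function.uncurry (ElectronCouette.dx f)
        = fun p => fderiv ℝ (Function.uncurry f) p (1, 0) := by
      ext ⟨x, y⟩; exact hf.dx_eq x y
    rw [h]
    exact (hf.smooth.fderiv_right (m := ∞) (by simp)).clm_apply contDiff_const
  · intro x y
    rw [ElectronCouette.dx, ElectronCouette.dx, ← deriv_comp_add_const]
    simp_rw [hf.periodic]

theorem dy (hf : IsSmoothPeriodic f) : IsSmoothPeriodic (dy f) := by
  constructor
  · have h : Function.uncurry (ElectronCouette.dy f)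
        = fun p => fderiv ℝ (Function.uncurry f) p (0, 1) := by
      ext ⟨x, y⟩; exact hf.dy_eq x y
    rw [h]
    exact (hf.smooth.fderiv_right (m := ∞) (by simp)).clm_apply contDiff_const
  · intro x y
    rw [ElectronCouette.dy, ElectronCouette.dy]
    simp_rw [hf.periodic]

theorem add (hf : IsSmoothPeriodic f) (hg : IsSmoothPeriodic g) :
    IsSmoothPeriodic fun x y => f x y + g x y :=
  ⟨hf.smooth.add hg.smooth, fun x y => by rw [hf.periodic, hg.periodic]⟩

theorem const_mul (hf : IsSmoothPeriodic f) (c : ℝ) : IsSmoothPeriodic fun x y => c * f x y :=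
  ⟨contDiff_const.mul hf.smooth, fun x y => by rw [hf.periodic]⟩

theorem continuous_left (hf : IsSmoothPeriodic f) (y : ℝ) : Continuous fun x => f x y :=
  hf.smooth.continuous.comp (by fun_prop : Continuous fun x : ℝ => (x, y))

end IsSmoothPeriodic

theorem continuous_mode {f : ℝ → ℝ → ℝ} (hf : Continuous (Function.uncurry f)) (k : ℤ) :
    Continuous (mode k f) := by
  refine intervalIntegral.continuous_parametric_intervalIntegral_of_continuous' ?_ _ _
  have : Continuous fun p : ℝ × ℝ => f p.2 p.1 := hf.comp continuous_swap
  simp only [Function.uncurry_def]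
  fun_prop

theorem intervalIntegrable_mode_integrand {f : ℝ → ℝ → ℝ} (k : ℤ) (y : ℝ)
    (hf : Continuous fun x => f x y) (a b : ℝ) : IntervalIntegrable
      (fun x : ℝ => Complex.exp (-(Complex.I * (k : ℂ) * (x : ℂ))) * (f x y : ℂ)) volume a b :=
  Continuous.intervalIntegrable (by fun_prop) _ _

theorem mode_add {f g : ℝ → ℝ → ℝ} (k : ℤ) (y : ℝ) (hf : Continuous fun x => f x y)
    (hg : Continuous fun x => g x y) :
    mode k (fun x y => f x y + g x y) y = mode k f y + mode k g y := by
  rw [mode, mode, mode, ← intervalIntegral.integral_add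
    (intervalIntegrable_mode_integrand k y hf _ _) (intervalIntegrable_mode_integrand k y hg _ _)]
  congr 1; ext x
  push_cast; ring

theorem mode_const_mul (f : ℝ → ℝ → ℝ) (k : ℤ) (c y : ℝ) :
    mode k (fun x y => c * f x y) y = c * mode k f y := by
  rw [mode, mode, ← intervalIntegral.integral_const_mul]
  congr 1; ext x
  push_cast; ring

theorem mode_id_mul (f : ℝ → ℝ → ℝ) (k : ℤ) (y : ℝ) :
    mode k (fun x y => y * f x y) y = y * mode k f y := by
  rw [mode, mode, ← intervalIntegral.integral_const_mul]
  congr 1; ext x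
  push_cast; ring

namespace IsSmoothPeriodic

variable {f g : ℝ → ℝ → ℝ}

theorem hasDerivAt_mode (hf : IsSmoothPeriodic f) (k : ℤ) (y : ℝ) :
    HasDerivAt (mode k f) (mode k (ElectronCouette.dy f) y) y := by
  have hd := hf.dy.smooth.continuous
  have hc := hf.smooth.continuous
  have hE : Continuous fun p : ℝ × ℝ =>
      Complex.exp (-(Complex.I * (k : ℂ) * ((p.2 : ℝ) : ℂ))) := by fun_prop
  -- The variable is shifted so that `y` corresponds to the positive parameter `s = 1`.
  have key := hasDerivAt_intervalIntegral_of_continuousOn (a := 0) (b := 2 * Real.pi) (s₀ := 1)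
    (h := fun s x => Complex.exp (-(Complex.I * (k : ℂ) * (x : ℂ))) * (f x (s + (y - 1)) : ℂ))
    (h' := fun s x => Complex.exp (-(Complex.I * (k : ℂ) * (x : ℂ))) *
      (ElectronCouette.dy f x (s + (y - 1)) : ℂ)) one_pos ?_ ?_ ?_
  · have := HasDerivAt.comp_sub_const y (y - 1) (f := fun s => ∫ x in (0 : ℝ)..(2 * Real.pi),
      Complex.exp (-(Complex.I * (k : ℂ) * (x : ℂ))) * (f x (s + (y - 1)) : ℂ))
      (by rw [sub_sub_cancel]; exact key)
    simpa [mode] using! this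
  · refine (hE.mul (Complex.continuous_ofReal.comp (hc.comp
      (by fun_prop : Continuous fun p : ℝ × ℝ => (p.2, p.1 + (y - 1)))))).continuousOn
  · refine (hE.mul (Complex.continuous_ofReal.comp (hd.comp
      (by fun_prop : Continuous fun p : ℝ × ℝ => (p.2, p.1 + (y - 1)))))).continuousOn
  · intro s _ x
    refine HasDerivAt.const_mul _ (HasDerivAt.ofReal_comp ?_)
    refine HasDerivAt.comp_add_const s (y - 1) ?_
    rw [hf.dy_eq]
    exact hf.hasDerivAt_dy _ _

/-- Integration by parts over one period; the boundary terms cancel by periodicity of `f` and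
`e^{-2πik} = 1`. -/
theorem mode_dx (hf : IsSmoothPeriodic f) (k : ℤ) (y : ℝ) :
    mode k (ElectronCouette.dx f) y = Complex.I * k * mode k f y := by
  have he : ∀ x : ℝ, HasDerivAt (fun x : ℝ => Complex.exp (-(Complex.I * k * x)))
      (-(Complex.I * k) * Complex.exp (-(Complex.I * k * x))) x := fun x => by
    have := ((hasDerivAt_id (x : ℂ)).const_mul (Complex.I * (k : ℂ))).neg.cexp.comp_ofReal
    simpa [mul_comm] using this
  have hd : ∀ x : ℝ, HasDerivAt (fun x => (f x y : ℂ)) (ElectronCouette.dx f x y : ℂ) x := fun x =>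
    HasDerivAt.ofReal_comp (by rw [hf.dx_eq]; exact hf.hasDerivAt_dx x y)
  have hc := hf.continuous_left y
  have hc' := hf.dx.continuous_left y
  have := intervalIntegral.integral_mul_deriv_eq_deriv_mul (a := 0) (b := 2 * Real.pi)
    (fun x _ => he x) (fun x _ => hd x) (Continuous.intervalIntegrable (by fun_prop) _ _)
    (Continuous.intervalIntegrable (by fun_prop) _ _)
  rw [mode, this]
  have hper : f (2 * Real.pi) y = f 0 y := by
    have := hf.periodic 0 y
    rwa [zero_add] at this
  have hexp : Complex.exp (-(Complex.I * k * (2 * Real.pi : ℝ))) = 1 := by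
    rw [Complex.exp_neg, show Complex.I * k * (2 * Real.pi : ℝ) = k * (2 * Real.pi * Complex.I) by
      push_cast; ring, Complex.exp_int_mul_two_pi_mul_I, inv_one]
  rw [hexp, hper, mode, ← intervalIntegral.integral_const_mul]
  simp only [Complex.ofReal_zero, mul_zero, neg_zero, Complex.exp_zero, sub_self, zero_sub]
  rw [← intervalIntegral.integral_neg]
  congr 1; ext x; ring

end IsSmoothPeriodic

/-! ### Truncated Fourier transforms -/

/-- A smooth compactly supported cutoff. -/
structure IsCutoff (χ : ℝ → ℝ) : Prop where
  smooth : ContDiff ℝ ∞ χ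
  compact : HasCompactSupport χ

theorem IsCutoff.deriv {χ : ℝ → ℝ} (h : IsCutoff χ) : IsCutoff (deriv χ) :=
  ⟨(contDiff_infty_iff_deriv.1 h.smooth).2, h.compact.deriv⟩

/-- The Fourier integral of the truncation `χ F`. -/
noncomputable def truncFT (χ : ℝ → ℝ) (F : ℝ → ℂ) (ζ : ℝ) : ℂ := intFT (fun y => (χ y : ℂ) * F y) ζ

theorem IsCutoff.integrable_mul {χ : ℝ → ℝ} (h : IsCutoff χ) {F : ℝ → ℂ} (hF : Continuous F) :
    Integrable fun y => (χ y : ℂ) * F y := by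
  have := h.smooth.continuous
  exact Continuous.integrable_of_hasCompactSupport (by fun_prop)
    (h.compact.comp_left Complex.ofReal_zero).mul_right

theorem IsCutoff.integrable_exp_mul {χ : ℝ → ℝ} (h : IsCutoff χ) {F : ℝ → ℂ} (hF : Continuous F)
    (ζ : ℝ) : Integrable fun y : ℝ =>
      Complex.exp (-(Complex.I * (ζ : ℂ) * (y : ℂ))) * ((χ y : ℂ) * F y) := by
  have := h.smooth.continuous
  exact Continuous.integrable_of_hasCompactSupport (by fun_prop)
    (h.compact.comp_left Complex.ofReal_zero).mul_right.mul_left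

theorem truncFT_add {χ : ℝ → ℝ} (h : IsCutoff χ) {F G : ℝ → ℂ} (hF : Continuous F)
    (hG : Continuous G) (ζ : ℝ) :
    truncFT χ (fun y => F y + G y) ζ = truncFT χ F ζ + truncFT χ G ζ := by
  rw [truncFT, truncFT, truncFT, intFT, intFT, intFT,
    ← integral_add (h.integrable_exp_mul hF ζ) (h.integrable_exp_mul hG ζ)]
  congr 1; ext y; ring

theorem truncFT_const_mul (χ : ℝ → ℝ) (F : ℝ → ℂ) (c : ℂ) (ζ : ℝ) :
    truncFT χ (fun y => c * F y) ζ = c * truncFT χ F ζ := by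
  rw [truncFT, truncFT, intFT, intFT, ← integral_const_mul]
  congr 1; ext y; ring

/-- A `y`-derivative becomes `iζ` up to a commutator in which `χ'` multiplies the undifferentiated
function. This is why no decay of derivatives of the solution is required. -/
theorem truncFT_deriv {χ : ℝ → ℝ} (h : IsCutoff χ) {F F' : ℝ → ℂ}
    (hF : ∀ y, HasDerivAt F (F' y) y) (hF' : Continuous F') (ζ : ℝ) :
    truncFT χ F' ζ = Complex.I * ζ * truncFT χ F ζ - truncFT (deriv χ) F ζ := by
  have hFc : Continuous F := continuous_iff_continuousAt.2 fun y => (hF y).continuousAt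
  have he : ∀ y : ℝ, HasDerivAt (fun y : ℝ => Complex.exp (-(Complex.I * ζ * y)))
      (-(Complex.I * ζ) * Complex.exp (-(Complex.I * ζ * y))) y := fun y => by
    have := ((hasDerivAt_id (y : ℂ)).const_mul (Complex.I * (ζ : ℂ))).neg.cexp.comp_ofReal
    simpa [mul_comm] using this
  have hd : ∀ y, HasDerivAt (fun y => (χ y : ℂ)) ((deriv χ y : ℝ) : ℂ) y := fun y =>
    ((h.smooth.differentiable (by simp)).differentiableAt.hasDerivAt).ofReal_comp
  have hi1 := h.integrable_exp_mul hF' ζ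
  have hi2 := h.integrable_exp_mul hFc ζ
  have hi3 := h.deriv.integrable_exp_mul hFc ζ
  have := integral_mul_deriv_eq_deriv_mul_of_integrable
    (u := fun y : ℝ => Complex.exp (-(Complex.I * ζ * y)) * (χ y : ℂ)) (v := F)
    (fun y _ => (he y).mul (hd y)) (fun y _ => hF y) (hi1.congr (Filter.Eventually.of_forall
      fun y => by simp only [Pi.mul_apply]; ring))
    (((hi2.const_mul (-(Complex.I * ζ))).add hi3).congr (Filter.Eventually.of_forall
      fun y => by simp only [Pi.mul_apply, Pi.add_apply]; ring))
    (hi2.congr (Filter.Eventually.of_forall fun y => by simp only [Pi.mul_apply]; ring))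
  rw [truncFT, truncFT, truncFT, intFT, intFT, intFT, ← integral_const_mul,
    ← integral_sub (hi2.const_mul _) hi3]
  simp only [← mul_assoc] at this ⊢
  rw [this, ← integral_neg]
  congr 1; ext y; ring

/-! ### Time dependent modes along the characteristics of the shear flow -/

/-- The truncated Fourier transform of the `k`-th mode of `f s` at the moving frequency
`ξ - k s`. -/
noncomputable def movingFT (χ : ℝ → ℝ) (k : ℤ) (f : ℝ → ℝ → ℝ → ℝ) (ξ s : ℝ) : ℂ :=
  truncFT χ (mode k (f s)) (ξ - k * s)

namespace IsSmoothL2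

variable {f : ℝ → ℝ → ℝ → ℝ}

theorem isSmoothPeriodic (hf : IsSmoothL2 f) {s : ℝ} (hs : 0 ≤ s) : IsSmoothPeriodic (f s) :=
  ⟨hf.smooth.comp_contDiff (f := fun p : ℝ × ℝ => (s, p.1, p.2)) (by fun_prop)
    fun p => ⟨hs, mem_univ _⟩, hf.periodic s hs⟩

/-- Freezing negative times at `0` gives a function continuous on the whole space, from which joint
measurability in `(ξ, s)` follows later. -/
theorem continuous_max (hf : IsSmoothL2 f) :
    Continuous fun p : ℝ × ℝ × ℝ => f (max p.1 0) p.2.1 p.2.2 :=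
  hf.smooth.continuousOn.comp_continuous (f := fun p : ℝ × ℝ × ℝ => (max p.1 0, p.2.1, p.2.2))
    (by fun_prop) fun p => ⟨show (0 : ℝ) ≤ max p.1 0 from le_max_right _ _, mem_univ _⟩

theorem hasDerivAt_time (hf : IsSmoothL2 f) {s : ℝ} (hs : 0 < s) (x y : ℝ) :
    HasDerivAt (fun s => f s x y)
      (fderiv ℝ (fun p : ℝ × ℝ × ℝ => f p.1 p.2.1 p.2.2) (s, x, y) (1, 0, 0)) s := by
  have hn : Ici (0 : ℝ) ×ˢ (univ : Set (ℝ × ℝ)) ∈ nhds (s, x, y) :=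
    prod_mem_nhds (Ici_mem_nhds hs) Filter.univ_mem
  have h := ((hf.smooth.contDiffAt hn).differentiableAt (by simp)).hasFDerivAt
  exact h.comp_hasDerivAt s ((hasDerivAt_id s).prodMk (hasDerivAt_const s (x, y)))

theorem continuousOn_time_deriv (hf : IsSmoothL2 f) :
    ContinuousOn (fun p : ℝ × ℝ × ℝ => deriv (fun s => f s p.2.1 p.2.2) p.1)
      (Ioi 0 ×ˢ univ) := by
  have h := ((hf.smooth.mono (prod_mono Ioi_subset_Ici_self le_rfl)).continuousOn_fderiv_of_isOpen
    (isOpen_Ioi.prod isOpen_univ) (by simp)).clm_apply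
      (continuousOn_const (c := ((1 : ℝ), (0 : ℝ), (0 : ℝ))))
  exact h.congr fun p hp => (hf.hasDerivAt_time hp.1 p.2.1 p.2.2).deriv

theorem continuousOn_pos (hf : IsSmoothL2 f) :
    ContinuousOn (fun p : ℝ × ℝ × ℝ => f p.1 p.2.1 p.2.2) (Ioi 0 ×ˢ univ) :=
  hf.smooth.continuousOn.mono (prod_mono Ioi_subset_Ici_self le_rfl)

end IsSmoothL2

theorem mode_eq_of_eqOn {f g : ℝ → ℝ → ℝ} (h : ∀ x y, f x y = g x y) (k : ℤ) :
    mode k f = mode k g := by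
  rw [show f = g from funext₂ h]

/-- The radius depends on `χ` alone, so the truncated transforms become integrals over a fixed
compact interval and may be differentiated in parameters. -/
theorem IsCutoff.exists_intervalIntegral {χ : ℝ → ℝ} (h : IsCutoff χ) :
    ∃ R : ℝ, ∀ (F : ℝ → ℂ) (ζ : ℝ), truncFT χ F ζ =
      ∫ y in (-R)..R, Complex.exp (-(Complex.I * (ζ : ℂ) * (y : ℂ))) * ((χ y : ℂ) * F y) := by
  obtain ⟨R, hR⟩ := h.compact.isBounded.subset_ball 0
  refine ⟨R, fun F ζ => ?_⟩
  rw [intervalIntegral.integral_eq_integral_of_support_subset]; rfl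
  intro y hy
  have : χ y ≠ 0 := fun h0 => hy (by simp [h0])
  have := hR (subset_tsupport χ this)
  rw [mem_ball_zero_iff, Real.norm_eq_abs, abs_lt] at this
  exact ⟨this.1, this.2.le⟩

theorem continuous_mode_max {f : ℝ → ℝ → ℝ → ℝ} (hf : IsSmoothL2 f) (k : ℤ) :
    Continuous fun p : ℝ × ℝ => mode k (f (max p.1 0)) p.2 := by
  have := hf.continuous_max.comp
    (by fun_prop : Continuous fun q : (ℝ × ℝ) × ℝ => (q.1.1, q.2, q.1.2))
  simp only [Function.comp_def] at this
  refine intervalIntegral.continuous_parametric_intervalIntegral_of_continuous'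
    (f := fun (p : ℝ × ℝ) (x : ℝ) => Complex.exp (-(Complex.I * (k : ℂ) * (x : ℂ))) *
      (f (max p.1 0) x p.2 : ℂ)) ?_ _ _
  exact Continuous.mul (by fun_prop) (Complex.continuous_ofReal.comp this)

theorem continuous_truncFT_max {f : ℝ → ℝ → ℝ → ℝ} (hf : IsSmoothL2 f) {χ : ℝ → ℝ}
    (hχ : IsCutoff χ) (k : ℤ) :
    Continuous fun p : ℝ × ℝ => truncFT χ (mode k (f (max p.1 0))) p.2 := by
  obtain ⟨R, hR⟩ := hχ.exists_intervalIntegral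
  simp_rw [hR]
  have h1 := (continuous_mode_max hf k).comp
    (by fun_prop : Continuous fun q : (ℝ × ℝ) × ℝ => (q.1.1, q.2))
  simp only [Function.comp_def] at h1
  have h2 := hχ.smooth.continuous
  refine intervalIntegral.continuous_parametric_intervalIntegral_of_continuous'
    (f := fun (p : ℝ × ℝ) (y : ℝ) => Complex.exp (-(Complex.I * (p.2 : ℂ) * (y : ℂ))) *
      ((χ y : ℂ) * mode k (f (max p.1 0)) y)) ?_ _ _
  simp only [Function.uncurry_def]
  fun_prop

theorem continuousOn_movingFT {f : ℝ → ℝ → ℝ → ℝ} (hf : IsSmoothL2 f) {χ : ℝ → ℝ}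
    (hχ : IsCutoff χ) (k : ℤ) (ξ : ℝ) : ContinuousOn (movingFT χ k f ξ) (Ici 0) := by
  have h := (continuous_truncFT_max hf hχ k).comp
    (by fun_prop : Continuous fun s : ℝ => (s, ξ - k * s))
  refine h.continuousOn.congr fun s hs => ?_
  simp [movingFT, max_eq_left (mem_Ici.1 hs)]

theorem hasDerivAt_mode_time {f : ℝ → ℝ → ℝ → ℝ} (hf : IsSmoothL2 f) (k : ℤ) {s : ℝ} (hs : 0 < s)
    (y : ℝ) : HasDerivAt (fun s => mode k (f s) y)
      (mode k (fun x y => deriv (fun s => f s x y) s) y) s := by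
  refine hasDerivAt_intervalIntegral_of_continuousOn
    (h := fun s x => Complex.exp (-(Complex.I * (k : ℂ) * (x : ℂ))) * (f s x y : ℂ))
    (h' := fun s x => Complex.exp (-(Complex.I * (k : ℂ) * (x : ℂ))) *
      ((deriv (fun s => f s x y) s : ℝ) : ℂ)) hs ?_ ?_ ?_
  · have h := hf.continuousOn_pos.comp
      (by fun_prop : Continuous fun p : ℝ × ℝ => (p.1, p.2, y)).continuousOn
      (s := Ioi 0 ×ˢ univ) fun p hp => ⟨hp.1, mem_univ _⟩
    refine ContinuousOn.mul (Continuous.continuousOn (by fun_prop))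
      (Complex.continuous_ofReal.comp_continuousOn h)
  · have h := hf.continuousOn_time_deriv.comp
      (by fun_prop : Continuous fun p : ℝ × ℝ => (p.1, p.2, y)).continuousOn
      (s := Ioi 0 ×ˢ univ) fun p hp => ⟨hp.1, mem_univ _⟩
    refine ContinuousOn.mul (Continuous.continuousOn (by fun_prop))
      (Complex.continuous_ofReal.comp_continuousOn h)
  · intro s hs x
    refine HasDerivAt.const_mul _ (HasDerivAt.ofReal_comp ?_)
    rw [(hf.hasDerivAt_time hs x y).deriv]
    exact hf.hasDerivAt_time hs x y

theorem continuousOn_mode_time_deriv {f : ℝ → ℝ → ℝ → ℝ} (hf : IsSmoothL2 f) (k : ℤ) :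
    ContinuousOn (fun p : ℝ × ℝ => mode k (fun x y => deriv (fun s => f s x y) p.1) p.2)
      (Ioi 0 ×ˢ univ) := by
  refine continuousOn_intervalIntegral
    (h := fun (p : ℝ × ℝ) x => Complex.exp (-(Complex.I * (k : ℂ) * (x : ℂ))) *
      ((deriv (fun s => f s x p.2) p.1 : ℝ) : ℂ)) ?_ _ _
  have h := hf.continuousOn_time_deriv.comp
      (by fun_prop : Continuous fun q : (ℝ × ℝ) × ℝ => (q.1.1, q.2, q.1.2)).continuousOn
      (s := (Ioi 0 ×ˢ univ) ×ˢ univ) fun p hp => ⟨hp.1.1, mem_univ _⟩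
  exact ContinuousOn.mul (Continuous.continuousOn (by fun_prop))
      (Complex.continuous_ofReal.comp_continuousOn h)

/-- The moving frequency turns the transport operator `∂_t + y ∂_x` into `∂_t`. -/
theorem hasDerivAt_movingFT {f : ℝ → ℝ → ℝ → ℝ} (hf : IsSmoothL2 f) {χ : ℝ → ℝ} (hχ : IsCutoff χ)
    (k : ℤ) (ξ : ℝ) {s : ℝ} (hs : 0 < s) :
    HasDerivAt (movingFT χ k f ξ) (truncFT χ
      (mode k fun x y => deriv (fun s => f s x y) s + y * dx (f s) x y) (ξ - k * s)) s := by
  obtain ⟨R, hR⟩ := hχ.exists_intervalIntegral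
  have hχc := hχ.smooth.continuous
  have hmode : ContinuousOn (fun p : ℝ × ℝ => mode k (f p.1) p.2) (Ioi 0 ×ˢ univ) :=
    (continuous_mode_max hf k).continuousOn.congr fun p hp => by
      show _ = mode k (f (max p.1 0)) p.2
      rw [max_eq_left (le_of_lt hp.1)]
  -- Differentiating the moving exponential produces `i k y`, which is the symbol of `y ∂_x` on the
  -- mode.
  have hderiv : ∀ s, 0 < s → ∀ y : ℝ, HasDerivAt
      (fun s : ℝ => Complex.exp (-(Complex.I * ((ξ - k * s : ℝ) : ℂ) * (y : ℂ))) *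
        ((χ y : ℂ) * mode k (f s) y))
      (Complex.exp (-(Complex.I * ((ξ - k * s : ℝ) : ℂ) * (y : ℂ))) * ((χ y : ℂ) *
        (mode k (fun x y => deriv (fun s => f s x y) s) y + Complex.I * k * y * mode k (f s) y)))
      s := fun s hs y => by
    have h1 : HasDerivAt (fun s : ℝ => Complex.exp (-(Complex.I * ((ξ - k * s : ℝ) : ℂ) * (y : ℂ))))
        (Complex.exp (-(Complex.I * ((ξ - k * s : ℝ) : ℂ) * (y : ℂ))) * (Complex.I * k * y)) s := by
      have h0 : HasDerivAt (fun s : ℝ => ((ξ - k * s : ℝ) : ℂ)) ((-(k : ℝ) : ℝ) : ℂ) s := by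
        refine HasDerivAt.ofReal_comp ?_
        simpa using ((hasDerivAt_id s).const_mul (k : ℝ)).const_sub ξ
      have h2 : HasDerivAt (fun s : ℝ => -(Complex.I * ((ξ - k * s : ℝ) : ℂ) * (y : ℂ)))
          (Complex.I * k * y) s :=
        ((h0.const_mul Complex.I).mul_const (y : ℂ)).neg.congr_deriv (by push_cast; ring)
      exact h2.cexp
    refine (h1.mul ((hasDerivAt_mode_time hf k hs y).const_mul (χ y : ℂ))).congr_deriv ?_
    ring
  have key := hasDerivAt_intervalIntegral_of_continuousOn (a := -R) (b := R) hs ?_ ?_ hderiv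
  · have e1 : movingFT χ k f ξ = fun s => ∫ y in (-R)..R,
        Complex.exp (-(Complex.I * ((ξ - k * s : ℝ) : ℂ) * (y : ℂ))) *
        ((χ y : ℂ) * mode k (f s) y) := funext fun s => hR _ _
    rw [e1, hR]
    refine key.congr_deriv ?_
    congr 1; ext y
    congr 2
    have hfs := hf.isSmoothPeriodic hs.le
    have hct : Continuous fun x => deriv (fun s => f s x y) s := by
      have := hf.continuousOn_time_deriv.comp_continuous
        (by fun_prop : Continuous fun x : ℝ => (s, x, y)) fun x => ⟨hs, mem_univ _⟩
      exact this
    rw [mode_add (f := fun x y => deriv (fun s => f s x y) s)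
      (g := fun x y => y * dx (f s) x y) k y hct (continuous_const.mul (hfs.dx.continuous_left y)),
      mode_id_mul, hfs.mode_dx]
    ring
  · exact ContinuousOn.mul (Continuous.continuousOn (by fun_prop))
      (ContinuousOn.mul (Continuous.continuousOn (by fun_prop)) hmode)
  · exact ContinuousOn.mul (Continuous.continuousOn (by fun_prop))
      (ContinuousOn.mul (Continuous.continuousOn (by fun_prop))
        ((continuousOn_mode_time_deriv hf k).add (ContinuousOn.mul
          (Continuous.continuousOn (by fun_prop)) hmode)))

/-! ### The mode equations -/

theorem truncFT_mode_dx {f : ℝ → ℝ → ℝ} (hf : IsSmoothPeriodic f) (χ : ℝ → ℝ) (k : ℤ) (ζ : ℝ) :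
    truncFT χ (mode k (dx f)) ζ = Complex.I * k * truncFT χ (mode k f) ζ := by
  rw [← truncFT_const_mul, funext (hf.mode_dx k)]

theorem truncFT_mode_dy {f : ℝ → ℝ → ℝ} (hf : IsSmoothPeriodic f) {χ : ℝ → ℝ} (hχ : IsCutoff χ)
    (k : ℤ) (ζ : ℝ) :
    truncFT χ (mode k (dy f)) ζ =
      Complex.I * ζ * truncFT χ (mode k f) ζ - truncFT (deriv χ) (mode k f) ζ :=
  truncFT_deriv hχ (hf.hasDerivAt_mode k) (continuous_mode hf.dy.smooth.continuous k) ζ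

theorem truncFT_mode_add {f g : ℝ → ℝ → ℝ} (hf : IsSmoothPeriodic f) (hg : IsSmoothPeriodic g)
    {χ : ℝ → ℝ} (hχ : IsCutoff χ) (k : ℤ) (ζ : ℝ) :
    truncFT χ (mode k fun x y => f x y + g x y) ζ =
      truncFT χ (mode k f) ζ + truncFT χ (mode k g) ζ := by
  rw [← truncFT_add hχ (continuous_mode hf.smooth.continuous k)
    (continuous_mode hg.smooth.continuous k)]
  congr 1
  exact funext fun y => mode_add k y (hf.continuous_left y) (hg.continuous_left y)

theorem truncFT_mode_const_mul (f : ℝ → ℝ → ℝ) (χ : ℝ → ℝ) (k : ℤ) (c ζ : ℝ) :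
    truncFT χ (mode k fun x y => c * f x y) ζ = c * truncFT χ (mode k f) ζ := by
  rw [← truncFT_const_mul]
  congr 1
  exact funext fun y => mode_const_mul f k c y

namespace IsSmoothSolution

variable {m e : ℝ} {η u₁ u₂ φ : ℝ → ℝ → ℝ → ℝ} {χ : ℝ → ℝ}

theorem hasDerivAt_movingFT_density (hS : IsSmoothSolution m e η u₁ u₂ φ) (hχ : IsCutoff χ) (k : ℤ)
    (ξ : ℝ) {s : ℝ} (hs : 0 < s) :
    HasDerivAt (movingFT χ k η ξ) (-(Complex.I * k * movingFT χ k u₁ ξ s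
      + Complex.I * (ξ - k * s : ℝ) * movingFT χ k u₂ ξ s - movingFT (deriv χ) k u₂ ξ s)) s := by
  refine (hasDerivAt_movingFT hS.density hχ k ξ hs).congr_deriv ?_
  have h1 := hS.velocity_x.isSmoothPeriodic hs.le
  have h2 := hS.velocity_y.isSmoothPeriodic hs.le
  rw [mode_eq_of_eqOn (g := fun x y => -1 * (dx (u₁ s) x y + dy (u₂ s) x y)) (fun x y => by
    have := hS.continuity s hs x y
    rw [divergence] at this
    linear_combination this), truncFT_mode_const_mul, truncFT_mode_add h1.dx h2.dy hχ,
    truncFT_mode_dx h1, truncFT_mode_dy h2 hχ]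
  simp only [movingFT]
  push_cast; ring

theorem hasDerivAt_movingFT_velocity_x (hS : IsSmoothSolution m e η u₁ u₂ φ) (hχ : IsCutoff χ)
    (k : ℤ) (ξ : ℝ) {s : ℝ} (hs : 0 < s) :
    HasDerivAt (movingFT χ k u₁ ξ) (-movingFT χ k u₂ ξ s
      - (1 / m : ℝ) * (Complex.I * k * movingFT χ k η ξ s)
      + (e / m : ℝ) * (Complex.I * k * movingFT χ k φ ξ s)) s := by
  refine (hasDerivAt_movingFT hS.velocity_x hχ k ξ hs).congr_deriv ?_
  have h1 := hS.density.isSmoothPeriodic hs.le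
  have h2 := hS.velocity_y.isSmoothPeriodic hs.le
  have h3 := hS.potential.isSmoothPeriodic hs.le
  rw [mode_eq_of_eqOn (g := fun x y => (-1 * u₂ s x y + (-(1 / m)) * dx (η s) x y)
    + e / m * dx (φ s) x y) (fun x y => by
      linear_combination hS.momentum_x s hs x y),
    truncFT_mode_add ((h2.const_mul (-1)).add (h1.dx.const_mul _)) (h3.dx.const_mul _) hχ,
    truncFT_mode_add (h2.const_mul (-1)) (h1.dx.const_mul _) hχ,
    truncFT_mode_const_mul, truncFT_mode_const_mul, truncFT_mode_const_mul,
    truncFT_mode_dx h1, truncFT_mode_dx h3]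
  simp only [movingFT]
  push_cast; ring

theorem hasDerivAt_movingFT_velocity_y (hS : IsSmoothSolution m e η u₁ u₂ φ) (hχ : IsCutoff χ)
    (k : ℤ) (ξ : ℝ) {s : ℝ} (hs : 0 < s) :
    HasDerivAt (movingFT χ k u₂ ξ)
      (-(1 / m : ℝ) * (Complex.I * (ξ - k * s : ℝ) * movingFT χ k η ξ s
          - movingFT (deriv χ) k η ξ s)
      + (e / m : ℝ) * (Complex.I * (ξ - k * s : ℝ) * movingFT χ k φ ξ s
          - movingFT (deriv χ) k φ ξ s)) s := by
  refine (hasDerivAt_movingFT hS.velocity_y hχ k ξ hs).congr_deriv ?_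
  have h1 := hS.density.isSmoothPeriodic hs.le
  have h3 := hS.potential.isSmoothPeriodic hs.le
  rw [mode_eq_of_eqOn (g := fun x y => (-(1 / m)) * dy (η s) x y + e / m * dy (φ s) x y)
      (fun x y => by linear_combination hS.momentum_y s hs x y),
    truncFT_mode_add (h1.dy.const_mul _) (h3.dy.const_mul _) hχ,
    truncFT_mode_const_mul, truncFT_mode_const_mul,
    truncFT_mode_dy h1 hχ, truncFT_mode_dy h3 hχ]
  simp only [movingFT]
  push_cast; ring

/-- Two `y`-derivatives fall on `φ`, hence one commutator with `χ'` counted twice and one with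
`χ''`. -/
theorem alpha_mul_movingFT_potential (hS : IsSmoothSolution m e η u₁ u₂ φ) (hχ : IsCutoff χ)
    (k : ℤ) (ξ : ℝ) {s : ℝ} (hs : 0 ≤ s) :
    (alpha k ξ s : ℂ) * movingFT χ k φ ξ s = -(4 * Real.pi * e : ℝ) * movingFT χ k η ξ s
      - 2 * (Complex.I * (ξ - k * s : ℝ) * movingFT (deriv χ) k φ ξ s)
      + movingFT (deriv (deriv χ)) k φ ξ s := by
  have h3 := hS.potential.isSmoothPeriodic hs
  have h := congrArg (fun f => truncFT χ (mode k f) (ξ - k * s))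
    (funext₂ (hS.poisson s hs) : (fun x y => dx (dx (φ s)) x y + dy (dy (φ s)) x y) =
      fun x y => 4 * Real.pi * e * η s x y)
  rw [truncFT_mode_add h3.dx.dx h3.dy.dy hχ, truncFT_mode_const_mul, truncFT_mode_dx h3.dx,
    truncFT_mode_dx h3, truncFT_mode_dy h3.dy hχ, truncFT_mode_dy h3 hχ,
    truncFT_mode_dy h3 hχ.deriv] at h
  simp only [movingFT, alpha_def]
  push_cast at h ⊢
  linear_combination -h + ((k : ℂ) ^ 2 + (ξ - k * s) ^ 2) * truncFT χ (mode k (φ s)) (ξ - k * s)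
    * Complex.I_sq

end IsSmoothSolution

/-! ### The fundamental matrix and Duhamel's formula -/

/-- In terms of a fourth root `q` of `α`, all fractional powers in `L` become integer powers,
accessible to field arithmetic. -/
theorem coeffL_entries (m e : ℝ) (k : ℤ) (ξ s : ℝ) {q r : ℝ} (hq : 0 < q)
    (hqα : q ^ 4 = alpha k ξ s) (hr : r = Real.sqrt m) :
    coeffL m e k ξ s 0 0 = -(1 / 4) * (alphaDot k ξ s / q ^ 4) ∧
    coeffL m e k ξ s 0 1 = -(q ^ 2 / r) ∧
    coeffL m e k ξ s 1 0 = 4 * Real.pi * e ^ 2 / (r * q ^ 2) + 2 * (k : ℝ) ^ 2 * r / q ^ 6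
      + q ^ 2 / r ∧
    coeffL m e k ξ s 1 1 = 1 / 4 * (alphaDot k ξ s / q ^ 4) := by
  have h2 : alpha k ξ s ^ (1 / 2 : ℝ) = q ^ 2 := by
    rw [← hqα, ← Real.rpow_natCast, ← Real.rpow_mul hq.le, ← Real.rpow_natCast]; norm_num
  have h6 : alpha k ξ s ^ (3 / 2 : ℝ) = q ^ 6 := by
    rw [← hqα, ← Real.rpow_natCast, ← Real.rpow_mul hq.le, ← Real.rpow_natCast]; norm_num
  have hs : Real.sqrt (1 / m) = 1 / r := by rw [hr, Real.sqrt_div zero_le_one, Real.sqrt_one]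
  refine ⟨?_, ?_, ?_, ?_⟩
  · rw [hqα]; rfl
  · show -(Real.sqrt (1 / m) * alpha k ξ s ^ (1 / 2 : ℝ)) = _
    rw [h2, hs]; ring
  · show 4 * Real.pi * e ^ 2 / (Real.sqrt m * alpha k ξ s ^ (1 / 2 : ℝ))
        + 2 * (k : ℝ) ^ 2 * Real.sqrt m / alpha k ξ s ^ (3 / 2 : ℝ)
        + Real.sqrt (1 / m) * alpha k ξ s ^ (1 / 2 : ℝ) = _
    rw [h2, h6, hs, hr]; ring
  · rw [hqα]; rfl

/-- The fundamental matrix of the mode system. -/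
noncomputable abbrev fundM (m e : ℝ) (k : ℤ) (ξ s : ℝ) : Matrix (Fin 2) (Fin 2) ℝ :=
  fundamentalMatrix (coeffL m e k ξ) s

/-- The scalar `2k²/α^{7/4}`. -/
noncomputable def forcing (k : ℤ) (ξ s : ℝ) : ℝ := 2 * (k : ℝ) ^ 2 / alpha k ξ s ^ (7 / 4 : ℝ)

section

variable {m e : ℝ} {k : ℤ} {ξ : ℝ}

theorem isFundamentalMatrix_fundM (hm : 0 < m) (hk : k ≠ 0) :
    IsFundamentalMatrix (coeffL m e k ξ) (fundM m e k ξ) :=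
  isFundamentalMatrix_fundamentalMatrix (continuous_coeffL m e hk ξ hm)

theorem continuous_fundM (hm : 0 < m) (hk : k ≠ 0) (i j : Fin 2) :
    Continuous fun s => fundM m e k ξ s i j :=
  continuous_iff_continuousAt.2 fun s =>
    ((isFundamentalMatrix_fundM hm hk).2 s i j).continuousAt

theorem det_fundM (hm : 0 < m) (hk : k ≠ 0) (s : ℝ) :
    fundM m e k ξ s 0 0 * fundM m e k ξ s 1 1 - fundM m e k ξ s 0 1 * fundM m e k ξ s 1 0 = 1 := by
  rw [← Matrix.det_fin_two]
  exact (isFundamentalMatrix_fundM hm hk).det_eq_one (trace_coeffL m e k ξ) s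

theorem continuous_forcing (hk : k ≠ 0) : Continuous (forcing k ξ) :=
  continuous_const.div ((continuous_alpha k ξ).rpow_const fun s => Or.inl (alpha_pos hk ξ s).ne')
    fun s => (Real.rpow_pos_of_pos (alpha_pos hk ξ s) _).ne'

theorem forcing_nonneg (hk : k ≠ 0) (s : ℝ) : 0 ≤ forcing k ξ s := by
  have := alpha_pos hk ξ s
  unfold forcing; positivity

/-- Since `α ≥ 1`, the exponent `7/4` may be lowered to `1`, which bounds the forcing by the
integrable weight. -/
theorem forcing_le (hk : k ≠ 0) (s : ℝ) : forcing k ξ s ≤ 2 * ((k : ℝ) ^ 2 / alpha k ξ s) := by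
  have := alpha_pos hk ξ s
  rw [forcing, ← mul_div_assoc]
  gcongr
  calc alpha k ξ s = alpha k ξ s ^ (1 : ℝ) := (Real.rpow_one _).symm
    _ ≤ _ := Real.rpow_le_rpow_of_exponent_le (one_le_alpha hk ξ s) (by norm_num)

/-- The components of `∫_0^t S_L(0, s) M(s) ds`. -/
noncomputable def duhamelInt (m e : ℝ) (k : ℤ) (ξ t : ℝ) : Fin 2 → ℝ :=
  ![∫ s in (0 : ℝ)..t, fundM m e k ξ s 0 1 * forcing k ξ s,
    ∫ s in (0 : ℝ)..t, -(fundM m e k ξ s 0 0 * forcing k ξ s)]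

theorem hasDerivAt_duhamelInt_zero (hm : 0 < m) (hk : k ≠ 0) (t : ℝ) :
    HasDerivAt (fun t => duhamelInt m e k ξ t 0) (fundM m e k ξ t 0 1 * forcing k ξ t) t := by
  have h := (continuous_fundM (e := e) (ξ := ξ) hm hk 0 1).mul (continuous_forcing (ξ := ξ) hk)
  exact h.integral_hasStrictDerivAt 0 t |>.hasDerivAt

theorem hasDerivAt_duhamelInt_one (hm : 0 < m) (hk : k ≠ 0) (t : ℝ) :
    HasDerivAt (fun t => duhamelInt m e k ξ t 1) (-(fundM m e k ξ t 0 0 * forcing k ξ t)) t := by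
  have h := ((continuous_fundM (e := e) (ξ := ξ) hm hk 0 0).mul
    (continuous_forcing (ξ := ξ) hk)).neg
  exact h.integral_hasStrictDerivAt 0 t |>.hasDerivAt

theorem duhamelInt_zero (i : Fin 2) : duhamelInt m e k ξ 0 i = 0 := by
  fin_cases i <;> simp [duhamelInt]

/-- `Φ(0) = 1` and `Φ(s)⁻¹` is the adjugate because the determinant is one. -/
theorem solOp_mulVec (hm : 0 < m) (hk : k ≠ 0) (s : ℝ) :
    (solOp m e k ξ 0 s).mulVec (forcingM k ξ s) =
      ![fundM m e k ξ s 0 1 * forcing k ξ s, -(fundM m e k ξ s 0 0 * forcing k ξ s)] := by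
  have h1 : fundM m e k ξ 0 = 1 := (isFundamentalMatrix_fundM hm hk).1
  have hdet : (fundM m e k ξ s).det = 1 :=
    (isFundamentalMatrix_fundM hm hk).det_eq_one (trace_coeffL m e k ξ) s
  have h2 : (fundM m e k ξ s)⁻¹ = (fundM m e k ξ s).adjugate := by
    rw [Matrix.inv_def, hdet]; simp
  have h3 : solOp m e k ξ 0 s = fundM m e k ξ 0 * (fundM m e k ξ s)⁻¹ := rfl
  rw [h3, h1, h2, one_mul, Matrix.adjugate_fin_two]
  ext i
  fin_cases i <;> simp [forcingM, forcing, Matrix.mulVec, dotProduct]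

/-- Every combination of the columns of `Φ` solves the system, so the energy estimate applies to it.
-/
theorem sq_fundM_le (hm : 0 < m) (hk : k ≠ 0) (v : Fin 2 → ℝ) (s t : ℝ) :
    (fundM m e k ξ t 0 0 * v 0 + fundM m e k ξ t 0 1 * v 1) ^ 2
      + (fundM m e k ξ t 1 0 * v 0 + fundM m e k ξ t 1 1 * v 1) ^ 2 ≤ growthConst m e *
    ((fundM m e k ξ s 0 0 * v 0 + fundM m e k ξ s 0 1 * v 1) ^ 2
      + (fundM m e k ξ s 1 0 * v 0 + fundM m e k ξ s 1 1 * v 1) ^ 2) := by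
  have h := (isFundamentalMatrix_fundM (e := e) (ξ := ξ) hm hk).2
  refine sq_add_sq_le_of_ode hm hk
    (A := fun t => fundM m e k ξ t 0 0 * v 0 + fundM m e k ξ t 0 1 * v 1)
    (B := fun t => fundM m e k ξ t 1 0 * v 0 + fundM m e k ξ t 1 1 * v 1) (ξ := ξ)
    (fun t => ?_) (fun t => ?_) t s
  · refine (((h t 0 0).mul_const (v 0)).add ((h t 0 1).mul_const (v 1))).congr_deriv ?_
    simp only [Matrix.mul_apply, Fin.sum_univ_two]; ring
  · refine (((h t 1 0).mul_const (v 0)).add ((h t 1 1).mul_const (v 1))).congr_deriv ?_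
    simp only [Matrix.mul_apply, Fin.sum_univ_two]; ring

theorem fundM_zero (hm : 0 < m) (hk : k ≠ 0) : fundM m e k ξ 0 = 1 :=
  (isFundamentalMatrix_fundM hm hk).1

theorem abs_fundM_le (hm : 0 < m) (hk : k ≠ 0) (i : Fin 2) (s : ℝ) :
    |fundM m e k ξ s 0 i| ≤ Real.sqrt (growthConst m e) := by
  refine Real.abs_le_sqrt ?_
  have h := sq_fundM_le (e := e) (ξ := ξ) hm hk (Pi.single i 1) 0 s
  rw [fundM_zero hm hk] at h
  fin_cases i <;> simp at h <;> simp <;> nlinarith [sq_nonneg (fundM m e k ξ s 1 0),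
    sq_nonneg (fundM m e k ξ s 1 1)]

theorem integral_alpha_le (hk : k ≠ 0) (t : ℝ) :
    ∫ s in (0 : ℝ)..t, (k : ℝ) ^ 2 / alpha k ξ s ≤ Real.pi := by
  have hc : Continuous fun s => (k : ℝ) ^ 2 / alpha k ξ s :=
    continuous_const.div (continuous_alpha k ξ) fun s => (alpha_pos hk ξ s).ne'
  rw [intervalIntegral.integral_eq_sub_of_hasDerivAt
    (fun s _ => hasDerivAt_arctan_sub hk ξ s) (hc.intervalIntegrable _ _)]
  have := Real.arctan_lt_pi_div_two (t - ξ / k)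
  have := Real.neg_pi_div_two_lt_arctan (0 - ξ / k)
  linarith

/-- The entries of `Φ` are at most `√C`, with `C` the growth constant, and the forcing is at most
`2k²/α`, whose integral is at most `2π`. -/
theorem abs_duhamelInt_le (hm : 0 < m) (hk : k ≠ 0) {t : ℝ} (ht : 0 ≤ t) (i : Fin 2) :
    |duhamelInt m e k ξ t i| ≤ 2 * Real.pi * Real.sqrt (growthConst m e) := by
  have hc : Continuous fun s => (k : ℝ) ^ 2 / alpha k ξ s :=
    continuous_const.div (continuous_alpha k ξ) fun s => (alpha_pos hk ξ s).ne'
  have key : ∀ j : Fin 2, ∀ s, |fundM m e k ξ s 0 j * forcing k ξ s| ≤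
      2 * Real.sqrt (growthConst m e) * ((k : ℝ) ^ 2 / alpha k ξ s) := fun j s => by
    rw [abs_mul, abs_of_nonneg (forcing_nonneg hk s)]
    calc _ ≤ Real.sqrt (growthConst m e) * (2 * ((k : ℝ) ^ 2 / alpha k ξ s)) :=
          mul_le_mul (abs_fundM_le hm hk j s) (forcing_le hk s) (forcing_nonneg hk s)
            (Real.sqrt_nonneg _)
      _ = _ := by ring
  have fin : ∫ s in (0 : ℝ)..t, 2 * Real.sqrt (growthConst m e) * ((k : ℝ) ^ 2 / alpha k ξ s)
      ≤ 2 * Real.pi * Real.sqrt (growthConst m e) := by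
    rw [intervalIntegral.integral_const_mul]
    calc _ ≤ 2 * Real.sqrt (growthConst m e) * Real.pi := by
          gcongr; exact integral_alpha_le hk t
      _ = _ := by ring
  refine le_trans ?_ fin
  have hi : IntervalIntegrable (fun s => 2 * Real.sqrt (growthConst m e) *
      ((k : ℝ) ^ 2 / alpha k ξ s)) volume 0 t := (continuous_const.mul hc).intervalIntegrable _ _
  fin_cases i
  · exact intervalIntegral.norm_integral_le_of_norm_le (f := fun s =>
      fundM m e k ξ s 0 1 * forcing k ξ s) ht (Filter.Eventually.of_forall fun s _ => key 1 s) hi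
  · refine intervalIntegral.norm_integral_le_of_norm_le (f := fun s =>
      -(fundM m e k ξ s 0 0 * forcing k ξ s)) ht (Filter.Eventually.of_forall fun s _ => ?_) hi
    rw [norm_neg]
    exact key 0 s

/-! ### The weighted unknowns and their pull-back by the flow. -/

/-- The fourth root of `α`. -/
noncomputable def alphaRoot (k : ℤ) (ξ s : ℝ) : ℝ := alpha k ξ s ^ (1 / 4 : ℝ)

theorem alphaRoot_pos (hk : k ≠ 0) (s : ℝ) : 0 < alphaRoot k ξ s :=
  Real.rpow_pos_of_pos (alpha_pos hk ξ s) _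

theorem alphaRoot_pow_four (hk : k ≠ 0) (s : ℝ) : alphaRoot k ξ s ^ 4 = alpha k ξ s := by
  rw [alphaRoot, ← Real.rpow_natCast, ← Real.rpow_mul (alpha_pos hk ξ s).le]; norm_num

theorem hasDerivAt_alphaRoot (hk : k ≠ 0) (s : ℝ) :
    HasDerivAt (alphaRoot k ξ) (alphaDot k ξ s / (4 * alphaRoot k ξ s ^ 3)) s := by
  refine ((hasDerivAt_alpha k ξ s).rpow_const (p := 1 / 4)
    (Or.inl (alpha_pos hk ξ s).ne')).congr_deriv ?_
  have hα := alpha_pos hk ξ s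
  have h3 : alpha k ξ s ^ (1 / 4 - 1 : ℝ) = (alphaRoot k ξ s ^ 3)⁻¹ := by
    rw [alphaRoot, ← Real.rpow_natCast, ← Real.rpow_mul hα.le, ← Real.rpow_neg hα.le]; norm_num
  rw [h3]
  field_simp

theorem continuous_alphaRoot (hk : k ≠ 0) : Continuous (alphaRoot k ξ) :=
  continuous_iff_continuousAt.2 fun s => (hasDerivAt_alphaRoot hk s).continuousAt

theorem forcing_eq (hk : k ≠ 0) (s : ℝ) : forcing k ξ s = 2 * (k : ℝ) ^ 2 / alphaRoot k ξ s ^ 7 := by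
  rw [forcing, alphaRoot, ← Real.rpow_natCast (_ ^ _) 7, ← Real.rpow_mul (alpha_pos hk ξ s).le]
  norm_num

/-- The divergence of a mode in Fourier variables. -/
noncomputable def divSymbol (k : ℤ) (ζ : ℝ) (v₁ v₂ : ℂ) : ℂ := Complex.I * k * v₁ + Complex.I * ζ * v₂

/-- The vorticity of a mode in Fourier variables. -/
noncomputable def vortSymbol (k : ℤ) (ζ : ℝ) (v₁ v₂ : ℂ) : ℂ :=
  -(Complex.I * ζ * v₁) + Complex.I * k * v₂

/-- The coefficients of `Φ(s)⁻¹ X - (∫_0^s Φ⁻¹ M) F`, where `X` and `F` are the weighted unknown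
and the conserved quantity built from the density `n` and the velocity `(v₁, v₂)` of a mode. -/
noncomputable def pullback (m e : ℝ) (k : ℤ) (ξ s : ℝ) (n v₁ v₂ : ℂ) : Fin 2 → ℂ :=
  ![(fundM m e k ξ s 1 1 : ℂ) * (n / (Real.sqrt m * alphaRoot k ξ s : ℝ))
      - (fundM m e k ξ s 0 1 : ℂ) * (divSymbol k (ξ - k * s) v₁ v₂ / (alphaRoot k ξ s ^ 3 : ℝ))
      - (duhamelInt m e k ξ s 0 : ℂ) * (n + vortSymbol k (ξ - k * s) v₁ v₂),
    -(fundM m e k ξ s 1 0 : ℂ) * (n / (Real.sqrt m * alphaRoot k ξ s : ℝ))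
      + (fundM m e k ξ s 0 0 : ℂ) * (divSymbol k (ξ - k * s) v₁ v₂ / (alphaRoot k ξ s ^ 3 : ℝ))
      - (duhamelInt m e k ξ s 1 : ℂ) * (n + vortSymbol k (ξ - k * s) v₁ v₂)]

end

namespace IsSmoothSolution

variable {m e : ℝ} {η u₁ u₂ φ : ℝ → ℝ → ℝ → ℝ} {χ : ℝ → ℝ} {k : ℤ}

/-- The commutator error in the equation of the divergence. -/
noncomputable def divError (m e ζ : ℝ) (n p pp : ℂ) : ℂ :=
  (e / m : ℝ) * (2 * (Complex.I * ζ * p) - pp) + Complex.I * ζ * ((1 / m : ℝ) * n - (e / m : ℝ) * p)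

/-- The commutator error in the equation of `F`. -/
noncomputable def conservedError (m e : ℝ) (k : ℤ) (u n p : ℂ) : ℂ :=
  u + Complex.I * k * ((1 / m : ℝ) * n - (e / m : ℝ) * p)

/-- The shear contributes `-2ik û^y` to the divergence equation, and `û^y` is recovered from
divergence and vorticity. The Poisson equation replaces `α φ̂` by the density plus commutators. -/
theorem hasDerivAt_divSymbol (hS : IsSmoothSolution m e η u₁ u₂ φ) (hχ : IsCutoff χ)
    (hk : k ≠ 0) (hm : 0 < m) (ξ : ℝ) {s : ℝ} (hs : 0 < s) :
    HasDerivAt (fun s => divSymbol k (ξ - k * s) (movingFT χ k u₁ ξ s) (movingFT χ k u₂ ξ s))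
      (((alphaDot k ξ s / alpha k ξ s : ℝ) : ℂ) *
          divSymbol k (ξ - k * s) (movingFT χ k u₁ ξ s) (movingFT χ k u₂ ξ s)
        - ((2 * (k : ℝ) ^ 2 / alpha k ξ s : ℝ) : ℂ) *
          vortSymbol k (ξ - k * s) (movingFT χ k u₁ ξ s) (movingFT χ k u₂ ξ s)
        + ((alpha k ξ s / m + 4 * Real.pi * e ^ 2 / m : ℝ) : ℂ) * movingFT χ k η ξ s
        + divError m e (ξ - k * s) (movingFT (deriv χ) k η ξ s) (movingFT (deriv χ) k φ ξ s)
          (movingFT (deriv (deriv χ)) k φ ξ s)) s := by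
  have h1 := hS.hasDerivAt_movingFT_velocity_x hχ k ξ hs
  have h2 := hS.hasDerivAt_movingFT_velocity_y hχ k ξ hs
  have h3 := hS.alpha_mul_movingFT_potential hχ k ξ hs.le
  have h0 : HasDerivAt (fun s : ℝ => ((ξ - k * s : ℝ) : ℂ)) ((-(k : ℝ) : ℝ) : ℂ) s := by
    refine HasDerivAt.ofReal_comp ?_
    simpa using ((hasDerivAt_id s).const_mul (k : ℝ)).const_sub ξ
  have hα : (alpha k ξ s : ℂ) ≠ 0 := by exact_mod_cast (alpha_pos hk ξ s).ne'
  have hm' : (m : ℂ) ≠ 0 := by exact_mod_cast hm.ne'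
  refine ((h1.const_mul (Complex.I * k)).add ((h0.const_mul Complex.I).mul h2)).congr_deriv ?_
  have hαe : (alpha k ξ s : ℂ) = (k : ℂ) ^ 2 + (ξ - k * s) ^ 2 := by
    rw [alpha_def]; push_cast; ring
  simp only [divSymbol, vortSymbol, divError, alphaDot]
  generalize movingFT χ k u₁ ξ s = v₁ at *
  generalize movingFT χ k u₂ ξ s = v₂ at *
  generalize movingFT χ k η ξ s = n at *
  generalize movingFT χ k φ ξ s = p at *
  generalize movingFT (deriv χ) k φ ξ s = pd at *
  generalize movingFT (deriv χ) k η ξ s = nd at *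
  generalize movingFT (deriv (deriv χ)) k φ ξ s = pdd at *
  push_cast at h3 ⊢
  -- Helmholtz decomposition of the `y`-velocity, multiplied by `-2ik`.
  have hdiv : -2 * (k : ℂ) * (ξ - k * s) / alpha k ξ s *
        (Complex.I * k * v₁ + Complex.I * (ξ - k * s) * v₂)
      - 2 * (k : ℂ) ^ 2 / alpha k ξ s * (-(Complex.I * (ξ - k * s) * v₁) + Complex.I * k * v₂)
      = -2 * Complex.I * k * v₂ := by
    rw [hαe] at hα ⊢
    field_simp
    ring
  rw [hαe] at h3
  linear_combination -(e / m : ℂ) * h3 - hdiv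
    + ((k : ℂ) ^ 2 + (ξ - k * s) ^ 2) * (e * p / m - n / m) * Complex.I_sq - n / m * hαe

/-- The shear makes the divergence a source of the vorticity, and it enters the density equation
with the opposite sign. The pressure and electric gradients have no curl, so only commutators
remain. -/
theorem hasDerivAt_conserved (hS : IsSmoothSolution m e η u₁ u₂ φ) (hχ : IsCutoff χ)
    (ξ : ℝ) {s : ℝ} (hs : 0 < s) :
    HasDerivAt (fun s => movingFT χ k η ξ s +
        vortSymbol k (ξ - k * s) (movingFT χ k u₁ ξ s) (movingFT χ k u₂ ξ s))
      (conservedError m e k (movingFT (deriv χ) k u₂ ξ s) (movingFT (deriv χ) k η ξ s)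
        (movingFT (deriv χ) k φ ξ s)) s := by
  have h1 := hS.hasDerivAt_movingFT_velocity_x hχ k ξ hs
  have h2 := hS.hasDerivAt_movingFT_velocity_y hχ k ξ hs
  have h0 : HasDerivAt (fun s : ℝ => ((ξ - k * s : ℝ) : ℂ)) ((-(k : ℝ) : ℝ) : ℂ) s := by
    refine HasDerivAt.ofReal_comp ?_
    simpa using ((hasDerivAt_id s).const_mul (k : ℝ)).const_sub ξ
  refine ((hS.hasDerivAt_movingFT_density hχ k ξ hs).add
    (((h0.const_mul Complex.I).mul h1).neg.add (h2.const_mul (Complex.I * k)))).congr_deriv ?_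
  simp only [conservedError]
  push_cast
  ring

theorem hasDerivAt_weighted_density (hS : IsSmoothSolution m e η u₁ u₂ φ) (hχ : IsCutoff χ)
    (hk : k ≠ 0) (hm : 0 < m) (ξ : ℝ) {s : ℝ} (hs : 0 < s) :
    HasDerivAt (fun s => movingFT χ k η ξ s / (Real.sqrt m * alphaRoot k ξ s : ℝ))
      ((coeffL m e k ξ s 0 0 : ℂ) * (movingFT χ k η ξ s / (Real.sqrt m * alphaRoot k ξ s : ℝ))
        + (coeffL m e k ξ s 0 1 : ℂ) * (divSymbol k (ξ - k * s) (movingFT χ k u₁ ξ s)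
          (movingFT χ k u₂ ξ s) / (alphaRoot k ξ s ^ 3 : ℝ))
        + movingFT (deriv χ) k u₂ ξ s / (Real.sqrt m * alphaRoot k ξ s : ℝ)) s := by
  have hq := alphaRoot_pos (ξ := ξ) hk s
  have hr := Real.sqrt_pos.2 hm
  have hd := ((hasDerivAt_alphaRoot (ξ := ξ) hk s).const_mul (Real.sqrt m)).ofReal_comp
  have hne : ((Real.sqrt m * alphaRoot k ξ s : ℝ) : ℂ) ≠ 0 := by
    exact_mod_cast (mul_pos hr hq).ne'
  refine ((hS.hasDerivAt_movingFT_density hχ k ξ hs).div hd hne).congr_deriv ?_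
  obtain ⟨e1, e2, -, -⟩ := coeffL_entries m e k ξ s hq (alphaRoot_pow_four hk s) rfl
  have hq' : (alphaRoot k ξ s : ℂ) ≠ 0 := by exact_mod_cast hq.ne'
  have hr' : (Real.sqrt m : ℂ) ≠ 0 := by exact_mod_cast hr.ne'
  rw [e1, e2, divSymbol]
  push_cast
  field_simp
  ring

/-- Writing `ω = F - η` splits `-2k² ω/α` into the forcing and the entry `2k²√m/α^{3/2}` of `L`. The
weight `α^{-3/4}` lowers the diagonal coefficient `α̇/α` to `α̇/(4α)`, which makes `L` trace free.
-/
theorem hasDerivAt_weighted_divergence (hS : IsSmoothSolution m e η u₁ u₂ φ) (hχ : IsCutoff χ)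
    (hk : k ≠ 0) (hm : 0 < m) (ξ : ℝ) {s : ℝ} (hs : 0 < s) :
    HasDerivAt (fun s => divSymbol k (ξ - k * s) (movingFT χ k u₁ ξ s) (movingFT χ k u₂ ξ s)
        / (alphaRoot k ξ s ^ 3 : ℝ))
      ((coeffL m e k ξ s 1 0 : ℂ) * (movingFT χ k η ξ s / (Real.sqrt m * alphaRoot k ξ s : ℝ))
        + (coeffL m e k ξ s 1 1 : ℂ) * (divSymbol k (ξ - k * s) (movingFT χ k u₁ ξ s)
          (movingFT χ k u₂ ξ s) / (alphaRoot k ξ s ^ 3 : ℝ))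
        - (forcing k ξ s : ℂ) * (movingFT χ k η ξ s +
          vortSymbol k (ξ - k * s) (movingFT χ k u₁ ξ s) (movingFT χ k u₂ ξ s))
        + divError m e (ξ - k * s) (movingFT (deriv χ) k η ξ s) (movingFT (deriv χ) k φ ξ s)
          (movingFT (deriv (deriv χ)) k φ ξ s) / (alphaRoot k ξ s ^ 3 : ℝ)) s := by
  have hq := alphaRoot_pos (ξ := ξ) hk s
  have hr := Real.sqrt_pos.2 hm
  have hd := ((hasDerivAt_alphaRoot (ξ := ξ) hk s).pow 3).ofReal_comp
  have hne : ((alphaRoot k ξ s ^ 3 : ℝ) : ℂ) ≠ 0 := by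
    exact_mod_cast (pow_pos hq 3).ne'
  refine ((hS.hasDerivAt_divSymbol hχ hk hm ξ hs).div hd hne).congr_deriv ?_
  obtain ⟨-, -, e1, e2⟩ := coeffL_entries m e k ξ s hq (alphaRoot_pow_four hk s) rfl
  have hq' : (alphaRoot k ξ s : ℂ) ≠ 0 := by exact_mod_cast hq.ne'
  have hr' : (Real.sqrt m : ℂ) ≠ 0 := by exact_mod_cast hr.ne'
  have hrr : (m : ℂ) = (Real.sqrt m : ℂ) ^ 2 := by exact_mod_cast (Real.sq_sqrt hm.le).symm
  have hα4 := alphaRoot_pow_four (ξ := ξ) hk s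
  rw [e1, e2, forcing_eq hk]
  generalize divSymbol k _ _ _ = ψ
  generalize vortSymbol k _ _ _ = w
  generalize divError _ _ _ _ _ _ = er
  generalize movingFT χ k η ξ s = n
  simp only [Pi.pow_apply]
  rw [← hα4]
  push_cast
  rw [hrr]
  generalize (Real.sqrt m : ℂ) = r at *
  generalize (alphaRoot k ξ s : ℂ) = q at *
  field_simp
  ring

/-- The pulled back unknown is constant up to commutator errors. -/
theorem hasDerivAt_pullback (hS : IsSmoothSolution m e η u₁ u₂ φ) (hχ : IsCutoff χ)
    (hk : k ≠ 0) (hm : 0 < m) (ξ : ℝ) {s : ℝ} (hs : 0 < s) :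
    HasDerivAt (fun s => pullback m e k ξ s (movingFT χ k η ξ s) (movingFT χ k u₁ ξ s)
        (movingFT χ k u₂ ξ s) 0)
      ((fundM m e k ξ s 1 1 : ℂ) *
          (movingFT (deriv χ) k u₂ ξ s / (Real.sqrt m * alphaRoot k ξ s : ℝ))
        - (fundM m e k ξ s 0 1 : ℂ) * (divError m e (ξ - k * s) (movingFT (deriv χ) k η ξ s)
          (movingFT (deriv χ) k φ ξ s) (movingFT (deriv (deriv χ)) k φ ξ s)
            / (alphaRoot k ξ s ^ 3 : ℝ))
        - (duhamelInt m e k ξ s 0 : ℂ) * conservedError m e k (movingFT (deriv χ) k u₂ ξ s)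
          (movingFT (deriv χ) k η ξ s) (movingFT (deriv χ) k φ ξ s)) s ∧
    HasDerivAt (fun s => pullback m e k ξ s (movingFT χ k η ξ s) (movingFT χ k u₁ ξ s)
        (movingFT χ k u₂ ξ s) 1)
      (-(fundM m e k ξ s 1 0 : ℂ) *
          (movingFT (deriv χ) k u₂ ξ s / (Real.sqrt m * alphaRoot k ξ s : ℝ))
        + (fundM m e k ξ s 0 0 : ℂ) * (divError m e (ξ - k * s) (movingFT (deriv χ) k η ξ s)
          (movingFT (deriv χ) k φ ξ s) (movingFT (deriv (deriv χ)) k φ ξ s)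
            / (alphaRoot k ξ s ^ 3 : ℝ))
        - (duhamelInt m e k ξ s 1 : ℂ) * conservedError m e k (movingFT (deriv χ) k u₂ ξ s)
          (movingFT (deriv χ) k η ξ s) (movingFT (deriv χ) k φ ξ s)) s := by
  have hΦ := fun i j => ((isFundamentalMatrix_fundM (e := e) (ξ := ξ) hm hk).2 s i j).ofReal_comp
  have hA := hS.hasDerivAt_weighted_density hχ hk hm ξ hs
  have hB := hS.hasDerivAt_weighted_divergence hχ hk hm ξ hs
  have hF := hS.hasDerivAt_conserved (k := k) hχ ξ hs
  have hJ0 := (hasDerivAt_duhamelInt_zero (e := e) (ξ := ξ) hm hk s).ofReal_comp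
  have hJ1 := (hasDerivAt_duhamelInt_one (e := e) (ξ := ξ) hm hk s).ofReal_comp
  -- With `Φ⁻¹` written as an adjugate, the relation `(Φ⁻¹)' = -Φ⁻¹ L` uses that `L` is trace free.
  have htr : coeffL m e k ξ s 1 1 = -coeffL m e k ξ s 0 0 := by
    have := trace_coeffL m e k ξ s
    rw [Matrix.trace_fin_two] at this
    linarith
  constructor
  · refine ((((hΦ 1 1).mul hA).sub ((hΦ 0 1).mul hB)).sub (hJ0.mul hF)).congr_deriv ?_
    simp only [Matrix.mul_apply, Fin.sum_univ_two, htr]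
    push_cast
    ring
  · refine ((((hΦ 1 0).neg.mul hA).add ((hΦ 0 0).mul hB)).sub (hJ1.mul hF)).congr_deriv ?_
    simp only [Matrix.mul_apply, Fin.sum_univ_two, htr, Pi.neg_apply]
    push_cast
    ring

end IsSmoothSolution

/-! ### Parseval's identity in `x` -/

theorem tsum_mode_sq {f : ℝ → ℝ → ℝ} (y : ℝ) (hf : Continuous fun x => f x y) :
    ∑' k : ℤ, ‖mode k f y‖ₑ ^ 2 =
      ENNReal.ofReal (2 * Real.pi) * ∫⁻ x in Ioc 0 (2 * Real.pi), ‖f x y‖ₑ ^ 2 := by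
  have hπ := Real.two_pi_pos
  have hc : Continuous fun x => (f x y : ℂ) := by fun_prop
  have hL2 : MemLp (fun x => (f x y : ℂ)) 2 (volume.restrict (Ioc 0 (2 * Real.pi))) := by
    obtain ⟨C, hC⟩ := (isCompact_Icc (a := (0 : ℝ)) (b := 2 * Real.pi)).exists_bound_of_continuousOn
      hc.continuousOn
    refine MemLp.of_bound hc.aestronglyMeasurable C ?_
    exact (ae_restrict_iff' measurableSet_Ioc).2
      (Filter.Eventually.of_forall fun x hx => hC x (Ioc_subset_Icc_self hx))
  have h := hasSum_sq_fourierCoeffOn hπ hL2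
  have hcoef : ∀ k : ℤ, ‖fourierCoeffOn hπ (fun x => (f x y : ℂ)) k‖ ^ 2
      = (1 / (2 * Real.pi)) ^ 2 * ‖mode k f y‖ ^ 2 := fun k => by
    rw [fourierCoeffOn_eq_integral, ← mul_pow]
    have h1 : ∫ x in (0 : ℝ)..(2 * Real.pi), (_root_.fourier (-k)) (x : AddCircle (2 * Real.pi - 0)) •
        (f x y : ℂ) = mode k f y := by
      rw [mode]
      congr 1; ext x
      rw [fourier_coe_apply, smul_eq_mul]
      congr 2
      have : (Real.pi : ℂ) ≠ 0 := by exact_mod_cast Real.pi_ne_zero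
      push_cast
      field_simp
      ring
    rw [h1, norm_smul, sub_zero, Real.norm_of_nonneg (by positivity)]
  simp_rw [hcoef] at h
  have h2 : HasSum (fun k : ℤ => ‖mode k f y‖ ^ 2)
      (2 * Real.pi * ∫ x in (0 : ℝ)..(2 * Real.pi), ‖(f x y : ℂ)‖ ^ 2) := by
    have h' := h.mul_left ((2 * Real.pi) ^ 2)
    have e1 : ∀ k : ℤ, (2 * Real.pi) ^ 2 * ((1 / (2 * Real.pi)) ^ 2 * ‖mode k f y‖ ^ 2)
        = ‖mode k f y‖ ^ 2 := fun k => by field_simp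
    have e2 : (2 * Real.pi) ^ 2 * (2 * Real.pi - 0)⁻¹ • ∫ x in (0 : ℝ)..(2 * Real.pi),
        ‖(f x y : ℂ)‖ ^ 2 = 2 * Real.pi * ∫ x in (0 : ℝ)..(2 * Real.pi), ‖(f x y : ℂ)‖ ^ 2 := by
      rw [smul_eq_mul, sub_zero]; field_simp
    simp_rw [e1, e2] at h'
    exact h'
  have h3 : ∀ z : ℂ, ‖z‖ₑ ^ 2 = ENNReal.ofReal (‖z‖ ^ 2) := fun z => by
    rw [← ofReal_norm, ENNReal.ofReal_pow (norm_nonneg _)]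
  simp_rw [h3]
  rw [← ENNReal.ofReal_tsum_of_nonneg (fun k => by positivity) h2.summable, h2.tsum_eq,
    ENNReal.ofReal_mul hπ.le, intervalIntegral.integral_of_le hπ.le,
    ofReal_integral_eq_lintegral_ofReal]
  · congr 1
    refine lintegral_congr fun x => ?_
    rw [← h3, ← ofReal_norm, ← ofReal_norm, Complex.norm_real]
  · exact hL2.integrable_norm_pow (p := 2) (by simp)
  · exact Filter.Eventually.of_forall fun x => by positivity

theorem l2Norm_sq (f : ℝ → ℝ → ℝ) (hf : Continuous (Function.uncurry f)) :
    l2Norm f ^ 2 = ∫⁻ y : ℝ, ∫⁻ x in Ioc 0 (2 * Real.pi), ‖f x y‖ₑ ^ 2 := by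
  rw [l2Norm, eLpNorm_two_sq, Measure.volume_eq_prod, ← Measure.prod_restrict,
    Measure.restrict_univ, lintegral_prod_symm]
  exact (Continuous.measurable (by
    have : Continuous fun p : ℝ × ℝ => f p.1 p.2 := hf
    fun_prop)).aemeasurable

theorem tsum_lintegral_mode_sq {f : ℝ → ℝ → ℝ} (hf : Continuous (Function.uncurry f)) :
    ∑' k : ℤ, ∫⁻ y, ‖mode k f y‖ₑ ^ 2 = ENNReal.ofReal (2 * Real.pi) * l2Norm f ^ 2 := by
  rw [l2Norm_sq f hf, ← lintegral_const_mul' _ _ ENNReal.ofReal_ne_top, ← lintegral_tsum]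
  · exact lintegral_congr fun y => tsum_mode_sq y
      (hf.comp (by fun_prop : Continuous fun x : ℝ => (x, y)))
  · intro k
    exact ((continuous_mode hf k).enorm.measurable.pow_const 2).aemeasurable

theorem lintegral_mode_sq_le {f : ℝ → ℝ → ℝ} (hf : Continuous (Function.uncurry f)) (k : ℤ) :
    ∫⁻ y, ‖mode k f y‖ₑ ^ 2 ≤ ENNReal.ofReal (2 * Real.pi) * l2Norm f ^ 2 := by
  rw [← tsum_lintegral_mode_sq hf]
  exact ENNReal.le_tsum k

theorem memLp_two_of_lintegral_lt_top {F : ℝ → ℂ} (hF : AEStronglyMeasurable F volume)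
    (h : ∫⁻ y, ‖F y‖ₑ ^ 2 < ⊤) : MemLp F 2 volume := by
  refine ⟨hF, ?_⟩
  rw [← eLpNorm_two_sq] at h
  exact (ENNReal.pow_lt_top_iff.1 h).resolve_right (by norm_num)

theorem memLp_mode {f : ℝ → ℝ → ℝ} (hf : Continuous (Function.uncurry f)) (h : l2Norm f < ⊤)
    (k : ℤ) : MemLp (mode k f) 2 volume :=
  memLp_two_of_lintegral_lt_top (continuous_mode hf k).aestronglyMeasurable
    ((lintegral_mode_sq_le hf k).trans_lt
      (ENNReal.mul_lt_top ENNReal.ofReal_lt_top (ENNReal.pow_lt_top h)))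

/-! ### A sequence of cutoffs -/

/-- The standard bump function. -/
noncomputable def stdBump : ContDiffBump (0 : ℝ) := ⟨1, 2, one_pos, one_lt_two⟩

/-- Cutoffs equal to one on `[-(n+1), n+1]`. -/
noncomputable def cut (n : ℕ) (y : ℝ) : ℝ := stdBump (((n : ℝ) + 1)⁻¹ * y)

theorem isCutoff_cut (n : ℕ) : IsCutoff (cut n) := by
  have hn : ((n : ℝ) + 1)⁻¹ ≠ 0 := by positivity
  exact ⟨stdBump.contDiff.comp (contDiff_const.mul contDiff_id),
    stdBump.hasCompactSupport.comp_homeomorph (Homeomorph.mulLeft₀ _ hn)⟩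

theorem cut_eventually_eq_one (y : ℝ) : ∀ᶠ n in Filter.atTop, cut n y = 1 := by
  obtain ⟨N, hN⟩ := exists_nat_ge |y|
  filter_upwards [Filter.eventually_ge_atTop N] with n hn
  refine stdBump.one_of_mem_closedBall ?_
  have hn' : (N : ℝ) ≤ n := by exact_mod_cast hn
  rw [mem_closedBall_zero_iff, norm_mul, norm_inv, Real.norm_of_nonneg (by positivity),
    Real.norm_eq_abs, inv_mul_le_iff₀ (by positivity)]
  show |y| ≤ (n + 1) * 1
  linarith

theorem abs_cut_sub_one_le (n : ℕ) (y : ℝ) : |cut n y - 1| ≤ 1 := by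
  have h1 : 0 ≤ cut n y := stdBump.nonneg
  have h2 : cut n y ≤ 1 := stdBump.le_one
  rw [abs_le]; constructor <;> linarith

/-- Scaling of a fixed bump. The second derivative gains a further factor `1/(n+1)`, which is not
needed. -/
theorem exists_abs_deriv_cut_le : ∃ C : ℝ, 0 ≤ C ∧ ∀ (n : ℕ) (y : ℝ),
    |deriv (cut n) y| ≤ C / (n + 1) ∧ |deriv (deriv (cut n)) y| ≤ C / (n + 1) := by
  have hb : ContDiff ℝ ∞ (stdBump : ℝ → ℝ) := stdBump.contDiff
  have hb1 : ContDiff ℝ ∞ (deriv (stdBump : ℝ → ℝ)) := (contDiff_infty_iff_deriv.1 hb).2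
  have hb2 : ContDiff ℝ ∞ (deriv (deriv (stdBump : ℝ → ℝ))) := (contDiff_infty_iff_deriv.1 hb1).2
  obtain ⟨C1, h1⟩ := stdBump.hasCompactSupport.deriv.exists_bound_of_continuous hb1.continuous
  obtain ⟨C2, h2⟩ := stdBump.hasCompactSupport.deriv.deriv.exists_bound_of_continuous hb2.continuous
  have hC1 : 0 ≤ C1 := (norm_nonneg _).trans (h1 0)
  refine ⟨max C1 C2, hC1.trans (le_max_left _ _), fun n y => ?_⟩
  have hn : (0 : ℝ) < n + 1 := by positivity
  have hd : deriv (cut n) = fun y => ((n : ℝ) + 1)⁻¹ * deriv (stdBump : ℝ → ℝ) (((n : ℝ) + 1)⁻¹ * y) := by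
    ext y
    exact deriv_comp_mul_left (((n : ℝ) + 1)⁻¹) stdBump y
  have hd2 : deriv (deriv (cut n)) y = ((n : ℝ) + 1)⁻¹ * (((n : ℝ) + 1)⁻¹ *
      deriv (deriv (stdBump : ℝ → ℝ)) (((n : ℝ) + 1)⁻¹ * y)) := by
    rw [hd, deriv_const_mul_field]
    congr 1
    exact deriv_comp_mul_left (((n : ℝ) + 1)⁻¹) (deriv stdBump) y
  have hinv : ((n : ℝ) + 1)⁻¹ ≤ 1 := inv_le_one_of_one_le₀ (by linarith [n.cast_nonneg (α := ℝ)])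
  have hinv0 : 0 ≤ ((n : ℝ) + 1)⁻¹ := by positivity
  constructor
  · rw [hd]
    simp only
    rw [abs_mul, abs_of_nonneg hinv0, div_eq_inv_mul]
    gcongr
    exact (h1 _).trans (le_max_left _ _)
  · rw [hd2, abs_mul, abs_mul, abs_of_nonneg hinv0, div_eq_inv_mul]
    gcongr
    calc _ ≤ 1 * |deriv (deriv (stdBump : ℝ → ℝ)) (((n : ℝ) + 1)⁻¹ * y)| := by gcongr
      _ ≤ _ := by rw [one_mul]; exact (h2 _).trans (le_max_right _ _)

/-! ### Removing the cutoff -/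

/-- The difference is the transform of `(χ_n - 1) F`, so Plancherel and dominated convergence apply.
-/
theorem lintegral_cut_sub_tendsto {F g : ℝ → ℂ} (hFc : Continuous F) (hF : MemLp F 2 volume)
    (hg : IsModeFT F g) :
    Filter.Tendsto (fun n => ∫⁻ ζ, ‖((1 / (2 * Real.pi) : ℝ) : ℂ) * truncFT (cut n) F ζ - g ζ‖ₑ ^ 2)
      Filter.atTop (nhds 0) := by
  have hFfin : ∫⁻ y, ‖F y‖ₑ ^ 2 < ⊤ := by
    rw [← eLpNorm_two_sq]; exact ENNReal.pow_lt_top hF.2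
  have hcc : ∀ n, Continuous (cut n) := fun n => (isCutoff_cut n).smooth.continuous
  have hbd : ∀ n y, ‖((cut n y - 1 : ℝ) : ℂ) * F y‖ₑ ^ 2 ≤ ‖F y‖ₑ ^ 2 := fun n y => by
    gcongr
    rw [enorm_mul]
    refine mul_le_of_le_one_left' ?_
    rw [← ofReal_norm, Complex.norm_real, Real.norm_eq_abs]
    exact ENNReal.ofReal_le_one.2 (abs_cut_sub_one_le n y)
  have hcont : ∀ n, Continuous fun y => ((cut n y - 1 : ℝ) : ℂ) * F y := fun n => by
    have := hcc n
    fun_prop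
  have key : ∀ n, ∫⁻ ζ, ‖((1 / (2 * Real.pi) : ℝ) : ℂ) * truncFT (cut n) F ζ - g ζ‖ₑ ^ 2
      = ENNReal.ofReal (1 / (2 * Real.pi)) * ∫⁻ y, ‖((cut n y - 1 : ℝ) : ℂ) * F y‖ₑ ^ 2 := fun n => by
    have h1 := isModeFT_intFT ((isCutoff_cut n).integrable_mul hFc)
    have h2 := h1.add (by have := hcc n; fun_prop) (by fun_prop) (hg.const_mul (-1))
    have h3 : (fun y => (cut n y : ℂ) * F y + -1 * F y) = fun y => ((cut n y - 1 : ℝ) : ℂ) * F y := by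
      ext y; push_cast; ring
    rw [h3] at h2
    rw [← h2.plancherel (memLp_two_of_lintegral_lt_top (hcont n).aestronglyMeasurable
      ((lintegral_mono (hbd n)).trans_lt hFfin))]
    refine lintegral_congr fun ζ => ?_
    rw [truncFT, neg_one_mul, sub_eq_add_neg]
  simp_rw [key]
  rw [← mul_zero (ENNReal.ofReal (1 / (2 * Real.pi)))]
  refine ENNReal.Tendsto.const_mul ?_ (Or.inr (by simp))
  rw [← lintegral_zero (μ := (volume : Measure ℝ))]
  refine tendsto_lintegral_of_dominated_convergence (fun y => ‖F y‖ₑ ^ 2)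
    (fun n => ((hcont n).enorm.measurable.pow_const 2)) (fun n => Filter.Eventually.of_forall (hbd n))
    hFfin.ne (Filter.Eventually.of_forall fun y => ?_)
  refine tendsto_const_nhds.congr' ?_
  filter_upwards [cut_eventually_eq_one y] with n hn
  simp [hn]

/-- Plancherel; the frequency shift is harmless by translation invariance. -/
theorem lintegral_truncFT_sq_le {χ : ℝ → ℝ} (hχ : IsCutoff χ) {B : ℝ} (hB : ∀ y, |χ y| ≤ B)
    {F : ℝ → ℂ} (hF : Continuous F) (hF2 : MemLp F 2 volume) (a : ℝ) :
    ∫⁻ ξ, ‖truncFT χ F (ξ - a)‖ₑ ^ 2 ≤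
      ENNReal.ofReal (2 * Real.pi) * (ENNReal.ofReal B ^ 2 * ∫⁻ y, ‖F y‖ₑ ^ 2) := by
  have hχc := hχ.smooth.continuous
  have hbd : ∀ y, ‖(χ y : ℂ) * F y‖ₑ ^ 2 ≤ ENNReal.ofReal B ^ 2 * ‖F y‖ₑ ^ 2 := fun y => by
    rw [enorm_mul, mul_pow]
    gcongr
    rw [← ofReal_norm, Complex.norm_real, Real.norm_eq_abs]
    exact ENNReal.ofReal_le_ofReal (hB y)
  have hle : ∫⁻ y, ‖(χ y : ℂ) * F y‖ₑ ^ 2 ≤ ENNReal.ofReal B ^ 2 * ∫⁻ y, ‖F y‖ₑ ^ 2 := by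
    rw [← lintegral_const_mul' _ _ (by simp)]
    exact lintegral_mono hbd
  have hfin : ∫⁻ y, ‖(χ y : ℂ) * F y‖ₑ ^ 2 < ⊤ := by
    refine hle.trans_lt (ENNReal.mul_lt_top (by simp) ?_)
    rw [← eLpNorm_two_sq]; exact ENNReal.pow_lt_top hF2.2
  rw [lintegral_sub_right_eq_self (fun ζ => ‖truncFT χ F ζ‖ₑ ^ 2) a]
  have := lintegral_intFT_sq (hχ.integrable_mul hF) (memLp_two_of_lintegral_lt_top
    (Continuous.aestronglyMeasurable (by fun_prop)) hfin)
  simp only [truncFT]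
  rw [this]
  gcongr

theorem measurable_movingFT_max {f : ℝ → ℝ → ℝ → ℝ} (hf : IsSmoothL2 f) {χ : ℝ → ℝ}
    (hχ : IsCutoff χ) (k : ℤ) :
    Measurable fun p : ℝ × ℝ => ‖truncFT χ (mode k (f (max p.2 0))) (p.1 - k * p.2)‖ₑ ^ 2 := by
  have h := (continuous_truncFT_max hf hχ k).comp
    (by fun_prop : Continuous fun p : ℝ × ℝ => (p.2, p.1 - k * p.2))
  exact h.enorm.measurable.pow_const 2

/-- The accumulated square of a commutator term. -/
noncomputable def accumulated (χ : ℝ → ℝ) (k : ℤ) (f : ℝ → ℝ → ℝ → ℝ) (t ξ : ℝ) : ℝ≥0∞ :=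
  ∫⁻ s in Ioc 0 t, ‖truncFT χ (mode k (f (max s 0))) (ξ - k * s)‖ₑ ^ 2

theorem measurable_accumulated {f : ℝ → ℝ → ℝ → ℝ} (hf : IsSmoothL2 f) {χ : ℝ → ℝ}
    (hχ : IsCutoff χ) (k : ℤ) (t : ℝ) : Measurable (accumulated χ k f t) :=
  (measurable_movingFT_max hf hχ k).lintegral_prod_right'

/-- Tonelli, then Plancherel at each time. Only the `L²` bound on `[0, t]` enters, and the factor
`B²` will tend to zero with the derivatives of the cutoffs. -/
theorem lintegral_accumulated_le {f : ℝ → ℝ → ℝ → ℝ} (hf : IsSmoothL2 f) {χ : ℝ → ℝ}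
    (hχ : IsCutoff χ) {B : ℝ} (hB : ∀ y, |χ y| ≤ B) (k : ℤ) (t : ℝ) {K : ℝ≥0∞}
    (hK : K < ⊤) (hfK : ∀ s ∈ Icc 0 t, l2Norm (f s) ≤ K) :
    ∫⁻ ξ, accumulated χ k f t ξ ≤ ENNReal.ofReal (2 * Real.pi) * (ENNReal.ofReal B ^ 2 *
      (ENNReal.ofReal (2 * Real.pi) * K ^ 2)) * ENNReal.ofReal t := by
  unfold accumulated
  rw [lintegral_lintegral_swap (measurable_movingFT_max hf hχ k).aemeasurable]
  calc _ ≤ ∫⁻ s in Ioc 0 t, ENNReal.ofReal (2 * Real.pi) * (ENNReal.ofReal B ^ 2 *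
      (ENNReal.ofReal (2 * Real.pi) * K ^ 2)) := by
        refine setLIntegral_mono measurable_const fun s hs => ?_
        have hsm := hf.isSmoothPeriodic hs.1.le
        have hl2 := hfK s ⟨hs.1.le, hs.2⟩
        rw [max_eq_left hs.1.le]
        refine (lintegral_truncFT_sq_le hχ hB (continuous_mode hsm.smooth.continuous k)
          (memLp_mode hsm.smooth.continuous (hl2.trans_lt hK) k) _).trans ?_
        gcongr
        refine (lintegral_mode_sq_le hsm.smooth.continuous k).trans ?_
        gcongr
    _ = _ := by rw [setLIntegral_const, Real.volume_Ioc, sub_zero]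

theorem tendsto_lintegral_accumulated {f : ℝ → ℝ → ℝ → ℝ} (hf : IsSmoothL2 f) {χ : ℕ → ℝ → ℝ}
    (hχ : ∀ n, IsCutoff (χ n)) {C : ℝ} (hC : ∀ n y, |χ n y| ≤ C / (n + 1)) (k : ℤ) (t : ℝ) :
    Filter.Tendsto (fun n => ∫⁻ ξ, accumulated (χ n) k f t ξ) Filter.atTop (nhds 0) := by
  obtain ⟨K, hK, hfK⟩ := hf.bounded t
  refine tendsto_of_tendsto_of_tendsto_of_le_of_le tendsto_const_nhds ?_ (fun _ => zero_le)
    (fun n => lintegral_accumulated_le hf (hχ n) (hC n) k t hK hfK)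
  have h0 : Filter.Tendsto (fun n : ℕ => ENNReal.ofReal (C / (n + 1))) Filter.atTop (nhds 0) := by
    rw [← ENNReal.ofReal_zero]
    exact ENNReal.tendsto_ofReal (tendsto_const_div_atTop_nhds_zero_nat C |>.comp
      (Filter.tendsto_add_atTop_nat 1) |>.congr fun n => by simp)
  have h1 : Filter.Tendsto (fun n : ℕ => ENNReal.ofReal (C / (n + 1)) ^ 2) Filter.atTop (nhds 0) := by
    have := ENNReal.Tendsto.pow (n := 2) h0
    simpa using this
  have hfin : ENNReal.ofReal (2 * Real.pi) * K ^ 2 ≠ ⊤ :=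
    ENNReal.mul_ne_top ENNReal.ofReal_ne_top (ENNReal.pow_ne_top hK.ne)
  have h2 := ENNReal.Tendsto.mul_const (b := ENNReal.ofReal t)
    (ENNReal.Tendsto.const_mul (a := ENNReal.ofReal (2 * Real.pi))
      (ENNReal.Tendsto.mul_const h1 (Or.inr hfin)) (Or.inr ENNReal.ofReal_ne_top)) (Or.inr (by simp))
  simpa using h2

/-- The integrals are summable, so the series converges almost everywhere and its terms tend to
zero. -/
theorem ae_tendsto_zero_of_lintegral_le {q : ℕ → ℝ → ℝ≥0∞} (hm : ∀ n, AEMeasurable (q n) volume)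
    (h : ∀ n, ∫⁻ ξ, q n ξ ≤ (1 / 2) ^ n) :
    ∀ᵐ ξ, Filter.Tendsto (fun n => q n ξ) Filter.atTop (nhds 0) := by
  have hsum : ∫⁻ ξ, ∑' n, q n ξ ≠ ⊤ := by
    rw [lintegral_tsum hm]
    refine ne_top_of_le_ne_top ?_ (ENNReal.tsum_le_tsum h)
    rw [ENNReal.tsum_geometric]
    simp
  filter_upwards [ae_lt_top' (AEMeasurable.tsum hm) hsum] with ξ hξ
  exact ENNReal.tendsto_atTop_zero_of_tsum_ne_top hξ.ne

section

/-! ### The pulled back unknown is conserved -/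

/-- Cauchy–Schwarz in time against the bounded coefficient. -/
theorem tendsto_integral_movingFT {f : ℝ → ℝ → ℝ → ℝ} {χ : ℕ → ℝ → ℝ} {k : ℤ} {t ξ : ℝ} (ht : 0 ≤ t)
    (hf : IsSmoothL2 f) (hχ : ∀ j, IsCutoff (χ j))
    (h : Filter.Tendsto (fun j => accumulated (χ j) k f t ξ) Filter.atTop (nhds 0)) {c : ℝ → ℂ}
    (hc : Continuous c) :
    Filter.Tendsto (fun j => ∫ s in (0 : ℝ)..t, c s * movingFT (χ j) k f ξ s) Filter.atTop
      (nhds 0) := by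
  have hcfin : (∫⁻ s in Ioc 0 t, ‖c s‖ₑ ^ (2 : ℝ)) ^ (1 / 2 : ℝ) ≠ ⊤ := by
    refine ENNReal.rpow_ne_top_of_nonneg (by norm_num) ?_
    obtain ⟨C, hC⟩ := (isCompact_Icc (a := (0 : ℝ)) (b := t)).exists_bound_of_continuousOn
      hc.continuousOn
    refine ne_top_of_le_ne_top ?_ (setLIntegral_mono (g := fun _ => ENNReal.ofReal C ^ (2 : ℝ))
      measurable_const fun s hs => ?_)
    · rw [setLIntegral_const]
      exact ENNReal.mul_ne_top (ENNReal.rpow_ne_top_of_nonneg (by norm_num) ENNReal.ofReal_ne_top)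
        (by simp)
    · gcongr
      rw [← ofReal_norm]
      exact ENNReal.ofReal_le_ofReal (hC s (Ioc_subset_Icc_self hs))
  have hbound : ∀ j, ‖∫ s in (0 : ℝ)..t, c s * movingFT (χ j) k f ξ s‖ₑ ≤
      (∫⁻ s in Ioc 0 t, ‖c s‖ₑ ^ (2 : ℝ)) ^ (1 / 2 : ℝ) * accumulated (χ j) k f t ξ ^ (1 / 2 : ℝ) :=
      fun j => by
    have hcont := (continuous_truncFT_max hf (hχ j) k).comp
      (by fun_prop : Continuous fun s : ℝ => (s, ξ - k * s))
    rw [intervalIntegral.integral_of_le ht]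
    refine (enorm_integral_le_lintegral_enorm _).trans ?_
    have heq : ∫⁻ s in Ioc 0 t, ‖c s * movingFT (χ j) k f ξ s‖ₑ =
        ∫⁻ s in Ioc 0 t, ((fun s => ‖c s‖ₑ) *
          fun s => ‖truncFT (χ j) (mode k (f (max s 0))) (ξ - k * s)‖ₑ) s := by
      refine setLIntegral_congr_fun measurableSet_Ioc fun s hs => ?_
      simp only [Pi.mul_apply]
      rw [enorm_mul, movingFT, max_eq_left hs.1.le]
    rw [heq]
    refine (ENNReal.lintegral_mul_le_Lp_mul_Lq _ (p := 2) (q := 2) Real.HolderConjugate.two_two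
      hc.enorm.measurable.aemeasurable hcont.enorm.measurable.aemeasurable).trans (le_of_eq ?_)
    congr 2
    refine lintegral_congr fun s => ?_
    rw [← ENNReal.rpow_natCast]; rfl
  rw [tendsto_zero_iff_enorm_tendsto_zero]
  refine tendsto_of_tendsto_of_tendsto_of_le_of_le tendsto_const_nhds ?_ (fun _ => zero_le) hbound
  have h1 := (ENNReal.continuous_rpow_const (y := (1 / 2 : ℝ))).tendsto 0 |>.comp h
  rw [ENNReal.zero_rpow_of_pos (by norm_num)] at h1
  simpa using ENNReal.Tendsto.const_mul h1 (Or.inr hcfin)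

variable {m e : ℝ} {η u₁ u₂ φ : ℝ → ℝ → ℝ → ℝ} {k : ℤ}

/-- For fixed `ξ` all coefficients are continuous in time, so each of the four commutator terms is
covered by the preceding lemma. The coefficients `a`, `b`, `c` are left free so that both pull-back
components and `F` are instances. -/
theorem tendsto_integral_error (hS : IsSmoothSolution m e η u₁ u₂ φ) {χ : ℕ → ℝ → ℝ} {t ξ : ℝ}
    (ht : 0 ≤ t) (hχ : ∀ j, IsCutoff (χ j))
    (hu : Filter.Tendsto (fun j => accumulated (deriv (χ j)) k u₂ t ξ) Filter.atTop (nhds 0))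
    (hn : Filter.Tendsto (fun j => accumulated (deriv (χ j)) k η t ξ) Filter.atTop (nhds 0))
    (hp : Filter.Tendsto (fun j => accumulated (deriv (χ j)) k φ t ξ) Filter.atTop (nhds 0))
    (hpp : Filter.Tendsto (fun j => accumulated (deriv (deriv (χ j))) k φ t ξ) Filter.atTop (nhds 0))
    {a b c : ℝ → ℂ} (ha : Continuous a) (hb : Continuous b) (hc : Continuous c)
    {D : ℕ → ℝ → ℂ} (hD : ∀ j s, D j s = a s * movingFT (deriv (χ j)) k u₂ ξ s
      + b s * IsSmoothSolution.divError m e (ξ - k * s) (movingFT (deriv (χ j)) k η ξ s)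
          (movingFT (deriv (χ j)) k φ ξ s) (movingFT (deriv (deriv (χ j))) k φ ξ s)
      + c s * IsSmoothSolution.conservedError m e k (movingFT (deriv (χ j)) k u₂ ξ s)
          (movingFT (deriv (χ j)) k η ξ s) (movingFT (deriv (χ j)) k φ ξ s)) :
    (∀ j, IntervalIntegrable (D j) volume 0 t) ∧
    Filter.Tendsto (fun j => ∫ s in (0 : ℝ)..t, D j s) Filter.atTop (nhds 0) := by
  have hd := fun j => (hχ j).deriv
  have hdd := fun j => (hχ j).deriv.deriv
  -- The error is regrouped by unknown: `χ' u₂`, `χ' η`, `χ' φ` and `χ'' φ`.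
  let c₁ : ℝ → ℂ := fun s => a s + c s
  let c₂ : ℝ → ℂ := fun s => (b s * (Complex.I * (ξ - k * s : ℝ)) + c s * (Complex.I * k)) * (1 / m : ℝ)
  let c₃ : ℝ → ℂ := fun s => (b s * (Complex.I * (ξ - k * s : ℝ)) - c s * (Complex.I * k)) * (e / m : ℝ)
  let c₄ : ℝ → ℂ := fun s => -(b s * (e / m : ℝ))
  have h1 : Continuous c₁ := by fun_prop
  have h2 : Continuous c₂ := by fun_prop
  have h3 : Continuous c₃ := by fun_prop
  have h4 : Continuous c₄ := by fun_prop
  have hsplit : ∀ j, D j = fun s => c₁ s * movingFT (deriv (χ j)) k u₂ ξ s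
      + c₂ s * movingFT (deriv (χ j)) k η ξ s + c₃ s * movingFT (deriv (χ j)) k φ ξ s
      + c₄ s * movingFT (deriv (deriv (χ j))) k φ ξ s := fun j => by
    ext s
    rw [hD]
    simp only [c₁, c₂, c₃, c₄, IsSmoothSolution.divError, IsSmoothSolution.conservedError]
    ring
  have hint : ∀ {f : ℝ → ℝ → ℝ → ℝ} {θ : ℝ → ℝ} {d : ℝ → ℂ}, IsSmoothL2 f → IsCutoff θ →
      Continuous d → IntervalIntegrable (fun s => d s * movingFT θ k f ξ s) volume 0 t :=
      fun hf hθ hd => by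
    refine ContinuousOn.intervalIntegrable (hd.continuousOn.mul
      ((continuousOn_movingFT hf hθ k ξ).mono fun s hs => ?_))
    rw [uIcc_of_le ht] at hs
    exact hs.1
  have i1 := fun j => hint hS.velocity_y (hd j) h1
  have i2 := fun j => hint hS.density (hd j) h2
  have i3 := fun j => hint hS.potential (hd j) h3
  have i4 := fun j => hint hS.potential (hdd j) h4
  refine ⟨fun j => by rw [hsplit]; exact (((i1 j).add (i2 j)).add (i3 j)).add (i4 j), ?_⟩
  have hI : ∀ j, ∫ s in (0 : ℝ)..t, D j s = (∫ s in (0 : ℝ)..t, c₁ s * movingFT (deriv (χ j)) k u₂ ξ s)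
      + (∫ s in (0 : ℝ)..t, c₂ s * movingFT (deriv (χ j)) k η ξ s)
      + (∫ s in (0 : ℝ)..t, c₃ s * movingFT (deriv (χ j)) k φ ξ s)
      + ∫ s in (0 : ℝ)..t, c₄ s * movingFT (deriv (deriv (χ j))) k φ ξ s := fun j => by
    rw [hsplit, intervalIntegral.integral_add (((i1 j).add (i2 j)).add (i3 j)) (i4 j),
      intervalIntegral.integral_add ((i1 j).add (i2 j)) (i3 j),
      intervalIntegral.integral_add (i1 j) (i2 j)]
  simp_rw [hI]
  have t1 := tendsto_integral_movingFT ht hS.velocity_y hd hu h1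
  have t2 := tendsto_integral_movingFT ht hS.density hd hn h2
  have t3 := tendsto_integral_movingFT ht hS.potential hd hp h3
  have t4 := tendsto_integral_movingFT ht hS.potential hdd hpp h4
  simpa using ((t1.add t2).add t3).add t4

theorem continuous_duhamelInt (hm : 0 < m) (hk : k ≠ 0) (ξ : ℝ) (i : Fin 2) :
    Continuous fun s => duhamelInt m e k ξ s i := by
  refine continuous_iff_continuousAt.2 fun s => ?_
  fin_cases i
  · exact (hasDerivAt_duhamelInt_zero hm hk s).continuousAt
  · exact (hasDerivAt_duhamelInt_one hm hk s).continuousAt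

theorem continuousOn_pullback (hm : 0 < m) (hk : k ≠ 0) (ξ : ℝ) {n v₁ v₂ : ℝ → ℂ} {S : Set ℝ}
    (hn : ContinuousOn n S) (h₁ : ContinuousOn v₁ S) (h₂ : ContinuousOn v₂ S) (i : Fin 2) :
    ContinuousOn (fun s => pullback m e k ξ s (n s) (v₁ s) (v₂ s) i) S := by
  have hΦ := fun i j => Complex.continuous_ofReal.comp (continuous_fundM (e := e) (ξ := ξ) hm hk i j)
  have hJ := fun i => Complex.continuous_ofReal.comp (continuous_duhamelInt (e := e) hm hk ξ i)
  have hq := Complex.continuous_ofReal.comp (continuous_alphaRoot (ξ := ξ) hk)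
  have hr : (Real.sqrt m : ℂ) ≠ 0 := by exact_mod_cast (Real.sqrt_pos.2 hm).ne'
  have hq0 : ∀ s, (alphaRoot k ξ s : ℂ) ≠ 0 := fun s => by exact_mod_cast (alphaRoot_pos hk s).ne'
  have hA : ContinuousOn (fun s => n s / ((Real.sqrt m * alphaRoot k ξ s : ℝ) : ℂ)) S := by
    simp only [Complex.ofReal_mul]
    exact hn.div (continuous_const.mul hq).continuousOn fun s _ => mul_ne_zero hr (hq0 s)
  have hD : ContinuousOn (fun s => divSymbol k (ξ - k * s) (v₁ s) (v₂ s)) S := by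
    simp only [divSymbol]
    fun_prop
  have hW : ContinuousOn (fun s => vortSymbol k (ξ - k * s) (v₁ s) (v₂ s)) S := by
    simp only [vortSymbol]
    fun_prop
  have hB : ContinuousOn (fun s => divSymbol k (ξ - k * s) (v₁ s) (v₂ s) /
      ((alphaRoot k ξ s ^ 3 : ℝ) : ℂ)) S := by
    simp only [Complex.ofReal_pow]
    exact hD.div (hq.pow 3).continuousOn fun s _ => pow_ne_zero 3 (hq0 s)
  fin_cases i
  · exact (((hΦ 1 1).continuousOn.mul hA).sub ((hΦ 0 1).continuousOn.mul hB)).sub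
      ((hJ 0).continuousOn.mul (hn.add hW))
  · exact (((hΦ 1 0).neg.continuousOn.mul hA).add ((hΦ 0 0).continuousOn.mul hB)).sub
      ((hJ 1).continuousOn.mul (hn.add hW))

/-- The fundamental theorem of calculus on `[0, t]`: the equations give the derivative for `s > 0`,
and continuity reaches the endpoint `0`. The integrand is the commutator error. -/
theorem tendsto_pullback_sub (hS : IsSmoothSolution m e η u₁ u₂ φ) (hm : 0 < m) (hk : k ≠ 0)
    {χ : ℕ → ℝ → ℝ} {t ξ : ℝ} (ht : 0 ≤ t) (hχ : ∀ j, IsCutoff (χ j))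
    (hu : Filter.Tendsto (fun j => accumulated (deriv (χ j)) k u₂ t ξ) Filter.atTop (nhds 0))
    (hn : Filter.Tendsto (fun j => accumulated (deriv (χ j)) k η t ξ) Filter.atTop (nhds 0))
    (hp : Filter.Tendsto (fun j => accumulated (deriv (χ j)) k φ t ξ) Filter.atTop (nhds 0))
    (hpp : Filter.Tendsto (fun j => accumulated (deriv (deriv (χ j))) k φ t ξ) Filter.atTop (nhds 0))
    (i : Fin 2) :
    Filter.Tendsto (fun j =>
      pullback m e k ξ t (movingFT (χ j) k η ξ t) (movingFT (χ j) k u₁ ξ t)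
          (movingFT (χ j) k u₂ ξ t) i
        - pullback m e k ξ 0 (movingFT (χ j) k η ξ 0) (movingFT (χ j) k u₁ ξ 0)
          (movingFT (χ j) k u₂ ξ 0) i) Filter.atTop (nhds 0) := by
  have hΦ := fun i j => Complex.continuous_ofReal.comp (continuous_fundM (e := e) (ξ := ξ) hm hk i j)
  have hJ := fun i => Complex.continuous_ofReal.comp (continuous_duhamelInt (e := e) hm hk ξ i)
  have hq := Complex.continuous_ofReal.comp (continuous_alphaRoot (ξ := ξ) hk)
  have hr : (Real.sqrt m : ℂ) ≠ 0 := by exact_mod_cast (Real.sqrt_pos.2 hm).ne'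
  have hq0 : ∀ s, (alphaRoot k ξ s : ℂ) ≠ 0 := fun s => by exact_mod_cast (alphaRoot_pos hk s).ne'
  have hcont := fun j (i : Fin 2) => continuousOn_pullback (e := e) hm hk ξ (S := Icc 0 t)
    ((continuousOn_movingFT hS.density (hχ j) k ξ).mono Icc_subset_Ici_self)
    ((continuousOn_movingFT hS.velocity_x (hχ j) k ξ).mono Icc_subset_Ici_self)
    ((continuousOn_movingFT hS.velocity_y (hχ j) k ξ).mono Icc_subset_Ici_self) i
  have hw1 : ∀ p : Fin 2, Continuous fun s =>
      (fundM m e k ξ s p 1 : ℂ) / ((Real.sqrt m * alphaRoot k ξ s : ℝ) : ℂ) := fun p => by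
    simp only [Complex.ofReal_mul]
    exact (hΦ p 1).div (continuous_const.mul hq) fun s => mul_ne_zero hr (hq0 s)
  have hw10 : Continuous fun s =>
      -(fundM m e k ξ s 1 0 : ℂ) / ((Real.sqrt m * alphaRoot k ξ s : ℝ) : ℂ) := by
    simp only [Complex.ofReal_mul]
    exact (hΦ 1 0).neg.div (continuous_const.mul hq) fun s => mul_ne_zero hr (hq0 s)
  have hw2 : ∀ p : Fin 2, Continuous fun s =>
      (fundM m e k ξ s 0 p : ℂ) / ((alphaRoot k ξ s ^ 3 : ℝ) : ℂ) := fun p => by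
    simp only [Complex.ofReal_pow]
    exact (hΦ 0 p).div (hq.pow 3) fun s => pow_ne_zero 3 (hq0 s)
  fin_cases i
  · obtain ⟨hint, hlim⟩ := tendsto_integral_error hS ht hχ hu hn hp hpp (hw1 1) (hw2 1).neg
      (hJ 0).neg (D := _) fun j s => rfl
    refine hlim.congr fun j => ?_
    refine intervalIntegral.integral_eq_sub_of_hasDerivAt_of_le ht (hcont j 0) (fun s hs => ?_)
      (hint j)
    refine (hS.hasDerivAt_pullback (hχ j) hk hm ξ hs.1).1.congr_deriv ?_
    simp only [Pi.neg_apply, Function.comp_apply]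
    ring
  · obtain ⟨hint, hlim⟩ := tendsto_integral_error hS ht hχ hu hn hp hpp hw10 (hw2 0)
      (hJ 1).neg (D := _) fun j s => rfl
    refine hlim.congr fun j => ?_
    refine intervalIntegral.integral_eq_sub_of_hasDerivAt_of_le ht (hcont j 1) (fun s hs => ?_)
      (hint j)
    refine (hS.hasDerivAt_pullback (hχ j) hk hm ξ hs.1).2.congr_deriv ?_
    simp only [Pi.neg_apply, Function.comp_apply]
    ring

theorem pullback_mul (ξ s : ℝ) (c n v₁ v₂ : ℂ) (i : Fin 2) :
    pullback m e k ξ s (c * n) (c * v₁) (c * v₂) i = c * pullback m e k ξ s n v₁ v₂ i := by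
  fin_cases i <;> simp only [pullback, divSymbol, vortSymbol, Fin.zero_eta, Fin.mk_one,
    Matrix.cons_val_zero, Matrix.cons_val_one] <;> ring

theorem continuous_divSymbol (k : ℤ) (ζ : ℝ) :
    Continuous fun p : ℂ × ℂ × ℂ => divSymbol k ζ p.2.1 p.2.2 :=
  (continuous_const.mul (continuous_fst.comp continuous_snd)).add
    (continuous_const.mul (continuous_snd.comp continuous_snd))

theorem continuous_vortSymbol (k : ℤ) (ζ : ℝ) :
    Continuous fun p : ℂ × ℂ × ℂ => vortSymbol k ζ p.2.1 p.2.2 :=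
  (continuous_const.mul (continuous_fst.comp continuous_snd)).neg.add
    (continuous_const.mul (continuous_snd.comp continuous_snd))

theorem continuous_pullback (ξ s : ℝ) (i : Fin 2) :
    Continuous fun p : ℂ × ℂ × ℂ => pullback m e k ξ s p.1 p.2.1 p.2.2 i := by
  have hd := continuous_divSymbol k (ξ - k * s)
  have hw := continuous_fst.add (continuous_vortSymbol k (ξ - k * s))
  fin_cases i
  · exact ((continuous_const.mul (continuous_fst.div_const _)).sub
      (continuous_const.mul (hd.div_const _))).sub (continuous_const.mul hw)
  · exact ((continuous_const.mul (continuous_fst.div_const _)).add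
      (continuous_const.mul (hd.div_const _))).sub (continuous_const.mul hw)

theorem tendsto_conserved_sub (hS : IsSmoothSolution m e η u₁ u₂ φ) {χ : ℕ → ℝ → ℝ} {t ξ : ℝ}
    (ht : 0 ≤ t) (hχ : ∀ j, IsCutoff (χ j))
    (hu : Filter.Tendsto (fun j => accumulated (deriv (χ j)) k u₂ t ξ) Filter.atTop (nhds 0))
    (hn : Filter.Tendsto (fun j => accumulated (deriv (χ j)) k η t ξ) Filter.atTop (nhds 0))
    (hp : Filter.Tendsto (fun j => accumulated (deriv (χ j)) k φ t ξ) Filter.atTop (nhds 0))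
    (hpp : Filter.Tendsto (fun j => accumulated (deriv (deriv (χ j))) k φ t ξ) Filter.atTop
      (nhds 0)) :
    Filter.Tendsto (fun j =>
      (movingFT (χ j) k η ξ t +
        vortSymbol k (ξ - k * t) (movingFT (χ j) k u₁ ξ t) (movingFT (χ j) k u₂ ξ t))
        - (movingFT (χ j) k η ξ 0 +
        vortSymbol k (ξ - k * 0) (movingFT (χ j) k u₁ ξ 0) (movingFT (χ j) k u₂ ξ 0)))
      Filter.atTop (nhds 0) := by
  obtain ⟨hint, hlim⟩ := tendsto_integral_error hS ht hχ hu hn hp hpp (a := fun _ => 0)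
    (b := fun _ => 0) (c := fun _ => 1) continuous_const continuous_const continuous_const
    (D := _) fun j s => rfl
  refine hlim.congr fun j => ?_
  refine intervalIntegral.integral_eq_sub_of_hasDerivAt_of_le ht (f := fun s =>
    movingFT (χ j) k η ξ s +
      vortSymbol k (ξ - k * s) (movingFT (χ j) k u₁ ξ s) (movingFT (χ j) k u₂ ξ s))
    ?_ (fun s hs => ?_) (hint j)
  · have h0 := (continuousOn_movingFT hS.density (hχ j) k ξ).mono fun s (hs : s ∈ Icc 0 t) => hs.1
    have h1 := (continuousOn_movingFT hS.velocity_x (hχ j) k ξ).mono fun s (hs : s ∈ Icc 0 t) => hs.1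
    have h2 := (continuousOn_movingFT hS.velocity_y (hχ j) k ξ).mono fun s (hs : s ∈ Icc 0 t) => hs.1
    simp only [vortSymbol]
    fun_prop
  · refine (hS.hasDerivAt_conserved (hχ j) ξ hs.1).congr_deriv ?_
    ring

/-! ### Passage to the limit along a sequence of cutoffs. -/

/-- The squared error of the truncated Fourier transform at the moving frequency. -/
noncomputable def truncError (k : ℤ) (f : ℝ → ℝ → ℝ → ℝ) (g : ℝ → ℂ) (s : ℝ) (n : ℕ) (ξ : ℝ) : ℝ≥0∞ :=
  ‖((1 / (2 * Real.pi) : ℝ) : ℂ) * movingFT (cut n) k f ξ s - g (ξ - k * s)‖ₑ ^ 2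

theorem aemeasurable_truncError {f : ℝ → ℝ → ℝ → ℝ} (hf : IsSmoothL2 f) {g : ℝ → ℂ}
    (hg : AEStronglyMeasurable g volume) {s : ℝ} (hs : 0 ≤ s) (n : ℕ) :
    AEMeasurable (truncError k f g s n) volume := by
  have h1 : Continuous fun ξ => movingFT (cut n) k f ξ s :=
    (continuous_intFT ((isCutoff_cut n).integrable_mul (continuous_mode
      (hf.isSmoothPeriodic hs).smooth.continuous k))).comp (by fun_prop : Continuous fun ξ : ℝ => ξ - k * s)
  have h2 : AEMeasurable (fun ξ => g (ξ - k * s)) volume :=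
    hg.aemeasurable.comp_quasiMeasurePreserving
      (measurePreserving_sub_right volume ((k : ℝ) * s)).quasiMeasurePreserving
  exact (((continuous_const.mul h1).measurable.aemeasurable.sub h2).enorm).pow_const 2

theorem tendsto_lintegral_truncError {f : ℝ → ℝ → ℝ → ℝ} (hf : IsSmoothL2 f) {g : ℝ → ℂ} {s : ℝ}
    (hs : 0 ≤ s) (hg : IsModeFT (mode k (f s)) g) :
    Filter.Tendsto (fun n => ∫⁻ ξ, truncError k f g s n ξ) Filter.atTop (nhds 0) := by
  obtain ⟨K, hK, hfK⟩ := hf.bounded s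
  have hc := (hf.isSmoothPeriodic hs).smooth.continuous
  refine (lintegral_cut_sub_tendsto (continuous_mode hc k)
    (memLp_mode hc ((hfK s ⟨hs, le_rfl⟩).trans_lt hK) k) hg).congr fun n => ?_
  exact (lintegral_sub_right_eq_self (fun ζ => ‖((1 / (2 * Real.pi) : ℝ) : ℂ) *
    truncFT (cut n) (mode k (f s)) ζ - g ζ‖ₑ ^ 2) ((k : ℝ) * s)).symm

theorem tendsto_of_truncError {f : ℝ → ℝ → ℝ → ℝ} {g : ℝ → ℂ} {s ξ : ℝ} {ν : ℕ → ℕ}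
    (h : Filter.Tendsto (fun j => truncError k f g s (ν j) ξ) Filter.atTop (nhds 0)) :
    Filter.Tendsto (fun j => ((1 / (2 * Real.pi) : ℝ) : ℂ) * movingFT (cut (ν j)) k f ξ s)
      Filter.atTop (nhds (g (ξ - k * s))) := by
  rw [tendsto_iff_norm_sub_tendsto_zero, ← tendsto_zero_iff_norm_tendsto_zero,
    tendsto_zero_iff_enorm_tendsto_zero]
  have h1 := (ENNReal.continuous_rpow_const (y := (1 / 2 : ℝ))).tendsto 0 |>.comp h
  rw [ENNReal.zero_rpow_of_pos (by norm_num)] at h1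
  refine h1.congr fun j => ?_
  simp only [Function.comp_apply, truncError]
  rw [← ENNReal.rpow_natCast, ← ENNReal.rpow_mul]
  norm_num

/-- A homogeneous continuous expression in the Fourier transforms of the solution is conserved once
it is conserved in the limit of vanishing commutators. -/
theorem ae_eq_of_tendsto_sub (hS : IsSmoothSolution m e η u₁ u₂ φ) {t : ℝ} (ht : 0 ≤ t) {n₀ a₀ b₀ n a b : ℝ → ℂ} (hn₀ : IsModeFT (mode k (η 0)) n₀)
    (ha₀ : IsModeFT (mode k (u₁ 0)) a₀) (hb₀ : IsModeFT (mode k (u₂ 0)) b₀)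
    (hn : IsModeFT (mode k (η t)) n) (ha : IsModeFT (mode k (u₁ t)) a)
    (hb : IsModeFT (mode k (u₂ t)) b) {P : ℝ → ℝ → ℂ → ℂ → ℂ → ℂ}
    (hmul : ∀ ξ s c n v₁ v₂, P ξ s (c * n) (c * v₁) (c * v₂) = c * P ξ s n v₁ v₂)
    (hcont : ∀ ξ s, Continuous fun p : ℂ × ℂ × ℂ => P ξ s p.1 p.2.1 p.2.2)
    (hP : ∀ {ξ : ℝ} {χ : ℕ → ℝ → ℝ}, (∀ j, IsCutoff (χ j)) →
      Filter.Tendsto (fun j => accumulated (deriv (χ j)) k u₂ t ξ) Filter.atTop (nhds 0) →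
      Filter.Tendsto (fun j => accumulated (deriv (χ j)) k η t ξ) Filter.atTop (nhds 0) →
      Filter.Tendsto (fun j => accumulated (deriv (χ j)) k φ t ξ) Filter.atTop (nhds 0) →
      Filter.Tendsto (fun j => accumulated (deriv (deriv (χ j))) k φ t ξ) Filter.atTop (nhds 0) →
      Filter.Tendsto (fun j =>
        P ξ t (movingFT (χ j) k η ξ t) (movingFT (χ j) k u₁ ξ t) (movingFT (χ j) k u₂ ξ t)
        - P ξ 0 (movingFT (χ j) k η ξ 0) (movingFT (χ j) k u₁ ξ 0) (movingFT (χ j) k u₂ ξ 0))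
        Filter.atTop (nhds 0)) :
    ∀ᵐ ξ : ℝ, P ξ t (n (ξ - k * t)) (a (ξ - k * t)) (b (ξ - k * t)) =
      P ξ 0 (n₀ ξ) (a₀ ξ) (b₀ ξ) := by
  obtain ⟨C, -, hC⟩ := exists_abs_deriv_cut_le
  have hd := fun n => (isCutoff_cut n).deriv
  have hdd := fun n => (isCutoff_cut n).deriv.deriv
  have h0 := le_refl (0 : ℝ)
  have T1 := tendsto_lintegral_truncError hS.density h0 hn₀
  have T2 := tendsto_lintegral_truncError hS.velocity_x h0 ha₀
  have T3 := tendsto_lintegral_truncError hS.velocity_y h0 hb₀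
  have T4 := tendsto_lintegral_truncError hS.density ht hn
  have T5 := tendsto_lintegral_truncError hS.velocity_x ht ha
  have T6 := tendsto_lintegral_truncError hS.velocity_y ht hb
  have T7 := tendsto_lintegral_accumulated hS.velocity_y hd (fun n y => (hC n y).1) k t
  have T8 := tendsto_lintegral_accumulated hS.density hd (fun n y => (hC n y).1) k t
  have T9 := tendsto_lintegral_accumulated hS.potential hd (fun n y => (hC n y).1) k t
  have T10 := tendsto_lintegral_accumulated hS.potential hdd (fun n y => (hC n y).2) k t
  have hpos : ∀ j : ℕ, (0 : ℝ≥0∞) < (1 / 2) ^ j := fun j => ENNReal.pow_pos (by simp) j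
  -- Six approximation errors and four commutators vanish in the limit; at each `j` one cutoff makes
  -- all ten integrals at most `2^{-j}`, hence summable.
  have hev : ∀ j : ℕ, ∃ ν : ℕ, _ := fun j =>
    (((((((((T1.eventually_le_const (hpos j)).and (T2.eventually_le_const (hpos j))).and
    (T3.eventually_le_const (hpos j))).and (T4.eventually_le_const (hpos j))).and
    (T5.eventually_le_const (hpos j))).and (T6.eventually_le_const (hpos j))).and
    (T7.eventually_le_const (hpos j))).and (T8.eventually_le_const (hpos j))).and
    (T9.eventually_le_const (hpos j))).and (T10.eventually_le_const (hpos j)) |>.exists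
  choose ν hν using hev
  have A1 := ae_tendsto_zero_of_lintegral_le
    (fun j => aemeasurable_truncError hS.density hn₀.1.1 h0 (ν j)) fun j => (hν j).1.1.1.1.1.1.1.1.1
  have A2 := ae_tendsto_zero_of_lintegral_le
    (fun j => aemeasurable_truncError hS.velocity_x ha₀.1.1 h0 (ν j))
    fun j => (hν j).1.1.1.1.1.1.1.1.2
  have A3 := ae_tendsto_zero_of_lintegral_le
    (fun j => aemeasurable_truncError hS.velocity_y hb₀.1.1 h0 (ν j)) fun j => (hν j).1.1.1.1.1.1.1.2
  have A4 := ae_tendsto_zero_of_lintegral_le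
    (fun j => aemeasurable_truncError hS.density hn.1.1 ht (ν j)) fun j => (hν j).1.1.1.1.1.1.2
  have A5 := ae_tendsto_zero_of_lintegral_le
    (fun j => aemeasurable_truncError hS.velocity_x ha.1.1 ht (ν j)) fun j => (hν j).1.1.1.1.1.2
  have A6 := ae_tendsto_zero_of_lintegral_le
    (fun j => aemeasurable_truncError hS.velocity_y hb.1.1 ht (ν j)) fun j => (hν j).1.1.1.1.2
  have A7 := ae_tendsto_zero_of_lintegral_le
    (fun j => (measurable_accumulated hS.velocity_y (hd (ν j)) k t).aemeasurable)
    fun j => (hν j).1.1.1.2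
  have A8 := ae_tendsto_zero_of_lintegral_le
    (fun j => (measurable_accumulated hS.density (hd (ν j)) k t).aemeasurable)
    fun j => (hν j).1.1.2
  have A9 := ae_tendsto_zero_of_lintegral_le
    (fun j => (measurable_accumulated hS.potential (hd (ν j)) k t).aemeasurable)
    fun j => (hν j).1.2
  have A10 := ae_tendsto_zero_of_lintegral_le
    (fun j => (measurable_accumulated hS.potential (hdd (ν j)) k t).aemeasurable)
    fun j => (hν j).2
  filter_upwards [A1, A2, A3, A4, A5, A6, A7, A8, A9, A10] with ξ l1 l2 l3 l4 l5 l6 l7 l8 l9 l10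
  -- Homogeneity moves the normalizing factor `1/2π` inside the expression, where the truncated
  -- transforms converge.
  have hlim := (hP (fun j => isCutoff_cut (ν j)) l7 l8 l9 l10).const_mul
    (((1 / (2 * Real.pi) : ℝ) : ℂ))
  simp_rw [mul_sub, ← hmul] at hlim
  have hL := (((hcont ξ t).tendsto _).comp ((tendsto_of_truncError l4).prodMk_nhds
      ((tendsto_of_truncError l5).prodMk_nhds (tendsto_of_truncError l6)))).sub
    (((hcont ξ 0).tendsto _).comp ((tendsto_of_truncError l1).prodMk_nhds
      ((tendsto_of_truncError l2).prodMk_nhds (tendsto_of_truncError l3))))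
  have := tendsto_nhds_unique hL hlim
  simpa [sub_eq_zero] using this

/-- The pulled back unknown built from the Fourier transforms of the solution is conserved. -/
theorem ae_pullback_eq (hS : IsSmoothSolution m e η u₁ u₂ φ) (hm : 0 < m) (hk : k ≠ 0) {t : ℝ}
    (ht : 0 ≤ t) {n₀ a₀ b₀ n a b : ℝ → ℂ} (hn₀ : IsModeFT (mode k (η 0)) n₀)
    (ha₀ : IsModeFT (mode k (u₁ 0)) a₀) (hb₀ : IsModeFT (mode k (u₂ 0)) b₀)
    (hn : IsModeFT (mode k (η t)) n) (ha : IsModeFT (mode k (u₁ t)) a)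
    (hb : IsModeFT (mode k (u₂ t)) b) (i : Fin 2) :
    ∀ᵐ ξ : ℝ, pullback m e k ξ t (n (ξ - k * t)) (a (ξ - k * t)) (b (ξ - k * t)) i =
      pullback m e k ξ 0 (n₀ ξ) (a₀ ξ) (b₀ ξ) i :=
  ae_eq_of_tendsto_sub hS ht hn₀ ha₀ hb₀ hn ha hb
    (P := fun ξ s n v₁ v₂ => pullback m e k ξ s n v₁ v₂ i)
    (fun ξ s c n v₁ v₂ => pullback_mul ξ s c n v₁ v₂ i) (fun ξ s => continuous_pullback ξ s i)
    fun hχ l7 l8 l9 l10 => tendsto_pullback_sub hS hm hk ht hχ l7 l8 l9 l10 i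

/-- The Fourier transform of `η + ω` is transported. -/
theorem ae_conserved_eq (hS : IsSmoothSolution m e η u₁ u₂ φ) {t : ℝ}
    (ht : 0 ≤ t) {n₀ a₀ b₀ n a b : ℝ → ℂ} (hn₀ : IsModeFT (mode k (η 0)) n₀)
    (ha₀ : IsModeFT (mode k (u₁ 0)) a₀) (hb₀ : IsModeFT (mode k (u₂ 0)) b₀)
    (hn : IsModeFT (mode k (η t)) n) (ha : IsModeFT (mode k (u₁ t)) a)
    (hb : IsModeFT (mode k (u₂ t)) b) :
    ∀ᵐ ξ : ℝ, n (ξ - k * t) + vortSymbol k (ξ - k * t) (a (ξ - k * t)) (b (ξ - k * t)) =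
      n₀ ξ + vortSymbol k ξ (a₀ ξ) (b₀ ξ) := by
  filter_upwards [ae_eq_of_tendsto_sub hS ht hn₀ ha₀ hb₀ hn ha hb
    (P := fun ξ s n v₁ v₂ => n + vortSymbol k (ξ - k * s) v₁ v₂)
    (fun ξ s c n v₁ v₂ => by simp only [vortSymbol]; ring)
    (fun ξ s => continuous_fst.add (continuous_vortSymbol k (ξ - k * s)))
    fun hχ l7 l8 l9 l10 => tendsto_conserved_sub hS ht hχ l7 l8 l9 l10] with ξ h
  simpa using h

end

/-! ### Fourier transforms of the unknowns -/

section

variable {k : ℤ} {f : ℝ → ℝ → ℝ}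

/-- `fourier` is a single choice for all modes, hence existence is required for every `k`. All later
identities compare this choice with explicit transforms through uniqueness. -/
theorem isModeFT_fourier (h : ∀ k, ∃ g, IsModeFT (mode k f) g) (k : ℤ) :
    IsModeFT (mode k f) (fourier f k) := by
  have hex : ∃ g, IsFourierTransform f g := by
    choose g hg using h
    exact ⟨g, isFourierTransform_iff.2 hg⟩
  have : IsFourierTransform f (fourier f) := by
    rw [fourier, dif_pos hex]
    exact hex.choose_spec
  exact isFourierTransform_iff.1 this k

theorem IsSmoothL2.memLp_mode {f : ℝ → ℝ → ℝ → ℝ} (hf : IsSmoothL2 f) {s : ℝ} (hs : 0 ≤ s) (k : ℤ) :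
    MemLp (mode k (f s)) 2 volume := by
  obtain ⟨K, hK, hfK⟩ := hf.bounded s
  exact ElectronCouette.memLp_mode (hf.isSmoothPeriodic hs).smooth.continuous
    ((hfK s ⟨hs, le_rfl⟩).trans_lt hK) k

theorem IsSmoothL2.isModeFT_fourier {f : ℝ → ℝ → ℝ → ℝ} (hf : IsSmoothL2 f) {s : ℝ} (hs : 0 ≤ s)
    (k : ℤ) : IsModeFT (mode k (f s)) (fourier (f s) k) :=
  ElectronCouette.isModeFT_fourier (fun k =>
    (exists_isModeFT (hf.memLp_mode hs k)).imp fun _ h => h.1) k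

theorem IsModeFT.divergence {u₁ u₂ : ℝ → ℝ → ℝ} (h₁ : IsSmoothPeriodic u₁)
    (h₂ : IsSmoothPeriodic u₂) {a b : ℝ → ℂ} (ha : IsModeFT (mode k u₁) a)
    (hb : IsModeFT (mode k u₂) b) :
    IsModeFT (mode k (divergence u₁ u₂)) fun ζ => divSymbol k ζ (a ζ) (b ζ) := by
  have hc := continuous_mode h₂.dy.smooth.continuous k
  have h := (ha.const_mul (Complex.I * k)).add
    (continuous_const.mul (continuous_mode h₁.smooth.continuous k)) hc
    (hb.deriv (h₂.hasDerivAt_mode k) hc)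
  convert h using 1
  · ext y
    show _ = Complex.I * k * mode k u₁ y + _
    rw [← h₁.mode_dx]
    exact mode_add k y (h₁.dx.continuous_left y) (h₂.dy.continuous_left y)
  · ext ζ
    rw [divSymbol]; ring

theorem IsModeFT.vorticity {u₁ u₂ : ℝ → ℝ → ℝ} (h₁ : IsSmoothPeriodic u₁)
    (h₂ : IsSmoothPeriodic u₂) {a b : ℝ → ℂ} (ha : IsModeFT (mode k u₁) a)
    (hb : IsModeFT (mode k u₂) b) :
    IsModeFT (mode k (vorticity u₁ u₂)) fun ζ => vortSymbol k ζ (a ζ) (b ζ) := by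
  have hc := continuous_mode h₁.dy.smooth.continuous k
  have h := ((ha.deriv (h₁.hasDerivAt_mode k) hc).const_mul (-1)).add
    (continuous_const.mul hc) (continuous_const.mul (continuous_mode h₂.smooth.continuous k))
    (hb.const_mul (Complex.I * k))
  convert h using 1
  · ext y
    have h3 := mode_const_mul (dy u₁) k (-1) y
    have h4 := mode_add (f := fun x y => -1 * dy u₁ x y) k y
      ((h₁.dy.const_mul (-1)).continuous_left y) (h₂.dx.continuous_left y)
    show _ = -1 * mode k (dy u₁) y + Complex.I * k * mode k u₂ y
    rw [← h₂.mode_dx]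
    push_cast at h3
    rw [← h3, ← h4]
    exact congrFun (mode_eq_of_eqOn (fun x y => by simp [ElectronCouette.vorticity]) k) y
  · ext ζ
    rw [vortSymbol]; ring

theorem IsSmoothPeriodic.vorticity {u₁ u₂ : ℝ → ℝ → ℝ} (h₁ : IsSmoothPeriodic u₁)
    (h₂ : IsSmoothPeriodic u₂) : IsSmoothPeriodic (vorticity u₁ u₂) := by
  have := (h₁.dy.const_mul (-1)).add h₂.dx
  simp only [neg_one_mul] at this
  exact this

theorem mode_zero_eq_zero (hf : ZeroAverage f) : mode 0 f = fun _ => 0 := by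
  ext y
  have h := hf y
  have h0 : (1 / (2 * Real.pi)) ≠ 0 := by have := Real.pi_pos; positivity
  have h1 := (mul_eq_zero.1 h).resolve_left h0
  simp only [mode, Int.cast_zero, mul_zero, zero_mul, neg_zero, Complex.exp_zero, one_mul]
  rw [intervalIntegral.integral_ofReal, h1, Complex.ofReal_zero]

theorem ae_fourier_zero_eq_zero (hf : ZeroAverage f) (h : IsModeFT (mode 0 f) (fourier f 0)) :
    ∀ᵐ ξ, fourier f 0 ξ = 0 :=
  h.unique (mode_zero_eq_zero hf ▸ isModeFT_zero)

end

/-! ### The datum seen through the solution at a later time -/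

section

variable {m e : ℝ} {k : ℤ} {ξ : ℝ}

/-- The solution of `X' = L X` equal to `(A, B)` at time `t` has value `Φ(t)⁻¹(A, B)` at time `0`.
The energy estimate is used backward on it, for real and imaginary parts separately. -/
theorem norm_sq_inv_fundM_le (hm : 0 < m) (hk : k ≠ 0) (t : ℝ) (A B : ℂ) :
    ‖(fundM m e k ξ t 1 1 : ℂ) * A - (fundM m e k ξ t 0 1 : ℂ) * B‖ ^ 2
      + ‖-(fundM m e k ξ t 1 0 : ℂ) * A + (fundM m e k ξ t 0 0 : ℂ) * B‖ ^ 2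
      ≤ growthConst m e * (‖A‖ ^ 2 + ‖B‖ ^ 2) := by
  have hdet := det_fundM (e := e) (ξ := ξ) hm hk t
  have key := fun x y : ℝ => sq_fundM_le (e := e) (ξ := ξ) hm hk
    ![fundM m e k ξ t 1 1 * x - fundM m e k ξ t 0 1 * y,
      -fundM m e k ξ t 1 0 * x + fundM m e k ξ t 0 0 * y] t 0
  simp only [fundM_zero hm hk, Matrix.cons_val_zero, Matrix.cons_val_one, Matrix.one_apply_eq,
    Matrix.one_apply_ne zero_ne_one, Matrix.one_apply_ne one_ne_zero, one_mul, zero_mul, add_zero,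
    zero_add] at key
  have e1 : ∀ x y : ℝ, fundM m e k ξ t 0 0 * (fundM m e k ξ t 1 1 * x - fundM m e k ξ t 0 1 * y)
      + fundM m e k ξ t 0 1 * (-fundM m e k ξ t 1 0 * x + fundM m e k ξ t 0 0 * y) = x := fun x y => by
    linear_combination x * hdet
  have e2 : ∀ x y : ℝ, fundM m e k ξ t 1 0 * (fundM m e k ξ t 1 1 * x - fundM m e k ξ t 0 1 * y)
      + fundM m e k ξ t 1 1 * (-fundM m e k ξ t 1 0 * x + fundM m e k ξ t 0 0 * y) = y := fun x y => by
    linear_combination y * hdet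
  simp only [e1, e2] at key
  have hre := key A.re B.re
  have him := key A.im B.im
  simp only [← Complex.normSq_eq_norm_sq, Complex.normSq_apply, Complex.add_re, Complex.add_im,
    Complex.sub_re, Complex.sub_im, Complex.neg_re, Complex.neg_im, Complex.mul_re, Complex.mul_im,
    Complex.ofReal_re, Complex.ofReal_im]
  nlinarith [hre, him]

theorem initB_eq (η₀ ψ₀ : ℝ → ℝ → ℝ) (hk : k ≠ 0) :
    initB m η₀ ψ₀ k ξ = ![fourier η₀ k ξ / ((Real.sqrt m * alphaRoot k ξ 0 : ℝ) : ℂ),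
      fourier ψ₀ k ξ / ((alphaRoot k ξ 0 ^ 3 : ℝ) : ℂ)] := by
  have h0 : alpha k ξ 0 = (k : ℝ) ^ 2 + ξ ^ 2 := by rw [alpha_def]; ring
  have h3 : alphaRoot k ξ 0 ^ 3 = ((k : ℝ) ^ 2 + ξ ^ 2) ^ (3 / 4 : ℝ) := by
    rw [alphaRoot, ← Real.rpow_natCast, ← Real.rpow_mul (alpha_pos hk ξ 0).le, h0]; norm_num
  rw [h3, alphaRoot, h0]
  rfl

theorem integral_solOp_mulVec (hm : 0 < m) (hk : k ≠ 0) (t : ℝ) (F : ℂ) (i : Fin 2) :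
    ∫ s in (0 : ℝ)..t, (((solOp m e k ξ 0 s).mulVec (forcingM k ξ s) i : ℝ) : ℂ) * F
      = (duhamelInt m e k ξ t i : ℂ) * F := by
  rw [intervalIntegral.integral_mul_const, intervalIntegral.integral_ofReal]
  congr 2
  simp only [solOp_mulVec hm hk]
  fin_cases i <;> rfl

theorem dataR_zero_mode_eq_zero (m e : ℝ) (η₀ ψ₀ ω₀ : ℝ → ℝ → ℝ) (t : ℝ) (hη : fourier η₀ 0 ξ = 0)
    (hψ : fourier ψ₀ 0 ξ = 0) (hF : fourier (fun x y => η₀ x y + ω₀ x y) 0 ξ = 0) :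
    dataR m e η₀ ψ₀ ω₀ t 0 ξ = 0 := by
  ext i
  fin_cases i <;> simp [dataR, initB, hη, hψ, hF]

theorem dataR_apply (hm : 0 < m) (hk : k ≠ 0) (η₀ ψ₀ ω₀ : ℝ → ℝ → ℝ) (t : ℝ) (i : Fin 2) :
    dataR m e η₀ ψ₀ ω₀ t k ξ i = initB m η₀ ψ₀ k ξ i
      + (duhamelInt m e k ξ t i : ℂ) * fourier (fun x y => η₀ x y + ω₀ x y) k ξ := by
  rw [← integral_solOp_mulVec hm hk]
  rfl

/-- At time `0` the flow is the identity and the Duhamel integral vanishes, so the pull-back is the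
datum `B^in`. -/
theorem pullback_zero (hm : 0 < m) (hk : k ≠ 0) (n v₁ v₂ : ℂ) :
    pullback m e k ξ 0 n v₁ v₂ = ![n / ((Real.sqrt m * alphaRoot k ξ 0 : ℝ) : ℂ),
      divSymbol k ξ v₁ v₂ / ((alphaRoot k ξ 0 ^ 3 : ℝ) : ℂ)] := by
  simp [pullback, fundM_zero hm hk, duhamelInt_zero]

end

/-! ### The datum functional bounded by the solution. -/

section

variable {m e : ℝ} {η u₁ u₂ φ : ℝ → ℝ → ℝ → ℝ}

namespace IsSmoothSolution

theorem isModeFT_divergence (hS : IsSmoothSolution m e η u₁ u₂ φ) {t : ℝ} (ht : 0 ≤ t) (k : ℤ) :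
    IsModeFT (mode k (divergence (u₁ t) (u₂ t)))
      fun ζ => divSymbol k ζ (fourier (u₁ t) k ζ) (fourier (u₂ t) k ζ) :=
  IsModeFT.divergence (hS.velocity_x.isSmoothPeriodic ht) (hS.velocity_y.isSmoothPeriodic ht)
    (hS.velocity_x.isModeFT_fourier ht k) (hS.velocity_y.isModeFT_fourier ht k)

theorem isModeFT_conserved (hS : IsSmoothSolution m e η u₁ u₂ φ) {t : ℝ} (ht : 0 ≤ t) (k : ℤ) :
    IsModeFT (mode k fun x y => η t x y + vorticity (u₁ t) (u₂ t) x y)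
      fun ζ => fourier (η t) k ζ + vortSymbol k ζ (fourier (u₁ t) k ζ) (fourier (u₂ t) k ζ) := by
  have h0 := hS.density.isSmoothPeriodic ht
  have h1 := hS.velocity_x.isSmoothPeriodic ht
  have h2 := hS.velocity_y.isSmoothPeriodic ht
  have hv := h1.vorticity h2
  have h := (hS.density.isModeFT_fourier ht k).add (continuous_mode h0.smooth.continuous k)
    (continuous_mode hv.smooth.continuous k) (IsModeFT.vorticity h1 h2
      (hS.velocity_x.isModeFT_fourier ht k) (hS.velocity_y.isModeFT_fourier ht k))
  convert h using 1
  ext y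
  exact mode_add k y (h0.continuous_left y) (hv.continuous_left y)

theorem isModeFT_fourier_divergence (hS : IsSmoothSolution m e η u₁ u₂ φ) {t : ℝ} (ht : 0 ≤ t)
    (k : ℤ) : IsModeFT (mode k (divergence (u₁ t) (u₂ t)))
      (fourier (divergence (u₁ t) (u₂ t)) k) :=
  isModeFT_fourier (fun k => ⟨_, hS.isModeFT_divergence ht k⟩) k

theorem isModeFT_fourier_conserved (hS : IsSmoothSolution m e η u₁ u₂ φ) {t : ℝ} (ht : 0 ≤ t)
    (k : ℤ) : IsModeFT (mode k fun x y => η t x y + vorticity (u₁ t) (u₂ t) x y)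
      (fourier (fun x y => η t x y + vorticity (u₁ t) (u₂ t) x y) k) :=
  isModeFT_fourier (fun k => ⟨_, hS.isModeFT_conserved ht k⟩) k

/-- The datum functional at time `t` is controlled by the solution at time `t`. -/
theorem ae_norm_sq_dataR_le (hS : IsSmoothSolution m e η u₁ u₂ φ) (hm : 0 < m) {k : ℤ} (hk : k ≠ 0)
    {t : ℝ} (ht : 0 ≤ t) :
    ∀ᵐ ξ : ℝ, ‖dataR m e (η 0) (divergence (u₁ 0) (u₂ 0)) (vorticity (u₁ 0) (u₂ 0)) t k ξ‖ ^ 2 ≤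
      growthConst m e * (‖fourier (η t) k (ξ - k * t)‖ ^ 2 / (m * alphaRoot k ξ t ^ 2)
        + ‖fourier (divergence (u₁ t) (u₂ t)) k (ξ - k * t)‖ ^ 2 / alphaRoot k ξ t ^ 6) := by
  have h0 := le_refl (0 : ℝ)
  have hn₀ := hS.density.isModeFT_fourier h0 k
  have ha₀ := hS.velocity_x.isModeFT_fourier h0 k
  have hb₀ := hS.velocity_y.isModeFT_fourier h0 k
  have hn := hS.density.isModeFT_fourier ht k
  have ha := hS.velocity_x.isModeFT_fourier ht k
  have hb := hS.velocity_y.isModeFT_fourier ht k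
  -- An identity valid for almost every `ζ` is transported to `ζ = ξ - kt` by translation
  -- invariance.
  have D := (measurePreserving_sub_right volume ((k : ℝ) * t)).quasiMeasurePreserving.ae
    ((hS.isModeFT_fourier_divergence ht k).unique (hS.isModeFT_divergence ht k))
  filter_upwards [ae_pullback_eq hS hm hk ht hn₀ ha₀ hb₀ hn ha hb 0,
    ae_pullback_eq hS hm hk ht hn₀ ha₀ hb₀ hn ha hb 1,
    ae_conserved_eq hS ht hn₀ ha₀ hb₀ hn ha hb, D,
    (hS.isModeFT_fourier_divergence h0 k).unique (hS.isModeFT_divergence h0 k),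
    (hS.isModeFT_fourier_conserved h0 k).unique (hS.isModeFT_conserved h0 k)]
    with ξ p0 p1 hF hD hD₀ hF₀
  have hq := alphaRoot_pos (ξ := ξ) hk t
  rw [EuclideanSpace.norm_sq_eq, Fin.sum_univ_two, dataR_apply hm hk, dataR_apply hm hk,
    initB_eq _ _ hk, hF₀, hD₀, hD]
  rw [pullback_zero hm hk] at p0 p1
  simp only [pullback, Matrix.cons_val_zero, Matrix.cons_val_one] at p0 p1 ⊢
  -- Conservation turns `B^in` into `Φ(t)⁻¹X(t)` minus the Duhamel term. Since `F̂` is transported,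
  -- that term cancels the one in the datum functional, leaving `Φ(t)⁻¹X(t)`.
  rw [← p0, ← p1, hF, sub_add_cancel, sub_add_cancel]
  refine (norm_sq_inv_fundM_le hm hk t _ _).trans (le_of_eq ?_)
  rw [norm_div, norm_div, Complex.norm_real, Complex.norm_real, div_pow, div_pow,
    Real.norm_of_nonneg (by positivity), Real.norm_of_nonneg (by positivity), mul_pow,
    Real.sq_sqrt hm.le, ← pow_mul]

end IsSmoothSolution

end

/-! ### Integration over the frequencies -/

theorem sq_add_sq_le_add_sq (a b : ℝ≥0∞) : a ^ 2 + b ^ 2 ≤ (a + b) ^ 2 := by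
  rw [add_sq, add_right_comm]
  exact le_self_add

theorem specNorm_sq {E : Type} [NormedAddCommGroup E] (r s : ℝ) (G : ℤ → ℝ → E) :
    specNorm r s G ^ 2 = ∑' k : ℤ, ∫⁻ ξ : ℝ,
      ENNReal.ofReal (jap (k : ℝ) ^ (2 * r) * jap ξ ^ (2 * s) * ‖G k ξ‖ ^ 2) := by
  rw [specNorm, ← ENNReal.rpow_natCast, ← ENNReal.rpow_mul]
  norm_num

theorem jap_pos (a : ℝ) : 0 < jap a := Real.sqrt_pos.2 (by positivity)

theorem jap_sq (a : ℝ) : jap a ^ 2 = 1 + a ^ 2 := Real.sq_sqrt (by positivity)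

/-- From `kt = ξ - (ξ - kt)` one gets `k²t² ≤ 2ξ² + 2(ξ - kt)²`, and `k² ≥ 1`. This inequality is
the source of the growth: `α` can be small at time `t` only for `|ξ|` of size `|kt|`, which the
weight `⟨ξ⟩^{-1}` pays for. -/
theorem jap_le_mul_alphaRoot {k : ℤ} (hk : k ≠ 0) (ξ t : ℝ) :
    jap t ≤ Real.sqrt 2 * jap ξ * alphaRoot k ξ t ^ 2 := by
  have hq := alphaRoot_pos (ξ := ξ) hk t
  refine (sq_le_sq₀ (jap_pos t).le (by have := jap_pos ξ; positivity)).1 ?_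
  rw [mul_pow, mul_pow, ← pow_mul, alphaRoot_pow_four hk, Real.sq_sqrt zero_le_two, jap_sq, jap_sq,
    alpha_def]
  have hk1 := one_le_sq_intCast hk
  have h1 : (k : ℝ) ^ 2 * t ^ 2 ≤ 2 * ξ ^ 2 + 2 * (ξ - k * t) ^ 2 := by
    nlinarith [sq_nonneg (2 * ξ - k * t)]
  nlinarith [mul_nonneg (sub_nonneg.2 hk1) (sq_nonneg t), mul_nonneg (sub_nonneg.2 hk1) (sq_nonneg ξ),
    mul_nonneg (sq_nonneg ξ) (sq_nonneg (ξ - k * t))]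

theorem norm_sq_fourierQ (u₁ u₂ : ℝ → ℝ → ℝ) {k : ℤ} (hk : k ≠ 0) (ζ : ℝ) :
    ‖fourierQ u₁ u₂ k ζ‖ ^ 2 = ‖fourier (divergence u₁ u₂) k ζ‖ ^ 2 / ((k : ℝ) ^ 2 + ζ ^ 2) := by
  have hpos : 0 < (k : ℝ) ^ 2 + ζ ^ 2 := by nlinarith [one_le_sq_intCast hk, sq_nonneg ζ]
  have hc : (k : ℂ) ^ 2 + (ζ : ℂ) ^ 2 = (((k : ℝ) ^ 2 + ζ ^ 2 : ℝ) : ℂ) := by push_cast; rfl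
  have hkn : ‖(k : ℂ)‖ ^ 2 = (k : ℝ) ^ 2 := by rw [Complex.norm_intCast, sq_abs]
  rw [EuclideanSpace.norm_sq_eq, Fin.sum_univ_two]
  simp only [fourierQ, hc, PiLp.toLp_apply, Matrix.cons_val_zero, Matrix.cons_val_one, norm_mul,
    norm_neg, norm_div, norm_one, Complex.norm_I, Complex.norm_real, one_mul, mul_pow, div_pow,
    hkn, Real.norm_eq_abs, sq_abs, one_pow]
  field_simp

theorem tsum_lintegral_fourier_sq {f : ℝ → ℝ → ℝ → ℝ} (hf : IsSmoothL2 f) {t : ℝ} (ht : 0 ≤ t) :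
    ∑' k : ℤ, ∫⁻ ζ, ENNReal.ofReal (‖fourier (f t) k ζ‖ ^ 2) = l2Norm (f t) ^ 2 := by
  have h : ∀ k : ℤ, ∫⁻ ζ, ENNReal.ofReal (‖fourier (f t) k ζ‖ ^ 2) =
      ENNReal.ofReal (1 / (2 * Real.pi)) * ∫⁻ y, ‖mode k (f t) y‖ₑ ^ 2 := fun k => by
    rw [← (hf.isModeFT_fourier ht k).plancherel (hf.memLp_mode ht k)]
    refine lintegral_congr fun ζ => ?_
    rw [ENNReal.ofReal_pow (norm_nonneg _), ofReal_norm]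
  simp_rw [h]
  rw [ENNReal.tsum_mul_left, tsum_lintegral_mode_sq (hf.isSmoothPeriodic ht).smooth.continuous,
    ← mul_assoc, ← ENNReal.ofReal_mul (by have := Real.pi_pos; positivity),
    one_div_mul_cancel Real.two_pi_pos.ne', ENNReal.ofReal_one, one_mul]

section

variable {m e : ℝ} {η u₁ u₂ φ : ℝ → ℝ → ℝ → ℝ}

theorem ae_fourier_data_zero_mode (hS : IsSmoothSolution m e η u₁ u₂ φ) (hη : ZeroAverage (η 0))
    (hψ : ZeroAverage (divergence (u₁ 0) (u₂ 0))) (hω : ZeroAverage (vorticity (u₁ 0) (u₂ 0))) :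
    ∀ᵐ ξ : ℝ, fourier (η 0) 0 ξ = 0 ∧ fourier (divergence (u₁ 0) (u₂ 0)) 0 ξ = 0 ∧
      fourier (fun x y => η 0 x y + vorticity (u₁ 0) (u₂ 0) x y) 0 ξ = 0 := by
  have h0 := le_refl (0 : ℝ)
  have hF : ZeroAverage fun x y => η 0 x y + vorticity (u₁ 0) (u₂ 0) x y := fun y => by
    rw [intervalIntegral.integral_add, mul_add, hη y, hω y, add_zero]
    · exact ((hS.density.isSmoothPeriodic h0).continuous_left y).intervalIntegrable _ _
    · exact (((hS.velocity_x.isSmoothPeriodic h0).vorticity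
        (hS.velocity_y.isSmoothPeriodic h0)).continuous_left y).intervalIntegrable _ _
  filter_upwards [ae_fourier_zero_eq_zero hη (hS.density.isModeFT_fourier h0 0),
    ae_fourier_zero_eq_zero hψ (hS.isModeFT_fourier_divergence h0 0),
    ae_fourier_zero_eq_zero hF (hS.isModeFT_fourier_conserved h0 0)] with ξ h1 h2 h3
  exact ⟨h1, h2, h3⟩

/-- The growth factor `⟨t⟩` cancels `⟨ξ⟩^{-1}` at the cost of `√2 α^{1/2}`, which is exactly the
factor between `|X|²` and the physical densities. -/
theorem lintegral_dataR_mul_le (hS : IsSmoothSolution m e η u₁ u₂ φ) (hm : 0 < m)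
    (hη : ZeroAverage (η 0)) (hψ : ZeroAverage (divergence (u₁ 0) (u₂ 0)))
    (hω : ZeroAverage (vorticity (u₁ 0) (u₂ 0))) {t : ℝ} (ht : 0 ≤ t) (k : ℤ) :
    (∫⁻ ξ : ℝ, ENNReal.ofReal (jap (k : ℝ) ^ (2 * (0 : ℝ)) * jap ξ ^ (2 * (-1 / 2) : ℝ) *
        ‖dataR m e (η 0) (divergence (u₁ 0) (u₂ 0)) (vorticity (u₁ 0) (u₂ 0)) t k ξ‖ ^ 2)) *
      ENNReal.ofReal (jap t) ≤
    ENNReal.ofReal (Real.sqrt 2 * growthConst m e) *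
      ((∫⁻ ζ : ℝ, ENNReal.ofReal (jap (k : ℝ) ^ (2 * (0 : ℝ)) * jap ζ ^ (2 * (0 : ℝ)) *
        ‖fourierQ (u₁ t) (u₂ t) k ζ‖ ^ 2)) +
      ENNReal.ofReal (1 / m) * ∫⁻ ζ, ENNReal.ofReal (‖fourier (η t) k ζ‖ ^ 2)) := by
  have hG := growthConst_pos (e := e) hm
  have hJ : ∀ ξ, jap ξ ^ (2 * (-1 / 2) : ℝ) = (jap ξ)⁻¹ := fun ξ => by
    rw [← Real.rpow_neg_one]; norm_num
  simp only [hJ, mul_zero, Real.rpow_zero, one_mul]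
  by_cases hk : k = 0
  · subst hk
    refine le_trans (le_of_eq ?_) (zero_le)
    rw [lintegral_eq_zero_of_ae_eq_zero, zero_mul]
    filter_upwards [ae_fourier_data_zero_mode hS hη hψ hω] with ξ ⟨h1, h2, h3⟩
    simp [dataR_zero_mode_eq_zero m e _ _ _ t h1 h2 h3]
  have hmeas : AEMeasurable (fun ζ => ENNReal.ofReal (1 / m) *
      ENNReal.ofReal (‖fourier (η t) k ζ‖ ^ 2)) volume :=
    ((hS.density.isModeFT_fourier ht k).1.1.norm.aemeasurable.pow_const 2).ennreal_ofReal.const_mul _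
  rw [← lintegral_const_mul' _ _ ENNReal.ofReal_ne_top, ← lintegral_add_right' _ hmeas,
    ← lintegral_const_mul' _ _ ENNReal.ofReal_ne_top, ← lintegral_mul_const' _ _ ENNReal.ofReal_ne_top]
  -- The change of variables `ζ = ξ - kt` on the solution side.
  refine le_trans ?_
    (lintegral_sub_right_eq_self (μ := (volume : Measure ℝ)) _ ((k : ℝ) * t)).le
  refine lintegral_mono_ae ?_
  filter_upwards [hS.ae_norm_sq_dataR_le hm hk ht] with ξ hξ
  have hq := alphaRoot_pos (ξ := ξ) hk t
  have hj := jap_pos ξ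
  rw [← ENNReal.ofReal_mul (by positivity), ← ENNReal.ofReal_mul (by positivity),
    ← ENNReal.ofReal_add (by positivity) (by positivity), ← ENNReal.ofReal_mul (by positivity)]
  refine ENNReal.ofReal_le_ofReal ?_
  rw [norm_sq_fourierQ _ _ hk, ← alpha_def, ← alphaRoot_pow_four hk]
  calc _ ≤ (jap ξ)⁻¹ * (growthConst m e *
        (‖fourier (η t) k (ξ - k * t)‖ ^ 2 / (m * alphaRoot k ξ t ^ 2)
          + ‖fourier (divergence (u₁ t) (u₂ t)) k (ξ - k * t)‖ ^ 2 / alphaRoot k ξ t ^ 6)) *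
        (Real.sqrt 2 * jap ξ * alphaRoot k ξ t ^ 2) := by
        have := jap_le_mul_alphaRoot hk ξ t
        have := (jap_pos t).le
        gcongr
    _ = _ := by field_simp; ring

theorem sq_lowerConst_mul_le (hS : IsSmoothSolution m e η u₁ u₂ φ) (hm : 0 < m)
    (hη : ZeroAverage (η 0)) (hψ : ZeroAverage (divergence (u₁ 0) (u₂ 0)))
    (hω : ZeroAverage (vorticity (u₁ 0) (u₂ 0))) {t : ℝ} (ht : 0 ≤ t) :
    lowerConst m e (η 0) (divergence (u₁ 0) (u₂ 0)) (vorticity (u₁ 0) (u₂ 0)) t ^ 2 *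
      ENNReal.ofReal (jap t) ≤ ENNReal.ofReal (Real.sqrt 2 * growthConst m e) *
        (normQ (u₁ t) (u₂ t) ^ 2 + ENNReal.ofReal (1 / m) * l2Norm (η t) ^ 2) := by
  rw [lowerConst, normQ, specNorm_sq, specNorm_sq, ← tsum_lintegral_fourier_sq hS.density ht,
    ← ENNReal.tsum_mul_left, ← ENNReal.tsum_add, ← ENNReal.tsum_mul_left, ← ENNReal.tsum_mul_right]
  exact ENNReal.tsum_le_tsum (lintegral_dataR_mul_le hS hm hη hψ hω ht)

/-- Square root of the preceding bound, with `a² + b² ≤ (a + b)²` on the solution side. -/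
theorem lowerConst_mul_le (hS : IsSmoothSolution m e η u₁ u₂ φ) (hm : 0 < m)
    (hη : ZeroAverage (η 0)) (hψ : ZeroAverage (divergence (u₁ 0) (u₂ 0)))
    (hω : ZeroAverage (vorticity (u₁ 0) (u₂ 0))) {t : ℝ} (ht : 0 ≤ t) {c : ℝ} (hc : 0 ≤ c)
    (hc' : c ^ 2 * (Real.sqrt 2 * growthConst m e) ≤ 1) :
    ENNReal.ofReal c * lowerConst m e (η 0) (divergence (u₁ 0) (u₂ 0)) (vorticity (u₁ 0) (u₂ 0)) t *
        ENNReal.ofReal (jap t ^ (1 / 2 : ℝ)) ≤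
      normQ (u₁ t) (u₂ t) + ENNReal.ofReal (Real.sqrt (1 / m)) * l2Norm (η t) := by
  refine (ENNReal.pow_le_pow_left_iff two_ne_zero).1 ?_
  have hj : ENNReal.ofReal (jap t ^ (1 / 2 : ℝ)) ^ 2 = ENNReal.ofReal (jap t) := by
    rw [← ENNReal.ofReal_pow (by have := jap_pos t; positivity), ← Real.rpow_natCast,
      ← Real.rpow_mul (jap_pos t).le]
    norm_num
  have hr : ENNReal.ofReal (Real.sqrt (1 / m)) ^ 2 = ENNReal.ofReal (1 / m) := by
    rw [← ENNReal.ofReal_pow (Real.sqrt_nonneg _), Real.sq_sqrt (by positivity)]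
  rw [mul_pow, mul_pow, hj, mul_assoc, ← ENNReal.ofReal_pow hc]
  calc _ ≤ ENNReal.ofReal (c ^ 2) * (ENNReal.ofReal (Real.sqrt 2 * growthConst m e) *
        (normQ (u₁ t) (u₂ t) ^ 2 + ENNReal.ofReal (1 / m) * l2Norm (η t) ^ 2)) := by
        exact mul_le_mul_right (sq_lowerConst_mul_le hS hm hη hψ hω ht) _
    _ ≤ 1 * (normQ (u₁ t) (u₂ t) ^ 2 + ENNReal.ofReal (1 / m) * l2Norm (η t) ^ 2) := by
        rw [← mul_assoc, ← ENNReal.ofReal_mul (by positivity)]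
        gcongr
        exact ENNReal.ofReal_le_one.2 hc'
    _ ≤ _ := by
        rw [one_mul, ← hr, ← mul_pow]
        exact sq_add_sq_le_add_sq _ _

/-! ### The lower bound on the datum functional -/

theorem sqrt_alpha_zero_le (k : ℤ) (ξ : ℝ) (hk : k ≠ 0) :
    alphaRoot k ξ 0 ^ 2 ≤ jap k * jap ξ := by
  refine (sq_le_sq₀ (by positivity) (by have := jap_pos k; have := jap_pos ξ; positivity)).1 ?_
  rw [← pow_mul, alphaRoot_pow_four hk, mul_pow, jap_sq, jap_sq, alpha_def]
  nlinarith [mul_nonneg (sq_nonneg (k : ℝ)) (sq_nonneg ξ)]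

/-- The bound for the Duhamel integral. -/
noncomputable def duhamelConst (m e : ℝ) : ℝ := 2 * Real.pi * Real.sqrt (growthConst m e)

/-- The datum is the difference of the functional and the Duhamel term, and the latter is bounded
uniformly in time and frequency. -/
theorem norm_sq_initB_le (hm : 0 < m) {k : ℤ} (hk : k ≠ 0) (η₀ ψ₀ ω₀ : ℝ → ℝ → ℝ) {t : ℝ}
    (ht : 0 ≤ t) (ξ : ℝ) (i : Fin 2) :
    ‖initB m η₀ ψ₀ k ξ i‖ ^ 2 ≤ 2 * ‖dataR m e η₀ ψ₀ ω₀ t k ξ‖ ^ 2 + 2 * (duhamelConst m e ^ 2 *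
      ‖fourier (fun x y => η₀ x y + ω₀ x y) k ξ‖ ^ 2) := by
  have h := dataR_apply (e := e) (ξ := ξ) hm hk η₀ ψ₀ ω₀ t i
  have h1 : ‖dataR m e η₀ ψ₀ ω₀ t k ξ i‖ ≤ ‖dataR m e η₀ ψ₀ ω₀ t k ξ‖ := PiLp.norm_apply_le _ i
  have hJ : ‖(duhamelInt m e k ξ t i : ℂ)‖ ≤ duhamelConst m e := by
    rw [Complex.norm_real]
    exact abs_duhamelInt_le hm hk ht i
  have h2 : ‖initB m η₀ ψ₀ k ξ i‖ ≤ ‖dataR m e η₀ ψ₀ ω₀ t k ξ‖ +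
      duhamelConst m e * ‖fourier (fun x y => η₀ x y + ω₀ x y) k ξ‖ := by
    rw [eq_sub_iff_add_eq.2 h.symm]
    refine (norm_sub_le _ _).trans (add_le_add h1 ?_)
    rw [norm_mul]
    gcongr
  rw [← mul_pow]
  calc _ ≤ _ := pow_le_pow_left₀ (norm_nonneg _) h2 2
    _ ≤ _ := by rw [← mul_add]; exact add_sq_le

/-- Common form of the density and divergence estimates: `w` is the Sobolev density, compared with
one component of `B^in`, and `A` is the constant of that comparison. -/
theorem lintegral_le_of_weight {w : ℝ → ℝ} {A : ℝ} (hA : 0 ≤ A) (hm : 0 < m) {k : ℤ}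
    {η₀ ψ₀ ω₀ : ℝ → ℝ → ℝ} {t : ℝ} (ht : 0 ≤ t)
    (hF : AEStronglyMeasurable (fourier (fun x y => η₀ x y + ω₀ x y) k) volume) {i : Fin 2}
    (h0 : k = 0 → ∀ᵐ ξ, w ξ = 0)
    (hw : k ≠ 0 → ∀ ξ, w ξ ≤ A * ((jap ξ)⁻¹ * ‖initB m η₀ ψ₀ k ξ i‖ ^ 2)) :
    ∫⁻ ξ, ENNReal.ofReal (w ξ) ≤ ENNReal.ofReal (2 * A) *
      ((∫⁻ ξ : ℝ, ENNReal.ofReal (jap (k : ℝ) ^ (2 * (0 : ℝ)) * jap ξ ^ (2 * (-1 / 2) : ℝ) *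
        ‖dataR m e η₀ ψ₀ ω₀ t k ξ‖ ^ 2)) + ENNReal.ofReal (duhamelConst m e ^ 2) *
      ∫⁻ ξ : ℝ, ENNReal.ofReal (jap (k : ℝ) ^ (2 * (0 : ℝ)) * jap ξ ^ (2 * (-1 / 2) : ℝ) *
        ‖fourier (fun x y => η₀ x y + ω₀ x y) k ξ‖ ^ 2)) := by
  have hJ : ∀ ξ, jap ξ ^ (2 * (-1 / 2) : ℝ) = (jap ξ)⁻¹ := fun ξ => by
    rw [← Real.rpow_neg_one]; norm_num
  simp only [hJ, mul_zero, Real.rpow_zero, one_mul]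
  by_cases hk : k = 0
  · refine le_trans (le_of_eq ?_) (zero_le)
    refine lintegral_eq_zero_of_ae_eq_zero ?_
    filter_upwards [h0 hk] with ξ hξ
    simp [hξ]
  have hjm : Measurable fun ξ : ℝ => (jap ξ)⁻¹ := by unfold jap; fun_prop
  have hmeas : AEMeasurable (fun ξ => ENNReal.ofReal (duhamelConst m e ^ 2) * ENNReal.ofReal
      ((jap ξ)⁻¹ * ‖fourier (fun x y => η₀ x y + ω₀ x y) k ξ‖ ^ 2)) volume :=
    (hjm.aemeasurable.mul (hF.norm.aemeasurable.pow_const 2)).ennreal_ofReal.const_mul _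
  rw [← lintegral_const_mul' _ _ ENNReal.ofReal_ne_top, ← lintegral_add_right' _ hmeas,
    ← lintegral_const_mul' _ _ ENNReal.ofReal_ne_top]
  refine lintegral_mono fun ξ => ?_
  have hj := jap_pos ξ
  rw [← ENNReal.ofReal_mul (by positivity), ← ENNReal.ofReal_add (by positivity) (by positivity),
    ← ENNReal.ofReal_mul (by positivity)]
  refine ENNReal.ofReal_le_ofReal ((hw hk ξ).trans ?_)
  calc _ ≤ A * ((jap ξ)⁻¹ * (2 * ‖dataR m e η₀ ψ₀ ω₀ t k ξ‖ ^ 2 + 2 * (duhamelConst m e ^ 2 *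
        ‖fourier (fun x y => η₀ x y + ω₀ x y) k ξ‖ ^ 2))) := by
        gcongr
        exact norm_sq_initB_le hm hk η₀ ψ₀ ω₀ ht ξ i
    _ = _ := by ring

/-- From `(k² + ξ²)^{1/2} ≤ ⟨k⟩⟨ξ⟩`; the factor `m` undoes the normalization by `√m`. -/
theorem density_weight_le (hm : 0 < m) {k : ℤ} (hk : k ≠ 0) (η₀ ψ₀ : ℝ → ℝ → ℝ) (ξ : ℝ) :
    jap (k : ℝ) ^ (2 * (-1 / 2) : ℝ) * jap ξ ^ (2 * (-1) : ℝ) * ‖fourier η₀ k ξ‖ ^ 2 ≤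
      m * ((jap ξ)⁻¹ * ‖initB m η₀ ψ₀ k ξ 0‖ ^ 2) := by
  have hq := alphaRoot_pos (ξ := ξ) hk 0
  have hj := jap_pos ξ
  have hjk := jap_pos k
  have h1 : jap (k : ℝ) ^ (2 * (-1 / 2) : ℝ) = (jap (k : ℝ))⁻¹ := by
    rw [← Real.rpow_neg_one]; norm_num
  have h2 : jap ξ ^ (2 * (-1) : ℝ) = (jap ξ ^ 2)⁻¹ := by
    rw [← Real.rpow_natCast, ← Real.rpow_neg hj.le]; norm_num
  have h3 : ‖initB m η₀ ψ₀ k ξ 0‖ ^ 2 = ‖fourier η₀ k ξ‖ ^ 2 / (m * alphaRoot k ξ 0 ^ 2) := by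
    rw [initB_eq _ _ hk, Matrix.cons_val_zero, norm_div, Complex.norm_real, div_pow,
      Real.norm_of_nonneg (by positivity), mul_pow, Real.sq_sqrt hm.le]
  rw [h1, h2, h3]
  calc _ = (jap ξ)⁻¹ * (‖fourier η₀ k ξ‖ ^ 2 / (jap k * jap ξ)) := by field_simp
    _ ≤ (jap ξ)⁻¹ * (‖fourier η₀ k ξ‖ ^ 2 / alphaRoot k ξ 0 ^ 2) := by
        gcongr
        exact sqrt_alpha_zero_le k ξ hk
    _ = _ := by field_simp

/-- The cube of the inequality `(k² + ξ²)^{1/2} ≤ ⟨k⟩⟨ξ⟩`. -/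
theorem divergence_weight_le {k : ℤ} (hk : k ≠ 0) (η₀ ψ₀ : ℝ → ℝ → ℝ) (ξ : ℝ) :
    jap (k : ℝ) ^ (2 * (-3 / 2) : ℝ) * jap ξ ^ (2 * (-2) : ℝ) * ‖fourier ψ₀ k ξ‖ ^ 2 ≤
      1 * ((jap ξ)⁻¹ * ‖initB m η₀ ψ₀ k ξ 1‖ ^ 2) := by
  have hq := alphaRoot_pos (ξ := ξ) hk 0
  have hj := jap_pos ξ
  have hjk := jap_pos k
  have h1 : jap (k : ℝ) ^ (2 * (-3 / 2) : ℝ) = (jap (k : ℝ) ^ 3)⁻¹ := by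
    rw [← Real.rpow_natCast, ← Real.rpow_neg hjk.le]; norm_num
  have h2 : jap ξ ^ (2 * (-2) : ℝ) = (jap ξ ^ 4)⁻¹ := by
    rw [← Real.rpow_natCast, ← Real.rpow_neg hj.le]; norm_num
  have h3 : ‖initB m η₀ ψ₀ k ξ 1‖ ^ 2 = ‖fourier ψ₀ k ξ‖ ^ 2 / (alphaRoot k ξ 0 ^ 2) ^ 3 := by
    rw [initB_eq _ _ hk, Matrix.cons_val_one, Matrix.cons_val_zero, norm_div, Complex.norm_real,
      div_pow, Real.norm_of_nonneg (by positivity)]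
    ring
  rw [h1, h2, h3, one_mul]
  calc _ = (jap ξ)⁻¹ * (‖fourier ψ₀ k ξ‖ ^ 2 / (jap k * jap ξ) ^ 3) := by field_simp
    _ ≤ _ := by
        gcongr
        exact sqrt_alpha_zero_le k ξ hk

/-- A weighted norm of the data that is controlled, mode by mode, by the datum functional. -/
theorem specNorm_le_of_tsum_le {E : Type} [NormedAddCommGroup E] {r s : ℝ} {G : ℤ → ℝ → E}
    {A : ℝ} {η₀ ψ₀ ω₀ : ℝ → ℝ → ℝ} {t : ℝ}
    (h : ∀ k : ℤ, ∫⁻ ξ, ENNReal.ofReal (jap (k : ℝ) ^ (2 * r) * jap ξ ^ (2 * s) * ‖G k ξ‖ ^ 2) ≤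
      ENNReal.ofReal (2 * A) *
      ((∫⁻ ξ : ℝ, ENNReal.ofReal (jap (k : ℝ) ^ (2 * (0 : ℝ)) * jap ξ ^ (2 * (-1 / 2) : ℝ) *
        ‖dataR m e η₀ ψ₀ ω₀ t k ξ‖ ^ 2)) + ENNReal.ofReal (duhamelConst m e ^ 2) *
      ∫⁻ ξ : ℝ, ENNReal.ofReal (jap (k : ℝ) ^ (2 * (0 : ℝ)) * jap ξ ^ (2 * (-1 / 2) : ℝ) *
        ‖fourier (fun x y => η₀ x y + ω₀ x y) k ξ‖ ^ 2))) :
    specNorm r s G ≤ ENNReal.ofReal (Real.sqrt (2 * A)) * (lowerConst m e η₀ ψ₀ ω₀ t +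
      ENNReal.ofReal (duhamelConst m e) * sobolevNorm 0 (-1 / 2) fun x y => η₀ x y + ω₀ x y) := by
  have hd : 0 ≤ duhamelConst m e := by have := Real.pi_pos; unfold duhamelConst; positivity
  refine (ENNReal.pow_le_pow_left_iff two_ne_zero).1 ?_
  rw [mul_pow]
  have hA : ENNReal.ofReal (Real.sqrt (2 * A)) ^ 2 = ENNReal.ofReal (2 * A) := by
    rw [← ENNReal.ofReal_pow (Real.sqrt_nonneg _)]
    rcases le_total 0 (2 * A) with h0 | h0
    · rw [Real.sq_sqrt h0]
    · rw [Real.sqrt_eq_zero_of_nonpos h0, ENNReal.ofReal_of_nonpos h0]; simp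
  rw [hA]
  calc _ ≤ ENNReal.ofReal (2 * A) * (lowerConst m e η₀ ψ₀ ω₀ t ^ 2 +
        ENNReal.ofReal (duhamelConst m e ^ 2) *
          (sobolevNorm 0 (-1 / 2) fun x y => η₀ x y + ω₀ x y) ^ 2) := by
        rw [sobolevNorm, lowerConst, specNorm_sq, specNorm_sq, specNorm_sq, ← ENNReal.tsum_mul_left,
          ← ENNReal.tsum_add, ← ENNReal.tsum_mul_left]
        exact ENNReal.tsum_le_tsum h
    _ ≤ _ := by
        rw [ENNReal.ofReal_pow hd, ← mul_pow]
        gcongr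
        exact sq_add_sq_le_add_sq _ _

theorem sobolevNorm_data_le (hS : IsSmoothSolution m e η u₁ u₂ φ) (hm : 0 < m)
    (hη : ZeroAverage (η 0)) (hψ : ZeroAverage (divergence (u₁ 0) (u₂ 0)))
    (hω : ZeroAverage (vorticity (u₁ 0) (u₂ 0))) {t : ℝ} (ht : 0 ≤ t) {c : ℝ} (hc : 0 ≤ c)
    (hc' : c * (Real.sqrt (2 * m) + Real.sqrt (2 * 1)) ≤ 1) :
    ENNReal.ofReal c * (sobolevNorm (-1 / 2) (-1) (η 0) +
        sobolevNorm (-3 / 2) (-2) (divergence (u₁ 0) (u₂ 0))) ≤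
      lowerConst m e (η 0) (divergence (u₁ 0) (u₂ 0)) (vorticity (u₁ 0) (u₂ 0)) t +
        ENNReal.ofReal (duhamelConst m e) *
          sobolevNorm 0 (-1 / 2) fun x y => η 0 x y + vorticity (u₁ 0) (u₂ 0) x y := by
  have hz := ae_fourier_data_zero_mode hS hη hψ hω
  have hF := fun k => (hS.isModeFT_fourier_conserved le_rfl k).1.1
  have h1 := specNorm_le_of_tsum_le (m := m) (e := e) (A := m) (r := -1 / 2) (s := -1)
    (G := fourier (η 0)) (ψ₀ := divergence (u₁ 0) (u₂ 0)) fun k =>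
    lintegral_le_of_weight hm.le hm ht (hF k) (i := 0)
      (fun hk => by subst hk; filter_upwards [hz] with ξ hξ; simp [hξ.1])
      fun hk ξ => density_weight_le hm hk _ _ ξ
  have h2 := specNorm_le_of_tsum_le (m := m) (e := e) (A := 1) (r := -3 / 2) (s := -2)
    (G := fourier (divergence (u₁ 0) (u₂ 0))) (η₀ := η 0) fun k =>
    lintegral_le_of_weight zero_le_one hm ht (hF k) (i := 1)
      (fun hk => by subst hk; filter_upwards [hz] with ξ hξ; simp [hξ.2.1])
      fun hk ξ => divergence_weight_le hk _ _ ξ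
  calc _ ≤ ENNReal.ofReal c * (_ + _) := mul_le_mul_right (add_le_add h1 h2) _
    _ = ENNReal.ofReal (c * (Real.sqrt (2 * m) + Real.sqrt (2 * 1))) * _ := by
        rw [← add_mul, ← ENNReal.ofReal_add (Real.sqrt_nonneg _) (Real.sqrt_nonneg _), ← mul_assoc,
          ← ENNReal.ofReal_mul hc]
    _ ≤ _ := mul_le_of_le_one_left' (ENNReal.ofReal_le_one.2 hc')

end

end ElectronCouette

/-! ### The two lower bounds with a common constant. -/

open ElectronCouette in
theorem theorem1p4 (m e : ℝ) (hm : 0 < m) (he : 0 < e) :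
    ∃ c K : ℝ, 0 < c ∧ 0 < K ∧
      ∀ η u₁ u₂ φ : ℝ → ℝ → ℝ → ℝ, IsSmoothSolution m e η u₁ u₂ φ →
      ∀ η₀ ψ₀ ω₀ : ℝ → ℝ → ℝ,
        η₀ = η 0 → ψ₀ = divergence (u₁ 0) (u₂ 0) → ω₀ = vorticity (u₁ 0) (u₂ 0) →
        MemSobolev 0 (-1 / 2) η₀ → MemSobolev 0 (-1 / 2) ω₀ → MemSobolev (-3 / 2) (-2) ψ₀ →
        ZeroAverage η₀ → ZeroAverage ψ₀ → ZeroAverage ω₀ →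
        ∀ t : ℝ, 0 ≤ t →
          ENNReal.ofReal c * lowerConst m e η₀ ψ₀ ω₀ t * ENNReal.ofReal (jap t ^ (1 / 2 : ℝ))
              ≤ normQ (u₁ t) (u₂ t) + ENNReal.ofReal (Real.sqrt (1 / m)) * l2Norm (η t) ∧
          ENNReal.ofReal c * (sobolevNorm (-1 / 2) (-1) η₀ + sobolevNorm (-3 / 2) (-2) ψ₀)
              ≤ lowerConst m e η₀ ψ₀ ω₀ t
                + ENNReal.ofReal K * sobolevNorm 0 (-1 / 2) (fun x y => η₀ x y + ω₀ x y) := by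
  have hG := growthConst_pos (e := e) hm
  have hpi := Real.pi_pos
  set a := Real.sqrt (Real.sqrt 2 * growthConst m e) with ha
  set b := Real.sqrt (2 * m) + Real.sqrt (2 * 1) with hb
  have ha0 : 0 < a := by positivity
  have hb0 : 0 < b := by positivity
  have hc0 : 0 < 1 / (a + b) := by positivity
  -- The first bound needs `c a ≤ 1` and the second `c b ≤ 1`; `c = 1/(a + b)` meets both.
  refine ⟨1 / (a + b), duhamelConst m e, hc0, by unfold duhamelConst; positivity, ?_⟩
  rintro η u₁ u₂ φ hS _ _ _ rfl rfl rfl - - - hη hψ hω t ht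
  refine ⟨lowerConst_mul_le hS hm hη hψ hω ht hc0.le ?_,
    sobolevNorm_data_le hS hm hη hψ hω ht hc0.le ?_⟩
  · rw [← Real.sq_sqrt (show 0 ≤ Real.sqrt 2 * growthConst m e by positivity), ← ha, ← mul_pow]
    refine pow_le_one₀ (by positivity) ?_
    rw [one_div_mul_eq_div, div_le_one (by positivity)]
    linarith
  · rw [one_div_mul_eq_div, div_le_one (by positivity)]
    linarith
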